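/- **Setting.** Let $1\le r$ and let $X^\star\in\mathbb R^{n\times q}$ be a rank-$r$ matrix with columns $x_k^\star$ and reduced SVD $X^\star=U^\star\Sigma V^{\star\top}=U^\star B^\star$; let $\sigma_{\max},\sigma_{\min}$ be its largest and smallest nonzero singular values, $\kappa=\sigma_{\max}/\sigma_{\min}$. Assume right incoherence: $\|b_k^\star\|\le\mu\sqrt{r/q}\,\sigma_{\max}$ for every column $b_k^\star$ of $B^\star$, with some $\mu\ge1$. For $n\times r$ matrices with orthonormal columns put $\mathrm{SD}_F(U_1,U_2)=\|(I-U_1U_1^\top)U_2\|_F$. There are $L=\tilde L\rho$ nodes, arranged in $\tilde L$ batches of $\rho$ nodes, and $m=L\tilde m$. Write $M^\dagger=(M^\top M)^{-1}M^\top$ and $\psi(a,b)=(1-a)\log\frac{1-a}{1-b}+a\log\frac ab$. **Algorithm (sample splitting).** In each iteration $s=0,1,2,\dots$ every node $\ell$ has, for each $k\in[q]$, two $\tilde m\times n$ matrices $(A_k)_\ell$, $(A_k')_\ell$ with measurements $(A_k)_\ell x_k^\star$, $(A'_k)_\ell x_k^\star$; all the entries are i.i.d. standard Gaussian, and the data of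 iteration $s$ are independent of everything that exists before iteration $s$ (including $U_0,\dots,U_s$). With $U=U_s$, node $\ell$ computes $(b_k)_\ell=((A_k)_\ell U)^\dagger (A_k)_\ell x_k^\star$ and $\nabla f_\ell=\sum_k (A'_k)_\ell^\top\big((A'_k)_\ell U(b_k)_\ell-(A'_k)_\ell x_k^\star\big)(b_k)_\ell^\top$ and sends $\nabla f_\ell$ to the center. At most $\tau L$ nodes are Byzantine in each iteration (the set may change with $s$); they send arbitrary matrices, which may depend on all the data up to and including iteration $s$. The center sums the received matrices over each batch, $\nabla f_{(\vartheta)}=\sum_{\ell\in\vartheta}\nabla f_\ell$, discards the batches with $\|\nabla f_{(\vartheta)}\|_F>\omega$, computes an approximate geometric median $\nabla f_{\rm gm}$ of the remaining ones, and sets $U_{s+1}=QR\big(U_s-\frac{\eta}{\rho\tilde m}\nabla f_{\rm gm}\big)$. The approximate geometric median of $z_1,\dots,z_N$ is computed by the path-following algorithm of Cohen et al. with $T_{\rm gm}$ iterations and accuracy parameter $\epsilon_{\rm GM}\in(0,1)$: with $f(x)=\sum_i\|x-z_i\|$, $x^{(0)}$ the mean of the $z_i$, $s_i=\frac{1}{400f(x^{(0)})}(1+\frac1{600})^{i-1}$,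 $f_s(x)=\sum_i\big(g_i-\log(1+g_i)\big)$, $g_i=\sqrt{1+s^2\|x-z_i\|^2}$, $\epsilon_v=\frac18\big(\frac{\epsilon_{\rm GM}/3}{7N}\big)^2$ and $\epsilon_c=(\epsilon_v/36)^{3/2}$, line searches produce $x^{(1)},\dots,x^{(T_{\rm gm}+1)}$, and the output is $x^{(T_{\rm gm}+1)}$ (or $x^{(0)}$ if $f(x^{(0)})=0$). The computation *succeeds* if $f(x^{(0)})=0$ or $\|x^{(i)}-\arg\min f_{s_i}\|\le\epsilon_c/s_i$ for all $i\le T_{\rm gm}+1$. **Theorem.** There are numerical constants $C_1,C_2,C_3\ge1$ and, for every $C_\omega\ge1$, a constant $C_{\rm gm}\ge1$ depending only on $C_\omega$, such that the following holds. Let $0<\eta\le0.5/\sigma_{\max}^2$, $0<\epsilon<1$, $T_{\rm gm}\ge C_{\rm gm}\log\frac{Lr}{\epsilon}$, $\omega=C_\omega\,\rho\tilde m\,\sigma_{\min}^2$, and suppose $$mq\ge C_1\tilde L\kappa^4\mu^2(n+r)r^2,\qquad \tilde m\ge C_2\max(\log q,\log n,r),\qquad 0\le\tau<0.4\,\tilde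 L/L,$$ and that $U_0$ has orthonormal columns with $\mathrm{SD}_F(U^\star,U_0)\le\delta_0:=0.1/\kappa^2$ (almost surely). Put $\delta_t=\big(1-\eta\sigma_{\max}^2\frac{0.12}{\kappa^2}\big)^t\delta_0$. 1. Let $t\ge0$ be such that $\delta_t\ge\epsilon$, and let $c_{\rm approxgm}\geq 0$ bound the probability that one of the geometric median computations in iterations $0,\dots,t$ does not succeed. Then, with probability at least $$1-c_{\rm approxgm}-(t+1)\Big[Ln^{-10}+\exp\big(-L\,\psi(0.4-\tau,n^{-10})\big)\Big],$$ $\mathrm{SD}_F(U^\star,U_{t+1})\le\delta_{t+1}$, and $\|x_k^\star-(x_k)_{t+1}\|\le1.4\,\delta_{t+1}\|x_k^\star\|$ for all $k\in[q]$, where $(x_k)_{t+1}=U_{t+1}(b_k)_\ell$ is the column estimate that any good node $\ell$ computes from $U_{t+1}$ (with the next, fresh set of measurements). 2. For the first $T$ with $\delta_T\le\epsilon$, the number of real scalars exchanged between the center and one node in the $T$ iterations is at most $C_3\,\frac{\kappa^2}{\eta\sigma_{\max}^2}\,nr\log\frac1\epsilon$; for $\eta=0.5/\sigma_{\max}^2$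 this is of order $\kappa^2nr\log\frac1\epsilon$. -/

import Mathlib

open MeasureTheory ProbabilityTheory
open scoped Matrix Matrix.Norms.Frobenius

/-!
Throughout, the norm of a matrix is the Frobenius norm, and the norm of a vector `v` is the
Euclidean norm `‖WithLp.toLp 2 v‖`.
-/

namespace ByzAltGDmin

noncomputable section

/-- `SD_F(U₁, U₂) = ‖(I - U₁ U₁ᵀ) U₂‖_F`. -/
def subspaceDist {n r : ℕ} (U₁ U₂ : Matrix (Fin n) (Fin r) ℝ) : ℝ :=
  ‖(1 - U₁ * U₁ᵀ) * U₂‖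

/-- `Q` is the orthonormal factor of a QR decomposition `M = Q R`. -/
def IsQRFactor {n r : ℕ} (M Q : Matrix (Fin n) (Fin r) ℝ) : Prop :=
  Qᵀ * Q = 1 ∧ ∃ R : Matrix (Fin r) (Fin r) ℝ, R.BlockTriangular id ∧ M = Q * R

/-- `M† = (Mᵀ M)⁻¹ Mᵀ`. -/
def pinv {m r : ℕ} (M : Matrix (Fin m) (Fin r) ℝ) : Matrix (Fin r) (Fin m) ℝ :=
  (Mᵀ * M)⁻¹ * Mᵀ

/-- Binary Kullback-Leibler divergence. -/
def psi (a b : ℝ) : ℝ :=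
  (1 - a) * Real.log ((1 - a) / (1 - b)) + a * Real.log (a / b)

/-- The reduced SVD `X = U diag(σ) Vᵀ` of a rank `r` matrix. (The `σ i` need not be listed in
decreasing order; only their maximum and minimum are used.) -/
structure IsReducedSVD {n q r : ℕ} (X : Matrix (Fin n) (Fin q) ℝ)
    (U : Matrix (Fin n) (Fin r) ℝ) (σ : Fin r → ℝ) (V : Matrix (Fin q) (Fin r) ℝ) : Prop where
  left_orthonormal : Uᵀ * U = 1
  right_orthonormal : Vᵀ * V = 1
  pos : ∀ i, 0 < σ i
  eq : X = U * Matrix.diagonal σ * Vᵀ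

/-- The largest singular value. -/
def sigmaMax {r : ℕ} (σ : Fin r → ℝ) : ℝ := ⨆ i, σ i

/-- The smallest nonzero singular value. -/
def sigmaMin {r : ℕ} (σ : Fin r → ℝ) : ℝ := ⨅ i, σ i

/-- The condition number. -/
def kappa {r : ℕ} (σ : Fin r → ℝ) : ℝ := sigmaMax σ / sigmaMin σ

/-- Incoherence of the right singular vectors: with `B = diag(σ) Vᵀ` and `b_k` its `k`-th column,
`‖b_k‖ ≤ μ √(r/q) σ_max` for all `k`. -/
def RightIncoherent {q r : ℕ} (σ : Fin r → ℝ) (V : Matrix (Fin q) (Fin r) ℝ) (μ : ℝ) : Prop :=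
  ∀ k, ‖WithLp.toLp 2 ((Matrix.diagonal σ * Vᵀ).col k)‖ ≤
    μ * Real.sqrt ((r : ℝ) / q) * sigmaMax σ

/-! ### Geometric median -/

section GeometricMedian

variable {ι E : Type*} [NormedAddCommGroup E] [NormedSpace ℝ E]

/-- The geometric median objective of the points `z i`, `i ∈ K`. -/
def gmObjective (K : Finset ι) (z : ι → E) (x : E) : ℝ := ∑ i ∈ K, ‖x - z i‖

/-- The smoothed objective `f_s` whose minimizers `x_s` form the central path. -/
def gmPenalized (K : Finset ι) (z : ι → E) (s : ℝ) (x : E) : ℝ :=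
  ∑ i ∈ K, (Real.sqrt (1 + s ^ 2 * ‖x - z i‖ ^ 2)
    - Real.log (1 + Real.sqrt (1 + s ^ 2 * ‖x - z i‖ ^ 2)))

/-- The starting point of the algorithm: the mean of the input points. -/
def gmStart (K : Finset ι) (z : ι → E) : E := (K.card : ℝ)⁻¹ • ∑ i ∈ K, z i

/-- The path parameters `s_{i+1} = (1 + 1/600)^i / (400 f(x⁽⁰⁾))`, `i = 0, 1, …`. -/
def gmPathParam (K : Finset ι) (z : ι → E) (i : ℕ) : ℝ :=
  1 / (400 * gmObjective K z (gmStart K z)) * (1 + 1 / 600) ^ i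

/-- `ε_v = (1/8) ((ε_GM / 3) / (7 N))²` for `N` input points. -/
def gmEpsV (N : ℕ) (εGM : ℝ) : ℝ := 1 / 8 * (εGM / 3 / (7 * N)) ^ 2

/-- The centering tolerance `ε_c = (ε_v / 36)^(3/2)`. -/
def gmEpsC (N : ℕ) (εGM : ℝ) : ℝ := (gmEpsV N εGM / 36) ^ (3 / 2 : ℝ)

/-- The path-following median algorithm produces `x⁽¹⁾, x⁽²⁾, …, x⁽ᵀ⁺¹⁾` by line searches
(`x i` stands for `x⁽ⁱ⁺¹⁾`). All of them meet their target: `x⁽ⁱ⁾` is within `ε_c / s_i` of the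
minimizer of `f_{s_i}`. No line search takes place if all input points coincide. -/
def LineSearchesSucceed (K : Finset ι) (z : ι → E) (εGM : ℝ) (T : ℕ) (x : ℕ → E) : Prop :=
  gmObjective K z (gmStart K z) = 0 ∨
    ∀ i ≤ T, ∃ c : E, IsMinOn (gmPenalized K z (gmPathParam K z i)) Set.univ c ∧
      ‖x i - c‖ ≤ gmEpsC K.card εGM / gmPathParam K z i

open Classical in
/-- The output after `T` iterations: the last iterate, or the starting point if the latter has
objective value zero (all input points coincide, or there are none). -/
def approxGM (K : Finset ι) (z : ι → E) (T : ℕ) (x : ℕ → E) : E :=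
  if gmObjective K z (gmStart K z) = 0 then gmStart K z else x T

end GeometricMedian

/-! ### Node computations -/

/-- The least squares coefficient `b_k = (A_k U)† y_k`, with `y_k = A_k x_k`. -/
def lsCoeff {m n r : ℕ} (A : Matrix (Fin m) (Fin n) ℝ) (U : Matrix (Fin n) (Fin r) ℝ)
    (x : Fin n → ℝ) : Fin r → ℝ :=
  pinv (A * U) *ᵥ (A *ᵥ x)

/-- The column estimate `U b_k`. -/
def columnEstimate {m n r : ℕ} (A : Matrix (Fin m) (Fin n) ℝ) (U : Matrix (Fin n) (Fin r) ℝ)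
    (x : Fin n → ℝ) : Fin n → ℝ :=
  U *ᵥ lsCoeff A U x

/-- The gradient `∑ₖ A_kᵀ (A_k U b_k - y_k) b_kᵀ` of a node. By sample splitting the coefficients
`b_k` are computed from `A₁`, while the gradient is computed from the independent `A₂`. -/
def nodeGradient {m n q r : ℕ} (A₁ A₂ : Fin q → Matrix (Fin m) (Fin n) ℝ)
    (X : Matrix (Fin n) (Fin q) ℝ) (U : Matrix (Fin n) (Fin r) ℝ) : Matrix (Fin n) (Fin r) ℝ :=
  ∑ k, Matrix.vecMulVec
    ((A₂ k)ᵀ *ᵥ (A₂ k *ᵥ (U *ᵥ lsCoeff (A₁ k) U (X.col k)) - A₂ k *ᵥ X.col k))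
    (lsCoeff (A₁ k) U (X.col k))

/-! ### The federated system -/

/-- The `L = Lt ρ` nodes, arranged in `Lt` batches of `ρ` nodes each. -/
abbrev Node (Lt ρ : ℕ) : Type := Fin Lt × Fin ρ

/-- Each iteration uses two independent sets of measurements: one to update `B`
and one to update `U`. -/
inductive Phase : Type
  | updateB : Phase
  | updateU : Phase

/-- Sum of the messages of the nodes of batch `θ`. -/
def batchSum {Lt ρ n r : ℕ} (Z : Node Lt ρ → Matrix (Fin n) (Fin r) ℝ) (θ : Fin Lt) :
    Matrix (Fin n) (Fin r) ℝ :=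
  ∑ j, Z (θ, j)

open Classical in
/-- The batches that survive thresholding. -/
def keptBatches {Lt ρ n r : ℕ} (thr : ℝ) (Z : Node Lt ρ → Matrix (Fin n) (Fin r) ℝ) :
    Finset (Fin Lt) :=
  Finset.univ.filter fun θ => ‖batchSum Z θ‖ ≤ thr

/-- Random Gaussian measurements with sample splitting. `A s p ℓ k` is the `mt × n` measurement
matrix of node `ℓ` for column `k`, used in phase `p` of iteration `s` (iterations are numbered
`s = 0, 1, …`; iteration `s` turns `U_s` into `U_{s+1}`). `F s` is the information that exists
before iteration `s`: the data of iteration `s` are independent of it. -/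
structure IsSampleSplitGaussian {Ω : Type*} [mΩ : MeasurableSpace Ω] (P : Measure Ω)
    {mt n q Lt ρ : ℕ} (F : Filtration ℕ mΩ)
    (A : ℕ → Phase → Node Lt ρ → Fin q → Ω → Matrix (Fin mt) (Fin n) ℝ) : Prop where
  adapted : ∀ s p ℓ k i j, Measurable[F (s + 1)] fun ω => A s p ℓ k ω i j
  gaussian : ∀ s p ℓ k i j, P.map (fun ω => A s p ℓ k ω i j) = gaussianReal 0 1
  indep_entries : ∀ s, iIndepFun
    (fun (a : Phase × Node Lt ρ × Fin q × Fin mt × Fin n) ω =>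
      A s a.1 a.2.1 a.2.2.1 ω a.2.2.2.1 a.2.2.2.2) P
  fresh : ∀ s, Indep
    (MeasurableSpace.comap
      (fun ω (a : Phase × Node Lt ρ × Fin q × Fin mt × Fin n) =>
        A s a.1 a.2.1 a.2.2.1 ω a.2.2.2.1 a.2.2.2.2) inferInstance)
    (F s) P

/-- A run of the Byzantine-resilient altGDmin iterations.

* `good s` is the set of non-Byzantine nodes in iteration `s`;
* `Z s ℓ` is the message that the center receives from node `ℓ` in iteration `s`. It is the honest
  gradient if `ℓ` is good. The Byzantine messages are arbitrary: they may depend on everything that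
  exists up to and including iteration `s`, in particular on the data of all the nodes;
* `x s` are the iterates of the geometric median computation in iteration `s`;
* `U s` is the subspace estimate, known before iteration `s`. -/
structure IsRun {Ω : Type*} [mΩ : MeasurableSpace Ω] {mt n q r Lt ρ : ℕ} (F : Filtration ℕ mΩ)
    (A : ℕ → Phase → Node Lt ρ → Fin q → Ω → Matrix (Fin mt) (Fin n) ℝ)
    (X : Matrix (Fin n) (Fin q) ℝ) (good : ℕ → Finset (Node Lt ρ))
    (η thr : ℝ) (Tgm : ℕ)
    (Z : ℕ → Node Lt ρ → Ω → Matrix (Fin n) (Fin r) ℝ)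
    (x : ℕ → Ω → ℕ → Matrix (Fin n) (Fin r) ℝ)
    (U : ℕ → Ω → Matrix (Fin n) (Fin r) ℝ) : Prop where
  init : ∀ ω, (U 0 ω)ᵀ * U 0 ω = 1
  adapted : ∀ s i j, Measurable[F s] fun ω => U s ω i j
  honest : ∀ s, ∀ ℓ ∈ good s, ∀ ω, Z s ℓ ω =
    nodeGradient (fun k => A s .updateB ℓ k ω) (fun k => A s .updateU ℓ k ω) X (U s ω)
  update : ∀ s ω, IsQRFactor
    (U s ω - (η / (ρ * mt : ℝ)) •
      approxGM (keptBatches thr fun ℓ => Z s ℓ ω) (batchSum fun ℓ => Z s ℓ ω) Tgm (x s ω))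
    (U (s + 1) ω)

/-- The geometric median computation of iteration `s` succeeds in outcome `ω`. -/
def GMSucceeds {Ω : Type*} {n r Lt ρ : ℕ} (thr εGM : ℝ) (Tgm : ℕ)
    (Z : ℕ → Node Lt ρ → Ω → Matrix (Fin n) (Fin r) ℝ)
    (x : ℕ → Ω → ℕ → Matrix (Fin n) (Fin r) ℝ) (s : ℕ) (ω : Ω) : Prop :=
  LineSearchesSucceed (keptBatches thr fun ℓ => Z s ℓ ω) (batchSum fun ℓ => Z s ℓ ω) εGM Tgm
    (x s ω)

/-- `δ_t = (1 - η σ_max² · 0.12 / κ²)^t · 0.1 / κ²`. -/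
def errorBound {r : ℕ} (σ : Fin r → ℝ) (η : ℝ) (t : ℕ) : ℝ :=
  (1 - η * sigmaMax σ ^ 2 * (0.12 / kappa σ ^ 2)) ^ t * (0.1 / kappa σ ^ 2)

/-- The number of real scalars exchanged between the center and one node in `T` iterations: in each
of them the node pushes an `n × r` gradient and the center pushes back an `n × r` matrix. -/
def scalarsExchanged (n r T : ℕ) : ℕ :=
  ∑ _s ∈ Finset.range T, (Fintype.card (Fin n × Fin r) + Fintype.card (Fin n × Fin r))

end

end ByzAltGDmin

/-!
Let `U` have orthonormal columns that nearly span those of `Ustar`. If the coefficients were the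
exact ones, `b_k = Uᵀ x_k`, then the expected gradient of a batch would be a multiple of
`E = (U Uᵀ X - X) (Uᵀ X)ᵀ`, and for `Pstar = 1 - Ustar Ustarᵀ`
`Pstar (U - η Y) = Pstar U (1 - η (Uᵀ X) (Uᵀ X)ᵀ) - η Pstar (Y - E)` since `Pstar X = 0`.
The Gram matrix is bounded below by nearly `σ_min²`, so a gradient step whose direction `Y` is
within `0.3 δ σ_min²` of `E` contracts the subspace distance `δ`. Passing to the orthonormal factor
costs little because `Uᵀ E = 0`.

The gradients actually computed are close to multiples of `E`. As the data of an iteration are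
independent of `U`, one may fix `U`; then the measurements `A U` are independent of those of the
component of `x_k` orthogonal to `U`, so that the least squares coefficients are accurate, and so
are the sums over a batch, by sub-exponential concentration on a net of the unit ball. Right
incoherence keeps any single column from dominating these sums.

More than `60 %` of the batches contain no Byzantine node, so their sums, which survive the
threshold, form a majority of those kept, and an approximate minimizer of the sum of distances to
the kept sums cannot be far from this cluster. The error of the path-following method decays like
`(600 / 601) ^ Tgm`. The theorem follows by induction over the iterations and a union bound over
their failures, with one more iteration for the fresh data that estimate the columns.
-/

namespace ByzAltGDmin

noncomputable section

/-! ### Euclidean norms of vectors and Frobenius norms of matrices -/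

section LinearAlgebra

variable {ι κ ν : Type*} [Fintype ι] [Fintype κ]

/-- The Euclidean norm of a vector; the norm instance of `ι → ℝ` is the sup norm. -/
def vnorm (v : ι → ℝ) : ℝ := ‖WithLp.toLp 2 v‖

theorem vnorm_nonneg (v : ι → ℝ) : 0 ≤ vnorm v := norm_nonneg _

theorem vnorm_sq (v : ι → ℝ) : vnorm v ^ 2 = v ⬝ᵥ v := by
  rw [vnorm, EuclideanSpace.norm_sq_eq]
  simp [dotProduct, pow_two]

theorem vnorm_sq_eq_sum (v : ι → ℝ) : vnorm v ^ 2 = ∑ i, v i ^ 2 := by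
  rw [vnorm_sq]
  simp only [dotProduct, pow_two]

theorem vnorm_zero : vnorm (0 : ι → ℝ) = 0 := by simp [vnorm]

theorem vnorm_eq_zero {v : ι → ℝ} : vnorm v = 0 ↔ v = 0 := by simp [vnorm]

theorem vnorm_add_le (v w : ι → ℝ) : vnorm (v + w) ≤ vnorm v + vnorm w :=
  norm_add_le (WithLp.toLp 2 v) (WithLp.toLp 2 w)

theorem vnorm_sub_le (v w : ι → ℝ) : vnorm (v - w) ≤ vnorm v + vnorm w :=
  norm_sub_le (WithLp.toLp 2 v) (WithLp.toLp 2 w)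

theorem vnorm_smul (c : ℝ) (v : ι → ℝ) : vnorm (c • v) = |c| * vnorm v := by
  simp [vnorm, norm_smul]

theorem dotProduct_le_vnorm_mul_vnorm (v w : ι → ℝ) : v ⬝ᵥ w ≤ vnorm v * vnorm w := by
  have h := real_inner_le_norm (WithLp.toLp 2 w) (WithLp.toLp 2 v)
  rwa [EuclideanSpace.inner_toLp_toLp, star_trivial, mul_comm] at h

theorem transpose_mulVec_dotProduct (M : Matrix ι κ ℝ) (v : ι → ℝ) (w : κ → ℝ) :
    (Mᵀ *ᵥ v) ⬝ᵥ w = v ⬝ᵥ (M *ᵥ w) := by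
  rw [Matrix.dotProduct_mulVec, Matrix.mulVec_transpose]

theorem vnorm_sq_mulVec (M : Matrix ι κ ℝ) (v : κ → ℝ) :
    vnorm (M *ᵥ v) ^ 2 = v ⬝ᵥ ((Mᵀ * M) *ᵥ v) := by
  rw [vnorm_sq, ← transpose_mulVec_dotProduct, Matrix.mulVec_mulVec, dotProduct_comm]

omit [Fintype ι] in
theorem col_mul (M : Matrix ι κ ℝ) (N : Matrix κ ν ℝ) (k : ν) :
    (M * N).col k = M *ᵥ N.col k := by
  ext i
  simp [Matrix.mul_apply, Matrix.mulVec, dotProduct]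

theorem frobenius_norm_sq (M : Matrix ι κ ℝ) : ‖M‖ ^ 2 = ∑ i, ∑ j, M i j ^ 2 := by
  rw [Matrix.frobenius_norm_def, ← Real.sqrt_eq_rpow, Real.sq_sqrt (by positivity)]
  simp

theorem frobenius_norm_sq_eq_sum_col (M : Matrix ι κ ℝ) :
    ‖M‖ ^ 2 = ∑ k, vnorm (M.col k) ^ 2 := by
  simp only [frobenius_norm_sq, vnorm_sq_eq_sum, Matrix.col_apply]
  exact Finset.sum_comm

theorem frobenius_norm_sq_eq_trace (M : Matrix ι κ ℝ) : ‖M‖ ^ 2 = (Mᵀ * M).trace := by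
  rw [frobenius_norm_sq, Finset.sum_comm]
  simp [Matrix.trace, Matrix.mul_apply, pow_two]

theorem frobenius_norm_vecMulVec (v : ι → ℝ) (w : κ → ℝ) :
    ‖Matrix.vecMulVec v w‖ = vnorm v * vnorm w := by
  rw [← sq_eq_sq₀ (norm_nonneg _) (mul_nonneg (vnorm_nonneg _) (vnorm_nonneg _)),
    frobenius_norm_sq, mul_pow, vnorm_sq_eq_sum, vnorm_sq_eq_sum, Finset.sum_mul_sum]
  simp only [Matrix.vecMulVec_apply, mul_pow]

theorem vnorm_mulVec_le (M : Matrix ι κ ℝ) (v : κ → ℝ) : vnorm (M *ᵥ v) ≤ ‖M‖ * vnorm v := by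
  simpa only [vnorm, ← Matrix.frobenius_norm_replicateCol (ι := Unit),
    Matrix.replicateCol_mulVec] using Matrix.frobenius_norm_mul M (Matrix.replicateCol Unit v)

theorem frobenius_norm_mul_le_of_vnorm_mulVec_le [Fintype ν] {M : Matrix ι κ ℝ} {c : ℝ}
    (hc : 0 ≤ c) (hM : ∀ v, vnorm (M *ᵥ v) ≤ c * vnorm v) (N : Matrix κ ν ℝ) :
    ‖M * N‖ ≤ c * ‖N‖ := by
  refine (sq_le_sq₀ (norm_nonneg _) (by positivity)).1 ?_
  simp only [mul_pow, frobenius_norm_sq_eq_sum_col, Finset.mul_sum, col_mul]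
  refine Finset.sum_le_sum fun k _ => ?_
  rw [← mul_pow]
  exact pow_le_pow_left₀ (vnorm_nonneg _) (hM _) 2

section Diagonal

variable [DecidableEq κ] {σ : κ → ℝ} {c : ℝ}

theorem vnorm_diagonal_mulVec_le (hσ : ∀ i, |σ i| ≤ c) (hc : 0 ≤ c) (v : κ → ℝ) :
    vnorm (Matrix.diagonal σ *ᵥ v) ≤ c * vnorm v := by
  refine (sq_le_sq₀ (vnorm_nonneg _) (mul_nonneg hc (vnorm_nonneg _))).1 ?_
  simp only [mul_pow, vnorm_sq_eq_sum, Matrix.mulVec_diagonal, Finset.mul_sum]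
  exact Finset.sum_le_sum fun i _ =>
    mul_le_mul_of_nonneg_right (sq_le_sq.2 ((hσ i).trans (le_abs_self c))) (sq_nonneg _)

theorem le_vnorm_diagonal_mulVec (hσ : ∀ i, c ≤ σ i) (hc : 0 ≤ c) (v : κ → ℝ) :
    c * vnorm v ≤ vnorm (Matrix.diagonal σ *ᵥ v) := by
  refine (sq_le_sq₀ (mul_nonneg hc (vnorm_nonneg _)) (vnorm_nonneg _)).1 ?_
  simp only [mul_pow, vnorm_sq_eq_sum, Matrix.mulVec_diagonal, Finset.mul_sum]
  exact Finset.sum_le_sum fun i _ =>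
    mul_le_mul_of_nonneg_right (pow_le_pow_left₀ hc (hσ i) 2) (sq_nonneg _)

end Diagonal

section Orthonormal

variable [DecidableEq κ] {U : Matrix ι κ ℝ}

theorem mulVec_dotProduct_mulVec (hU : Uᵀ * U = 1) (v w : κ → ℝ) :
    (U *ᵥ v) ⬝ᵥ (U *ᵥ w) = v ⬝ᵥ w := by
  rw [← transpose_mulVec_dotProduct, Matrix.mulVec_mulVec, hU, Matrix.one_mulVec]

theorem vnorm_orthonormal_mulVec (hU : Uᵀ * U = 1) (v : κ → ℝ) : vnorm (U *ᵥ v) = vnorm v := by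
  rw [← sq_eq_sq₀ (vnorm_nonneg _) (vnorm_nonneg _), vnorm_sq, vnorm_sq,
    mulVec_dotProduct_mulVec hU]

theorem card_le_card_of_orthonormal (hU : Uᵀ * U = 1) : Fintype.card κ ≤ Fintype.card ι := by
  have h := (Matrix.rank_mul_le_left Uᵀ U).trans (Matrix.rank_le_card_width Uᵀ)
  rwa [hU, Matrix.rank_one] at h

omit [DecidableEq κ] in
/-- The component of `x` orthogonal to the range of a matrix `U` with orthonormal columns. -/
def residual (U : Matrix ι κ ℝ) (x : ι → ℝ) : ι → ℝ := x - U *ᵥ (Uᵀ *ᵥ x)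

omit [DecidableEq κ] in
theorem residual_eq_mulVec [DecidableEq ι] (U : Matrix ι κ ℝ) (x : ι → ℝ) :
    residual U x = (1 - U * Uᵀ) *ᵥ x := by
  rw [residual, Matrix.sub_mulVec, Matrix.one_mulVec, Matrix.mulVec_mulVec]

theorem transpose_mulVec_residual (hU : Uᵀ * U = 1) (x : ι → ℝ) : Uᵀ *ᵥ residual U x = 0 := by
  rw [residual, Matrix.mulVec_sub, Matrix.mulVec_mulVec _ Uᵀ U, hU, Matrix.one_mulVec, sub_self]

theorem vnorm_sq_transpose_mulVec_add_vnorm_sq_residual (hU : Uᵀ * U = 1) (x : ι → ℝ) :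
    vnorm (Uᵀ *ᵥ x) ^ 2 + vnorm (residual U x) ^ 2 = vnorm x ^ 2 := by
  have orthogonal : residual U x ⬝ᵥ (U *ᵥ (Uᵀ *ᵥ x)) = 0 := by
    rw [← transpose_mulVec_dotProduct, transpose_mulVec_residual hU, zero_dotProduct]
  have split : x = residual U x + U *ᵥ (Uᵀ *ᵥ x) := (sub_add_cancel _ _).symm
  conv_rhs => rw [split]
  rw [vnorm_sq (_ + _), add_dotProduct, dotProduct_add, dotProduct_add, orthogonal,
    dotProduct_comm (U *ᵥ _) (residual U x), orthogonal, mulVec_dotProduct_mulVec hU, vnorm_sq,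
    vnorm_sq]
  ring

theorem vnorm_transpose_mulVec_le (hU : Uᵀ * U = 1) (x : ι → ℝ) :
    vnorm (Uᵀ *ᵥ x) ≤ vnorm x := by
  rw [← sq_le_sq₀ (vnorm_nonneg _) (vnorm_nonneg _),
    ← vnorm_sq_transpose_mulVec_add_vnorm_sq_residual hU x]
  exact le_add_of_nonneg_right (sq_nonneg _)

theorem vnorm_residual_le (hU : Uᵀ * U = 1) (x : ι → ℝ) : vnorm (residual U x) ≤ vnorm x := by
  rw [← sq_le_sq₀ (vnorm_nonneg _) (vnorm_nonneg _),
    ← vnorm_sq_transpose_mulVec_add_vnorm_sq_residual hU x]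
  exact le_add_of_nonneg_left (sq_nonneg _)

variable [Fintype ν]

theorem frobenius_norm_orthonormal_mul_le (hU : Uᵀ * U = 1) (M : Matrix κ ν ℝ) :
    ‖U * M‖ ≤ ‖M‖ := by
  simpa using frobenius_norm_mul_le_of_vnorm_mulVec_le zero_le_one
    (fun v => by rw [one_mul, vnorm_orthonormal_mulVec hU]) M

theorem frobenius_norm_transpose_orthonormal_mul_le (hU : Uᵀ * U = 1) (M : Matrix ι ν ℝ) :
    ‖Uᵀ * M‖ ≤ ‖M‖ := by
  simpa using frobenius_norm_mul_le_of_vnorm_mulVec_le zero_le_one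
    (fun v => by rw [one_mul]; exact vnorm_transpose_mulVec_le hU v) M

theorem frobenius_norm_mul_orthonormal_le (hU : Uᵀ * U = 1) (M : Matrix ν ι ℝ) :
    ‖M * U‖ ≤ ‖M‖ := by
  rw [← Matrix.frobenius_norm_transpose, Matrix.transpose_mul, ← Matrix.frobenius_norm_transpose M]
  exact frobenius_norm_transpose_orthonormal_mul_le hU _

theorem frobenius_norm_mul_transpose_orthonormal_le (hU : Uᵀ * U = 1) (M : Matrix ν κ ℝ) :
    ‖M * Uᵀ‖ ≤ ‖M‖ := by
  rw [← Matrix.frobenius_norm_transpose, Matrix.transpose_mul, ← Matrix.frobenius_norm_transpose M,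
    Matrix.transpose_transpose]
  exact frobenius_norm_orthonormal_mul_le hU _

theorem frobenius_norm_proj_compl_mul_le [DecidableEq ι] (hU : Uᵀ * U = 1) (M : Matrix ι ν ℝ) :
    ‖(1 - U * Uᵀ) * M‖ ≤ ‖M‖ := by
  simpa using frobenius_norm_mul_le_of_vnorm_mulVec_le zero_le_one
    (fun v => by rw [one_mul, ← residual_eq_mulVec]; exact vnorm_residual_le hU v) M

end Orthonormal

end LinearAlgebra

/-! ### Subspace distance -/

section SubspaceDist

variable {n r : ℕ} {U₁ U₂ : Matrix (Fin n) (Fin r) ℝ}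

theorem subspaceDist_nonneg (U₁ U₂ : Matrix (Fin n) (Fin r) ℝ) : 0 ≤ subspaceDist U₁ U₂ :=
  norm_nonneg _

theorem transpose_proj_compl_mul_self (h₁ : U₁ᵀ * U₁ = 1) :
    (1 - U₁ * U₁ᵀ)ᵀ * (1 - U₁ * U₁ᵀ) = 1 - U₁ * U₁ᵀ := by
  have idem : U₁ * U₁ᵀ * (U₁ * U₁ᵀ) = U₁ * U₁ᵀ := by
    rw [Matrix.mul_assoc, ← Matrix.mul_assoc U₁ᵀ, h₁, Matrix.one_mul]
  simp only [Matrix.transpose_sub, Matrix.transpose_one, Matrix.transpose_mul,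
    Matrix.transpose_transpose, sub_mul, mul_sub, one_mul, mul_one, idem, sub_self, sub_zero]

theorem subspaceDist_sq (h₁ : U₁ᵀ * U₁ = 1) (h₂ : U₂ᵀ * U₂ = 1) :
    subspaceDist U₁ U₂ ^ 2 = r - ‖U₁ᵀ * U₂‖ ^ 2 := by
  have gram : ((1 - U₁ * U₁ᵀ) * U₂)ᵀ * ((1 - U₁ * U₁ᵀ) * U₂) =
      1 - (U₁ᵀ * U₂)ᵀ * (U₁ᵀ * U₂) := by
    rw [Matrix.transpose_mul, Matrix.mul_assoc, ← Matrix.mul_assoc _ _ U₂,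
      transpose_proj_compl_mul_self h₁, Matrix.sub_mul, Matrix.mul_sub, Matrix.one_mul, h₂]
    simp only [Matrix.transpose_mul, Matrix.transpose_transpose, Matrix.mul_assoc]
  rw [subspaceDist, frobenius_norm_sq_eq_trace, frobenius_norm_sq_eq_trace, gram,
    Matrix.trace_sub, Matrix.trace_one, Fintype.card_fin]

theorem subspaceDist_comm (h₁ : U₁ᵀ * U₁ = 1) (h₂ : U₂ᵀ * U₂ = 1) :
    subspaceDist U₁ U₂ = subspaceDist U₂ U₁ := by
  rw [← sq_eq_sq₀ (subspaceDist_nonneg _ _) (subspaceDist_nonneg _ _), subspaceDist_sq h₁ h₂,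
    subspaceDist_sq h₂ h₁, ← Matrix.frobenius_norm_transpose (U₁ᵀ * U₂), Matrix.transpose_mul,
    Matrix.transpose_transpose]

end SubspaceDist

/-! ### Reduced singular value decompositions -/

section ReducedSVD

variable {p n q r : ℕ} {X : Matrix (Fin n) (Fin q) ℝ} {Ustar U : Matrix (Fin n) (Fin r) ℝ}
  {σ : Fin r → ℝ} {V : Matrix (Fin q) (Fin r) ℝ} {δ : ℝ}

theorem le_sigmaMax (σ : Fin r → ℝ) (i : Fin r) : σ i ≤ sigmaMax σ :=
  le_ciSup (Set.finite_range σ).bddAbove i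

theorem sigmaMin_le (σ : Fin r → ℝ) (i : Fin r) : sigmaMin σ ≤ σ i :=
  ciInf_le (Set.finite_range σ).bddBelow i

theorem sigmaMin_le_sigmaMax (σ : Fin r → ℝ) : sigmaMin σ ≤ sigmaMax σ := by
  rcases isEmpty_or_nonempty (Fin r) with h | ⟨⟨i⟩⟩
  · simp [sigmaMin, sigmaMax]
  · exact (sigmaMin_le σ i).trans (le_sigmaMax σ i)

namespace IsReducedSVD

theorem sigmaMin_nonneg (hX : IsReducedSVD X Ustar σ V) : 0 ≤ sigmaMin σ :=
  Real.iInf_nonneg fun i => (hX.pos i).le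

theorem sigmaMax_nonneg (hX : IsReducedSVD X Ustar σ V) : 0 ≤ sigmaMax σ :=
  Real.iSup_nonneg fun i => (hX.pos i).le

theorem sigmaMin_pos [NeZero r] (hX : IsReducedSVD X Ustar σ V) : 0 < sigmaMin σ := by
  obtain ⟨i, hi⟩ := exists_eq_ciInf_of_finite (f := σ)
  rw [sigmaMin, ← hi]
  exact hX.pos i

theorem sigmaMax_pos [NeZero r] (hX : IsReducedSVD X Ustar σ V) : 0 < sigmaMax σ :=
  hX.sigmaMin_pos.trans_le (sigmaMin_le_sigmaMax σ)

theorem one_le_kappa [NeZero r] (hX : IsReducedSVD X Ustar σ V) : 1 ≤ kappa σ := by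
  rw [kappa, one_le_div hX.sigmaMin_pos]
  exact sigmaMin_le_sigmaMax σ

theorem abs_le_sigmaMax (hX : IsReducedSVD X Ustar σ V) (i : Fin r) : |σ i| ≤ sigmaMax σ := by
  rw [abs_of_pos (hX.pos i)]
  exact le_sigmaMax σ i

theorem vnorm_mulVec_le (hX : IsReducedSVD X Ustar σ V) (v : Fin q → ℝ) :
    vnorm (X *ᵥ v) ≤ sigmaMax σ * vnorm v := by
  rw [hX.eq, ← Matrix.mulVec_mulVec, ← Matrix.mulVec_mulVec,
    vnorm_orthonormal_mulVec hX.left_orthonormal]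
  exact (vnorm_diagonal_mulVec_le hX.abs_le_sigmaMax hX.sigmaMax_nonneg _).trans
    (mul_le_mul_of_nonneg_left (vnorm_transpose_mulVec_le hX.right_orthonormal v)
      hX.sigmaMax_nonneg)

theorem norm_mul_le (hX : IsReducedSVD X Ustar σ V) (M : Matrix (Fin p) (Fin n) ℝ) :
    ‖M * X‖ ≤ ‖M * Ustar‖ * sigmaMax σ := by
  rw [hX.eq, ← Matrix.mul_assoc, ← Matrix.mul_assoc]
  refine (frobenius_norm_mul_transpose_orthonormal_le hX.right_orthonormal _).trans ?_
  rw [← Matrix.frobenius_norm_transpose, Matrix.transpose_mul, Matrix.diagonal_transpose,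
    ← Matrix.frobenius_norm_transpose (M * Ustar), mul_comm]
  exact frobenius_norm_mul_le_of_vnorm_mulVec_le hX.sigmaMax_nonneg
    (vnorm_diagonal_mulVec_le hX.abs_le_sigmaMax hX.sigmaMax_nonneg) _

theorem proj_compl_mul_self (hX : IsReducedSVD X Ustar σ V) : (1 - Ustar * Ustarᵀ) * X = 0 := by
  rw [hX.eq, Matrix.sub_mul, Matrix.one_mul, Matrix.mul_assoc Ustar, Matrix.mul_assoc Ustar,
    ← Matrix.mul_assoc Ustarᵀ, hX.left_orthonormal, Matrix.one_mul, sub_self]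

theorem le_vnorm_sq_transpose_mulVec (hX : IsReducedSVD X Ustar σ V) (hU : Uᵀ * U = 1)
    (hδ : subspaceDist Ustar U ≤ δ) (v : Fin r → ℝ) :
    sigmaMin σ ^ 2 * ((1 - δ ^ 2) * vnorm v ^ 2) ≤ vnorm ((Uᵀ * X)ᵀ *ᵥ v) ^ 2 := by
  have factored : (Uᵀ * X)ᵀ *ᵥ v = V *ᵥ (Matrix.diagonal σ *ᵥ (Ustarᵀ *ᵥ (U *ᵥ v))) := by
    rw [hX.eq]
    simp only [Matrix.transpose_mul, Matrix.transpose_transpose, Matrix.diagonal_transpose,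
      Matrix.mulVec_mulVec, Matrix.mul_assoc]
  have residual_le : vnorm (residual Ustar (U *ᵥ v)) ≤ δ * vnorm v := by
    rw [residual_eq_mulVec, Matrix.mulVec_mulVec]
    exact (ByzAltGDmin.vnorm_mulVec_le _ v).trans
      (mul_le_mul_of_nonneg_right hδ (vnorm_nonneg _))
  have pythagoras :=
    vnorm_sq_transpose_mulVec_add_vnorm_sq_residual hX.left_orthonormal (U *ᵥ v)
  rw [vnorm_orthonormal_mulVec hU] at pythagoras
  rw [factored, vnorm_orthonormal_mulVec hX.right_orthonormal]
  calc sigmaMin σ ^ 2 * ((1 - δ ^ 2) * vnorm v ^ 2)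
      ≤ sigmaMin σ ^ 2 * vnorm (Ustarᵀ *ᵥ (U *ᵥ v)) ^ 2 := by
        gcongr
        linarith [pow_le_pow_left₀ (vnorm_nonneg _) residual_le 2, mul_pow δ (vnorm v) 2]
    _ = (sigmaMin σ * vnorm (Ustarᵀ *ᵥ (U *ᵥ v))) ^ 2 := (mul_pow _ _ 2).symm
    _ ≤ vnorm (Matrix.diagonal σ *ᵥ (Ustarᵀ *ᵥ (U *ᵥ v))) ^ 2 :=
        pow_le_pow_left₀ (mul_nonneg hX.sigmaMin_nonneg (vnorm_nonneg _))
          (le_vnorm_diagonal_mulVec (sigmaMin_le σ) hX.sigmaMin_nonneg _) 2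

theorem col_eq (hX : IsReducedSVD X Ustar σ V) (k : Fin q) :
    X.col k = Ustar *ᵥ (Matrix.diagonal σ * Vᵀ).col k := by
  rw [← col_mul, ← Matrix.mul_assoc, ← hX.eq]

theorem vnorm_col (hX : IsReducedSVD X Ustar σ V) (k : Fin q) :
    vnorm (X.col k) = vnorm ((Matrix.diagonal σ * Vᵀ).col k) := by
  rw [hX.col_eq, vnorm_orthonormal_mulVec hX.left_orthonormal]

theorem vnorm_residual_col_le (hX : IsReducedSVD X Ustar σ V) (hU : Uᵀ * U = 1)
    (hδ : subspaceDist Ustar U ≤ δ) (k : Fin q) :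
    vnorm (residual U (X.col k)) ≤ δ * vnorm (X.col k) := by
  rw [hX.vnorm_col, hX.col_eq, residual_eq_mulVec, Matrix.mulVec_mulVec]
  rw [subspaceDist_comm hX.left_orthonormal hU] at hδ
  exact (ByzAltGDmin.vnorm_mulVec_le _ _).trans (mul_le_mul_of_nonneg_right hδ (vnorm_nonneg _))

theorem sum_vnorm_sq_residual_le (hX : IsReducedSVD X Ustar σ V) (hU : Uᵀ * U = 1)
    (hδ : subspaceDist Ustar U ≤ δ) :
    ∑ k, vnorm (residual U (X.col k)) ^ 2 ≤ δ ^ 2 * sigmaMax σ ^ 2 := by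
  rw [subspaceDist_comm hX.left_orthonormal hU] at hδ
  simp only [residual_eq_mulVec, ← col_mul, ← frobenius_norm_sq_eq_sum_col, ← mul_pow]
  exact pow_le_pow_left₀ (norm_nonneg _)
    ((hX.norm_mul_le _).trans (mul_le_mul_of_nonneg_right hδ hX.sigmaMax_nonneg)) 2

theorem sum_vnorm_sq_mulVec_le (hX : IsReducedSVD X Ustar σ V) (hU : Uᵀ * U = 1)
    {D : Matrix (Fin p) (Fin r) ℝ} (hD : ‖D‖ ≤ 1) :
    ∑ k, vnorm (D *ᵥ (Uᵀ *ᵥ X.col k)) ^ 2 ≤ sigmaMax σ ^ 2 := by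
  simp only [← col_mul, ← frobenius_norm_sq_eq_sum_col]
  refine pow_le_pow_left₀ (norm_nonneg _) ?_ 2
  rw [← Matrix.mul_assoc]
  refine (hX.norm_mul_le _).trans (mul_le_of_le_one_left hX.sigmaMax_nonneg ?_)
  exact (frobenius_norm_mul_orthonormal_le hX.left_orthonormal _).trans
    ((frobenius_norm_mul_transpose_orthonormal_le hU D).trans hD)

end IsReducedSVD

theorem RightIncoherent.vnorm_col_le {μ : ℝ} (hμ : RightIncoherent σ V μ)
    (hX : IsReducedSVD X Ustar σ V) (k : Fin q) :
    vnorm (X.col k) ≤ μ * √((r : ℝ) / q) * sigmaMax σ :=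
  (hX.vnorm_col k).trans_le (hμ k)

end ReducedSVD

/-! ### Contraction of one perturbed gradient step -/

section Contraction

variable {n q r : ℕ} {X : Matrix (Fin n) (Fin q) ℝ} {Ustar U : Matrix (Fin n) (Fin r) ℝ}
  {σ : Fin r → ℝ} {V : Matrix (Fin q) (Fin r) ℝ} {δ η : ℝ}

/-- The expectation of a node gradient, per measurement, if the coefficients are the exact ones:
with `b_k = Uᵀ x_k` this is `∑ₖ (U b_k - x_k) b_kᵀ`. -/
def expectedGradient (U : Matrix (Fin n) (Fin r) ℝ) (X : Matrix (Fin n) (Fin q) ℝ) :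
    Matrix (Fin n) (Fin r) ℝ :=
  (U * (Uᵀ * X) - X) * (Uᵀ * X)ᵀ

theorem expectedGradient_eq_neg_sum (U : Matrix (Fin n) (Fin r) ℝ)
    (X : Matrix (Fin n) (Fin q) ℝ) :
    expectedGradient U X =
      -∑ k, Matrix.vecMulVec (residual U (X.col k)) (Uᵀ *ᵥ X.col k) := by
  ext i j
  rw [expectedGradient, Matrix.mul_apply, Matrix.neg_apply, Matrix.sum_apply,
    ← Finset.sum_neg_distrib]
  refine Finset.sum_congr rfl fun k _ => ?_
  rw [Matrix.vecMulVec_apply, Matrix.transpose_apply, ← col_mul, Matrix.col_apply, residual,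
    ← col_mul, ← col_mul, Pi.sub_apply, Matrix.sub_apply, Matrix.col_apply, Matrix.col_apply]
  ring

theorem transpose_mul_expectedGradient (hU : Uᵀ * U = 1) (X : Matrix (Fin n) (Fin q) ℝ) :
    Uᵀ * expectedGradient U X = 0 := by
  rw [expectedGradient, ← Matrix.mul_assoc, Matrix.mul_sub, ← Matrix.mul_assoc, hU,
    Matrix.one_mul, sub_self, Matrix.zero_mul]

theorem norm_mul_inv_one_sub_le (M : Matrix (Fin n) (Fin r) ℝ) {D : Matrix (Fin r) (Fin r) ℝ}
    {d : ℝ} (hD : ‖D‖ ≤ d) (hd : d < 1) : ‖M * (1 - D)⁻¹‖ ≤ ‖M‖ / (1 - d) := by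
  have hdet : IsUnit (1 - D).det :=
    (Matrix.isUnit_iff_isUnit_det _).1 (isUnit_one_sub_of_norm_lt_one (hD.trans_lt hd))
  have resolvent : M * (1 - D)⁻¹ = M + M * (1 - D)⁻¹ * D := by
    have cancel : M * (1 - D)⁻¹ * (1 - D) = M := by
      rw [Matrix.mul_assoc, Matrix.nonsing_inv_mul _ hdet, Matrix.mul_one]
    rw [Matrix.mul_sub, Matrix.mul_one] at cancel
    exact sub_eq_iff_eq_add.1 cancel
  have bound : ‖M * (1 - D)⁻¹‖ ≤ ‖M‖ + ‖M * (1 - D)⁻¹‖ * d :=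
    calc ‖M * (1 - D)⁻¹‖ ≤ ‖M‖ + ‖M * (1 - D)⁻¹ * D‖ := by
          conv_lhs => rw [resolvent]
          exact norm_add_le _ _
      _ ≤ ‖M‖ + ‖M * (1 - D)⁻¹‖ * d := by
          gcongr
          exact (Matrix.frobenius_norm_mul _ _).trans (by gcongr)
  rw [le_div_iff₀ (sub_pos.2 hd)]
  linarith

theorem IsQRFactor.subspaceDist_le {M Q : Matrix (Fin n) (Fin r) ℝ} (hQR : IsQRFactor M Q)
    (hU : Uᵀ * U = 1) (hdet : IsUnit (Uᵀ * M).det) (W : Matrix (Fin n) (Fin r) ℝ) :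
    subspaceDist W Q ≤ ‖(1 - W * Wᵀ) * M * (Uᵀ * M)⁻¹‖ := by
  obtain ⟨hQ, R, -, hR⟩ := hQR
  have right_inv : R * ((Uᵀ * M)⁻¹ * (Uᵀ * Q)) = 1 := by
    rw [mul_eq_one_comm, Matrix.mul_assoc, Matrix.mul_assoc Uᵀ, ← hR,
      Matrix.nonsing_inv_mul _ hdet]
  have factored : (1 - W * Wᵀ) * Q = (1 - W * Wᵀ) * M * (Uᵀ * M)⁻¹ * Uᵀ * Q :=
    calc (1 - W * Wᵀ) * Q = (1 - W * Wᵀ) * Q * (R * ((Uᵀ * M)⁻¹ * (Uᵀ * Q))) := by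
          rw [right_inv, Matrix.mul_one]
      _ = (1 - W * Wᵀ) * (Q * R) * (Uᵀ * M)⁻¹ * Uᵀ * Q := by simp only [Matrix.mul_assoc]
      _ = _ := by rw [← hR]
  rw [subspaceDist, factored]
  exact (frobenius_norm_mul_orthonormal_le hQ _).trans
    (frobenius_norm_mul_transpose_orthonormal_le hU _)

theorem vnorm_sq_sub_smul_gram_mulVec_le {s : ℝ} (G : Matrix (Fin r) (Fin q) ℝ)
    (hG : ∀ w, vnorm (G *ᵥ w) ≤ s * vnorm w) (hη : 0 ≤ η) (hηs : η * s ^ 2 ≤ 0.5)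
    (v : Fin r → ℝ) :
    vnorm ((1 - η • (G * Gᵀ)) *ᵥ v) ^ 2 ≤ vnorm v ^ 2 - 1.5 * (η * vnorm (Gᵀ *ᵥ v) ^ 2) := by
  have cross : v ⬝ᵥ (G *ᵥ (Gᵀ *ᵥ v)) = vnorm (Gᵀ *ᵥ v) ^ 2 := by
    rw [vnorm_sq, transpose_mulVec_dotProduct]
  have square : η * (η * vnorm (G *ᵥ (Gᵀ *ᵥ v)) ^ 2) ≤ 0.5 * (η * vnorm (Gᵀ *ᵥ v) ^ 2) :=
    calc η * (η * vnorm (G *ᵥ (Gᵀ *ᵥ v)) ^ 2) ≤ η * (η * (s * vnorm (Gᵀ *ᵥ v)) ^ 2) := by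
          gcongr
          exacts [vnorm_nonneg _, hG _]
      _ = (η * s ^ 2) * (η * vnorm (Gᵀ *ᵥ v) ^ 2) := by ring
      _ ≤ 0.5 * (η * vnorm (Gᵀ *ᵥ v) ^ 2) := by gcongr
  have expand : (1 - η • (G * Gᵀ)) *ᵥ v = v - η • (G *ᵥ (Gᵀ *ᵥ v)) := by
    rw [Matrix.sub_mulVec, Matrix.one_mulVec, Matrix.smul_mulVec, Matrix.mulVec_mulVec]
  rw [expand, vnorm_sq, sub_dotProduct, dotProduct_sub, dotProduct_sub, smul_dotProduct,
    dotProduct_smul, smul_dotProduct, dotProduct_smul, dotProduct_comm (G *ᵥ (Gᵀ *ᵥ v)) v, cross,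
    ← vnorm_sq, ← vnorm_sq]
  simp only [smul_eq_mul]
  linarith

namespace IsReducedSVD

theorem mul_sigmaMin_sq_le (hX : IsReducedSVD X Ustar σ V) (hη : 0 ≤ η)
    (hη1 : η * sigmaMax σ ^ 2 ≤ 0.5) : η * sigmaMin σ ^ 2 ≤ 0.5 :=
  (mul_le_mul_of_nonneg_left
    (pow_le_pow_left₀ hX.sigmaMin_nonneg (sigmaMin_le_sigmaMax σ) 2) hη).trans hη1

theorem vnorm_one_sub_smul_gram_mulVec_le (hX : IsReducedSVD X Ustar σ V) (hU : Uᵀ * U = 1)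
    (hδ : subspaceDist Ustar U ≤ δ) (hδ1 : δ ≤ 0.1) (hη : 0 ≤ η)
    (hη1 : η * sigmaMax σ ^ 2 ≤ 0.5) (v : Fin r → ℝ) :
    vnorm ((1 - η • ((Uᵀ * X) * (Uᵀ * X)ᵀ)) *ᵥ v) ≤
      (1 - 0.74 * (η * sigmaMin σ ^ 2)) * vnorm v := by
  have ha := hX.mul_sigmaMin_sq_le hη hη1
  have hδ0 : 0 ≤ δ := (subspaceDist_nonneg _ _).trans hδ
  have le_gram : 0.99 * (η * sigmaMin σ ^ 2) * vnorm v ^ 2 ≤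
      η * vnorm ((Uᵀ * X)ᵀ *ᵥ v) ^ 2 :=
    calc 0.99 * (η * sigmaMin σ ^ 2) * vnorm v ^ 2
        = η * (sigmaMin σ ^ 2 * (0.99 * vnorm v ^ 2)) := by ring
      _ ≤ η * (sigmaMin σ ^ 2 * ((1 - δ ^ 2) * vnorm v ^ 2)) := by
          gcongr
          nlinarith
      _ ≤ η * vnorm ((Uᵀ * X)ᵀ *ᵥ v) ^ 2 := by
          gcongr
          exact hX.le_vnorm_sq_transpose_mulVec hU hδ v
  have step := vnorm_sq_sub_smul_gram_mulVec_le (Uᵀ * X) (s := sigmaMax σ)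
    (fun w => by
      rw [← Matrix.mulVec_mulVec]
      exact (vnorm_transpose_mulVec_le hU _).trans (hX.vnorm_mulVec_le _)) hη hη1 v
  rw [← sq_le_sq₀ (vnorm_nonneg _) (mul_nonneg (by linarith) (vnorm_nonneg _))]
  nlinarith [mul_nonneg (sq_nonneg (η * sigmaMin σ ^ 2)) (sq_nonneg (vnorm v)),
    mul_nonneg (mul_nonneg hη (sq_nonneg (sigmaMin σ))) (sq_nonneg (vnorm v))]

variable {Y : Matrix (Fin n) (Fin r) ℝ}

theorem proj_compl_mul_sub_smul (hX : IsReducedSVD X Ustar σ V)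
    (U Y : Matrix (Fin n) (Fin r) ℝ) (η : ℝ) :
    (1 - Ustar * Ustarᵀ) * (U - η • Y) =
      (1 - Ustar * Ustarᵀ) * U * (1 - η • ((Uᵀ * X) * (Uᵀ * X)ᵀ)) -
        η • ((1 - Ustar * Ustarᵀ) * (Y - expectedGradient U X)) := by
  have annihilate : (1 - Ustar * Ustarᵀ) * expectedGradient U X =
      (1 - Ustar * Ustarᵀ) * U * ((Uᵀ * X) * (Uᵀ * X)ᵀ) := by
    rw [expectedGradient, ← Matrix.mul_assoc, Matrix.mul_sub, hX.proj_compl_mul_self, sub_zero]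
    simp only [Matrix.mul_assoc]
  simp only [Matrix.mul_sub _ Y, annihilate, Matrix.mul_sub _ U, Matrix.mul_smul,
    Matrix.mul_sub _ 1, Matrix.mul_one, smul_sub]
  abel

theorem norm_proj_compl_mul_sub_smul_le (hX : IsReducedSVD X Ustar σ V) (hU : Uᵀ * U = 1)
    (hδ : subspaceDist Ustar U ≤ δ) (hδ1 : δ ≤ 0.1) (hη : 0 ≤ η)
    (hη1 : η * sigmaMax σ ^ 2 ≤ 0.5)
    (hY : ‖Y - expectedGradient U X‖ ≤ 0.3 * δ * sigmaMin σ ^ 2) :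
    ‖(1 - Ustar * Ustarᵀ) * (U - η • Y)‖ ≤ (1 - 0.44 * (η * sigmaMin σ ^ 2)) * δ := by
  have ha := hX.mul_sigmaMin_sq_le hη hη1
  have shrink : ‖(1 - Ustar * Ustarᵀ) * U * (1 - η • ((Uᵀ * X) * (Uᵀ * X)ᵀ))‖ ≤
      (1 - 0.74 * (η * sigmaMin σ ^ 2)) * δ := by
    refine le_trans ?_ (mul_le_mul_of_nonneg_left hδ (by linarith))
    rw [subspaceDist, ← Matrix.frobenius_norm_transpose, Matrix.transpose_mul,
      ← Matrix.frobenius_norm_transpose ((1 - Ustar * Ustarᵀ) * U)]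
    refine frobenius_norm_mul_le_of_vnorm_mulVec_le (by linarith) (fun v => ?_) _
    simpa using hX.vnorm_one_sub_smul_gram_mulVec_le hU hδ hδ1 hη hη1 v
  have perturbation : ‖η • ((1 - Ustar * Ustarᵀ) * (Y - expectedGradient U X))‖ ≤
      η * (0.3 * δ * sigmaMin σ ^ 2) := by
    rw [norm_smul, Real.norm_of_nonneg hη]
    gcongr
    exact (frobenius_norm_proj_compl_mul_le hX.left_orthonormal _).trans hY
  rw [hX.proj_compl_mul_sub_smul]
  linarith [norm_sub_le ((1 - Ustar * Ustarᵀ) * U * (1 - η • ((Uᵀ * X) * (Uᵀ * X)ᵀ)))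
    (η • ((1 - Ustar * Ustarᵀ) * (Y - expectedGradient U X)))]

theorem norm_expectedGradient_le (hX : IsReducedSVD X Ustar σ V) (hU : Uᵀ * U = 1)
    (hδ : subspaceDist Ustar U ≤ δ) : ‖expectedGradient U X‖ ≤ δ * sigmaMax σ ^ 2 := by
  have residual_eq : U * (Uᵀ * X) - X = -((1 - U * Uᵀ) * X) := by
    rw [Matrix.sub_mul, Matrix.one_mul, Matrix.mul_assoc, neg_sub]
  have residual_le : ‖U * (Uᵀ * X) - X‖ ≤ δ * sigmaMax σ := by
    rw [residual_eq, norm_neg]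
    rw [subspaceDist_comm hX.left_orthonormal hU] at hδ
    exact (hX.norm_mul_le _).trans (mul_le_mul_of_nonneg_right hδ hX.sigmaMax_nonneg)
  calc ‖expectedGradient U X‖ = ‖Uᵀ * X * (U * (Uᵀ * X) - X)ᵀ‖ := by
        rw [expectedGradient, ← Matrix.frobenius_norm_transpose, Matrix.transpose_mul,
          Matrix.transpose_transpose]
    _ ≤ sigmaMax σ * ‖(U * (Uᵀ * X) - X)ᵀ‖ :=
        frobenius_norm_mul_le_of_vnorm_mulVec_le hX.sigmaMax_nonneg (fun v => by
          rw [← Matrix.mulVec_mulVec]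
          exact (vnorm_transpose_mulVec_le hU _).trans (hX.vnorm_mulVec_le v)) _
    _ ≤ sigmaMax σ * (δ * sigmaMax σ) := by
        rw [Matrix.frobenius_norm_transpose]
        exact mul_le_mul_of_nonneg_left residual_le hX.sigmaMax_nonneg
    _ = δ * sigmaMax σ ^ 2 := by ring

theorem subspaceDist_update_le (hX : IsReducedSVD X Ustar σ V) (hU : Uᵀ * U = 1)
    (hδ : subspaceDist Ustar U ≤ δ) (hδ1 : δ ≤ 0.1) (hη : 0 ≤ η)
    (hη1 : η * sigmaMax σ ^ 2 ≤ 0.5)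
    (hY : ‖Y - expectedGradient U X‖ ≤ 0.3 * δ * sigmaMin σ ^ 2)
    {U' : Matrix (Fin n) (Fin r) ℝ} (hQR : IsQRFactor (U - η • Y) U') :
    subspaceDist Ustar U' ≤ (1 - 0.12 * (η * sigmaMin σ ^ 2)) * δ := by
  have ha := hX.mul_sigmaMin_sq_le hη hη1
  have ha0 : 0 ≤ η * sigmaMin σ ^ 2 := by positivity
  have hδ0 : 0 ≤ δ := (subspaceDist_nonneg _ _).trans hδ
  set D := η • (Uᵀ * (Y - expectedGradient U X)) with hD
  have hD_le : ‖D‖ ≤ 0.03 * (η * sigmaMin σ ^ 2) := by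
    rw [hD, norm_smul, Real.norm_of_nonneg hη]
    calc η * ‖Uᵀ * (Y - expectedGradient U X)‖ ≤ η * (0.3 * δ * sigmaMin σ ^ 2) := by
          gcongr
          exact (frobenius_norm_transpose_orthonormal_mul_le hU _).trans hY
      _ ≤ 0.03 * (η * sigmaMin σ ^ 2) := by nlinarith
  have along_U : Uᵀ * (U - η • Y) = 1 - D := by
    rw [hD, Matrix.mul_sub, Matrix.mul_sub, hU, transpose_mul_expectedGradient hU, sub_zero,
      Matrix.mul_smul]
  have hdet : IsUnit (Uᵀ * (U - η • Y)).det := by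
    rw [along_U]
    exact (Matrix.isUnit_iff_isUnit_det _).1 (isUnit_one_sub_of_norm_lt_one (by linarith))
  calc subspaceDist Ustar U'
      ≤ ‖(1 - Ustar * Ustarᵀ) * (U - η • Y) * (1 - D)⁻¹‖ :=
        along_U ▸ hQR.subspaceDist_le hU hdet Ustar
    _ ≤ ‖(1 - Ustar * Ustarᵀ) * (U - η • Y)‖ / (1 - 0.03 * (η * sigmaMin σ ^ 2)) :=
        norm_mul_inv_one_sub_le _ hD_le (by linarith)
    _ ≤ (1 - 0.44 * (η * sigmaMin σ ^ 2)) * δ / (1 - 0.03 * (η * sigmaMin σ ^ 2)) := by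
        gcongr
        · linarith
        · exact hX.norm_proj_compl_mul_sub_smul_le hU hδ hδ1 hη hη1 hY
    _ ≤ (1 - 0.12 * (η * sigmaMin σ ^ 2)) * δ := by
        rw [div_le_iff₀ (by linarith)]
        nlinarith [mul_nonneg ha0 hδ0, mul_nonneg (mul_nonneg ha0 ha0) hδ0]

end IsReducedSVD

end Contraction

/-! ### Accuracy of the approximate geometric median -/

section GeometricMedianAccuracy

variable {ι E : Type*} [NormedAddCommGroup E]

theorem gmObjective_nonneg (K : Finset ι) (z : ι → E) (x : E) : 0 ≤ gmObjective K z x :=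
  Finset.sum_nonneg fun _ _ => norm_nonneg _

theorem gmObjective_le_add (K : Finset ι) (z : ι → E) (x y : E) :
    gmObjective K z x ≤ gmObjective K z y + K.card * ‖x - y‖ := by
  rw [gmObjective, gmObjective, ← nsmul_eq_mul, ← Finset.sum_const, ← Finset.sum_add_distrib]
  exact Finset.sum_le_sum fun i _ =>
    (norm_sub_le_norm_sub_add_norm_sub x y (z i)).trans_eq (add_comm _ _)

-- Moving from `y` to `x` gains at most `‖x - y‖` at each point outside `S`, and loses at least
-- `‖x - y‖ - 2 R` at each point of `S`.
theorem norm_sub_le_of_gmObjective_le [DecidableEq ι] {K S : Finset ι} {z : ι → E} {x y : E}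
    {R gap : ℝ} (hSK : S ⊆ K) (hS : ∀ i ∈ S, ‖z i - y‖ ≤ R)
    (hcard : (3 : ℝ) * (K \ S).card ≤ 2 * S.card) (hne : S.Nonempty)
    (hx : gmObjective K z x ≤ gmObjective K z y + gap) :
    ‖x - y‖ ≤ 6 * R + 3 * gap / S.card := by
  have split (w : E) : gmObjective K z w =
      ∑ i ∈ K \ S, ‖w - z i‖ + ∑ i ∈ S, ‖w - z i‖ := (Finset.sum_sdiff hSK).symm
  have outside : ∑ i ∈ K \ S, (‖y - z i‖ - ‖x - y‖) ≤ ∑ i ∈ K \ S, ‖x - z i‖ :=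
    Finset.sum_le_sum fun i _ => by
      linarith [norm_sub_le_norm_sub_add_norm_sub y x (z i), norm_sub_rev x y]
  have inside : ∑ _i ∈ S, (‖x - y‖ - R) ≤ ∑ i ∈ S, ‖x - z i‖ :=
    Finset.sum_le_sum fun i hi => by
      linarith [norm_sub_le_norm_sub_add_norm_sub x (z i) y, hS i hi]
  have center : ∑ i ∈ S, ‖y - z i‖ ≤ ∑ _i ∈ S, R :=
    Finset.sum_le_sum fun i hi => (norm_sub_rev _ _).trans_le (hS i hi)
  rw [split, split] at hx
  simp only [Finset.sum_sub_distrib, Finset.sum_const, nsmul_eq_mul] at outside inside center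
  have hS0 : (0 : ℝ) < S.card := by exact_mod_cast hne.card_pos
  rw [← sub_le_iff_le_add', le_div_iff₀ hS0]
  nlinarith [norm_nonneg (x - y)]

/-- The summand of the smoothed objective `f_s` for a point at distance `d`. -/
def gmPenalty (s d : ℝ) : ℝ :=
  √(1 + s ^ 2 * d ^ 2) - Real.log (1 + √(1 + s ^ 2 * d ^ 2))

theorem hasDerivAt_gmPenalty (s d : ℝ) :
    HasDerivAt (gmPenalty s) (s ^ 2 * d / (1 + √(1 + s ^ 2 * d ^ 2))) d := by
  have hpos : 0 < 1 + s ^ 2 * d ^ 2 := by positivity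
  have : 0 < √(1 + s ^ 2 * d ^ 2) := Real.sqrt_pos.2 hpos
  have inner_deriv : HasDerivAt (fun d : ℝ => 1 + s ^ 2 * d ^ 2) (s ^ 2 * (2 * d)) d := by
    simpa using ((hasDerivAt_pow 2 d).const_mul (s ^ 2)).const_add 1
  have sqrt_deriv := inner_deriv.sqrt hpos.ne'
  refine (sqrt_deriv.sub ((sqrt_deriv.const_add 1).log (by positivity))).congr_deriv ?_
  field_simp
  ring

theorem gmPenalty_monotoneOn (s : ℝ) : MonotoneOn (gmPenalty s) (Set.Ici 0) := by
  refine monotoneOn_of_deriv_nonneg (convex_Ici 0)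
    (fun d _ => (hasDerivAt_gmPenalty s d).continuousAt.continuousWithinAt)
    (fun d _ => (hasDerivAt_gmPenalty s d).differentiableAt.differentiableWithinAt) fun d hd => ?_
  rw [interior_Ici] at hd
  rw [(hasDerivAt_gmPenalty s d).deriv]
  have : 0 < d := hd
  positivity

theorem deriv_gmPenalty_le {s d : ℝ} (hs : 0 ≤ s) : deriv (gmPenalty s) d ≤ s := by
  have le_sqrt : s * d ≤ √(1 + s ^ 2 * d ^ 2) := Real.le_sqrt_of_sq_le (by nlinarith)
  rw [(hasDerivAt_gmPenalty s d).deriv, div_le_iff₀ (by positivity)]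
  nlinarith

theorem sub_deriv_gmPenalty_mul_le {s d : ℝ} (hs : 0 ≤ s) (hd : 0 ≤ d) :
    (s - deriv (gmPenalty s) d) * d ≤ 2 := by
  have hsd : 0 ≤ s * d := mul_nonneg hs hd
  have le_sqrt : s * d ≤ √(1 + s ^ 2 * d ^ 2) := Real.le_sqrt_of_sq_le (by nlinarith)
  have sqrt_le : √(1 + s ^ 2 * d ^ 2) ≤ 1 + s * d :=
    Real.sqrt_le_iff.2 ⟨by positivity, by nlinarith⟩
  rw [(hasDerivAt_gmPenalty s d).deriv, sub_mul, div_mul_eq_mul_div, sub_le_iff_le_add,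
    ← sub_le_iff_le_add', le_div_iff₀ (by positivity)]
  nlinarith

theorem nonneg_of_hasDerivAt_of_forall_le {f : ℝ → ℝ} {f' a b : ℝ} (hab : a < b)
    (hf : HasDerivAt f f' a) (hle : ∀ x ∈ Set.Ioo a b, f a ≤ f x) : 0 ≤ f' := by
  have slope_tendsto := (hasDerivAt_iff_tendsto_slope.1 hf).mono_left
    (nhdsWithin_mono a (s := Set.Ioi a) fun _ hx => ne_of_gt hx)
  refine ge_of_tendsto slope_tendsto ?_
  filter_upwards [Ioo_mem_nhdsGT hab] with x hx
  rw [slope_def_field]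
  exact div_nonneg (sub_nonneg.2 (hle x hx)) (sub_nonneg.2 hx.1.le)

variable [NormedSpace ℝ E]

theorem norm_one_sub_smul_add_smul_sub_le {h : ℝ} (hh : h ∈ Set.Icc 0 1) (c y z : E) :
    ‖(1 - h) • c + h • y - z‖ ≤ ‖c - z‖ + h * (‖y - z‖ - ‖c - z‖) := by
  have convex_comb : (1 - h) • c + h • y - z = (1 - h) • (c - z) + h • (y - z) := by module
  rw [convex_comb]
  refine (norm_add_le _ _).trans_eq ?_
  rw [norm_smul, norm_smul, Real.norm_of_nonneg hh.1, Real.norm_of_nonneg (sub_nonneg.2 hh.2)]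
  ring

-- First-order optimality along the segment from `c` to `y`; since the penalty is increasing, the
-- distances to the points may be replaced by their linear upper bounds along the segment.
theorem sum_deriv_gmPenalty_mul_sub_nonneg {K : Finset ι} {z : ι → E} {s : ℝ} {c : E}
    (hc : IsMinOn (gmPenalized K z s) Set.univ c) (y : E) :
    0 ≤ ∑ i ∈ K, deriv (gmPenalty s) ‖c - z i‖ * (‖y - z i‖ - ‖c - z i‖) := by
  refine nonneg_of_hasDerivAt_of_forall_le (zero_lt_one' ℝ)
    (f := fun h => ∑ i ∈ K, gmPenalty s (‖c - z i‖ + h * (‖y - z i‖ - ‖c - z i‖)))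
    (HasDerivAt.fun_sum fun i _ => ?_) fun h hh => ?_
  · have affine : HasDerivAt (fun h : ℝ => ‖c - z i‖ + h * (‖y - z i‖ - ‖c - z i‖))
        (‖y - z i‖ - ‖c - z i‖) 0 := by
      simpa using ((hasDerivAt_id (0 : ℝ)).mul_const (‖y - z i‖ - ‖c - z i‖)).const_add ‖c - z i‖
    have outer : HasDerivAt (gmPenalty s) (deriv (gmPenalty s) ‖c - z i‖)
        (‖c - z i‖ + 0 * (‖y - z i‖ - ‖c - z i‖)) := by
      rw [zero_mul, add_zero]
      exact (hasDerivAt_gmPenalty s _).differentiableAt.hasDerivAt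
    exact outer.comp (0 : ℝ) affine
  · have at_zero : ∑ i ∈ K, gmPenalty s (‖c - z i‖ + 0 * (‖y - z i‖ - ‖c - z i‖)) =
        gmPenalized K z s c := by
      simp only [zero_mul, add_zero, gmPenalized, gmPenalty]
    refine (at_zero.trans_le (hc (Set.mem_univ ((1 - h) • c + h • y)))).trans ?_
    refine Finset.sum_le_sum fun i _ => ?_
    have hle := norm_one_sub_smul_add_smul_sub_le (Set.Ioo_subset_Icc_self hh) c y (z i)
    exact gmPenalty_monotoneOn s (norm_nonneg _) ((norm_nonneg _).trans hle) hle

theorem gmObjective_le_of_isMinOn_gmPenalized {K : Finset ι} {z : ι → E} {s : ℝ} (hs : 0 < s)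
    {c : E} (hc : IsMinOn (gmPenalized K z s) Set.univ c) (y : E) :
    gmObjective K z c ≤ gmObjective K z y + 2 * K.card / s := by
  have optimality := sum_deriv_gmPenalty_mul_sub_nonneg hc y
  simp only [mul_sub, Finset.sum_sub_distrib] at optimality
  have upper : ∑ i ∈ K, deriv (gmPenalty s) ‖c - z i‖ * ‖y - z i‖ ≤ s * gmObjective K z y := by
    rw [gmObjective, Finset.mul_sum]
    exact Finset.sum_le_sum fun i _ =>
      mul_le_mul_of_nonneg_right (deriv_gmPenalty_le hs.le) (norm_nonneg _)
  have lower : s * gmObjective K z c - ∑ i ∈ K, deriv (gmPenalty s) ‖c - z i‖ * ‖c - z i‖ ≤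
      2 * K.card := by
    rw [gmObjective, Finset.mul_sum, ← Finset.sum_sub_distrib, mul_comm, ← nsmul_eq_mul,
      ← Finset.sum_const]
    refine Finset.sum_le_sum fun i _ => ?_
    rw [← sub_mul]
    exact sub_deriv_gmPenalty_mul_le hs.le (norm_nonneg _)
  rw [← sub_le_iff_le_add', le_div_iff₀ hs]
  linarith

theorem gmEpsC_le_one {N : ℕ} {εGM : ℝ} (h0 : 0 < εGM) (h1 : εGM < 1) : gmEpsC N εGM ≤ 1 := by
  have ratio_le : εGM / 3 / (7 * N) ≤ 1 := by
    rcases Nat.eq_zero_or_pos N with rfl | hN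
    · simp
    · have : (1 : ℝ) ≤ N := by exact_mod_cast hN
      rw [div_le_one (by positivity)]
      linarith
  have ratio_nonneg : 0 ≤ εGM / 3 / (7 * N) := by positivity
  have base_nonneg : 0 ≤ gmEpsV N εGM / 36 := by rw [gmEpsV]; positivity
  refine Real.rpow_le_one base_nonneg ?_ (by norm_num)
  rw [gmEpsV, div_le_one (by norm_num)]
  nlinarith

variable {K : Finset ι} {z : ι → E} {R : ℝ}

theorem norm_gmStart_le (hR : ∀ i ∈ K, ‖z i‖ ≤ R) (hK : K.Nonempty) : ‖gmStart K z‖ ≤ R := by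
  have hN : (0 : ℝ) < K.card := by exact_mod_cast hK.card_pos
  rw [gmStart, norm_smul, norm_inv, Real.norm_natCast, inv_mul_le_iff₀ hN]
  refine (norm_sum_le_of_le K hR).trans_eq ?_
  rw [Finset.sum_const, nsmul_eq_mul]

theorem gmObjective_gmStart_le (hR : ∀ i ∈ K, ‖z i‖ ≤ R) :
    gmObjective K z (gmStart K z) ≤ 2 * K.card * R := by
  calc gmObjective K z (gmStart K z) ≤ ∑ i ∈ K, (2 * R) := Finset.sum_le_sum fun i hi => by
        linarith [norm_sub_le (gmStart K z) (z i), hR i hi, norm_gmStart_le hR ⟨i, hi⟩]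
    _ = 2 * K.card * R := by
        rw [Finset.sum_const, nsmul_eq_mul]
        ring

theorem inv_gmPathParam (K : Finset ι) (z : ι → E) (T : ℕ) :
    (gmPathParam K z T)⁻¹ = 400 * gmObjective K z (gmStart K z) * (600 / 601) ^ T := by
  rw [gmPathParam, mul_inv, one_div, inv_inv, ← inv_pow]
  norm_num

theorem gmObjective_approxGM_le {εGM : ℝ} (h0 : 0 < εGM) (h1 : εGM < 1) {T : ℕ} {x : ℕ → E}
    (hx : LineSearchesSucceed K z εGM T x) (hR : ∀ i ∈ K, ‖z i‖ ≤ R) (hR0 : 0 ≤ R) (y : E) :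
    gmObjective K z (approxGM K z T x) ≤
      gmObjective K z y + 2400 * K.card ^ 2 * R * (600 / 601) ^ T := by
  classical
  by_cases hf : gmObjective K z (gmStart K z) = 0
  · rw [approxGM, if_pos hf, hf]
    exact add_nonneg (gmObjective_nonneg _ _ _) (by positivity)
  obtain ⟨c, hc, hxc⟩ := (hx.resolve_left hf) T le_rfl
  have start_pos : 0 < gmObjective K z (gmStart K z) :=
    (gmObjective_nonneg _ _ _).lt_of_ne' hf
  have param_pos : 0 < gmPathParam K z T := by rw [gmPathParam]; positivity
  have near_path : ‖x T - c‖ ≤ (gmPathParam K z T)⁻¹ := by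
    rw [← one_div]
    exact hxc.trans (by gcongr; exact gmEpsC_le_one h0 h1)
  have inv_param_le : (gmPathParam K z T)⁻¹ ≤ 400 * (2 * K.card * R) * (600 / 601) ^ T := by
    rw [inv_gmPathParam]
    gcongr
    exact gmObjective_gmStart_le hR
  rw [approxGM, if_neg hf]
  calc gmObjective K z (x T)
      ≤ gmObjective K z c + K.card * ‖x T - c‖ := gmObjective_le_add K z (x T) c
    _ ≤ (gmObjective K z y + 2 * K.card / gmPathParam K z T) +
          K.card * (gmPathParam K z T)⁻¹ := by
        gcongr
        exact gmObjective_le_of_isMinOn_gmPenalized param_pos hc y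
    _ = gmObjective K z y + 3 * K.card * (gmPathParam K z T)⁻¹ := by ring
    _ ≤ gmObjective K z y + 3 * K.card * (400 * (2 * K.card * R) * (600 / 601) ^ T) := by gcongr
    _ = gmObjective K z y + 2400 * K.card ^ 2 * R * (600 / 601) ^ T := by ring

theorem norm_approxGM_sub_le {S : Finset ι} {εGM r : ℝ} (h0 : 0 < εGM)
    (h1 : εGM < 1) {T : ℕ} {x : ℕ → E} (hx : LineSearchesSucceed K z εGM T x)
    (hR : ∀ i ∈ K, ‖z i‖ ≤ R) (hR0 : 0 ≤ R) {y : E} (hSK : S ⊆ K) (hS : ∀ i ∈ S, ‖z i - y‖ ≤ r)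
    (hne : S.Nonempty) (hcard : 0.6 * (K.card : ℝ) ≤ S.card) :
    ‖approxGM K z T x - y‖ ≤ 6 * r + 12000 * K.card * R * (600 / 601) ^ T := by
  classical
  have S_pos : (0 : ℝ) < S.card := by exact_mod_cast hne.card_pos
  have card_split : ((K \ S).card : ℝ) + S.card = K.card := by
    exact_mod_cast Finset.card_sdiff_add_card_eq_card hSK
  have gap_le : 3 * (2400 * (K.card : ℝ) ^ 2 * R * (600 / 601) ^ T) / S.card ≤
      12000 * K.card * R * (600 / 601) ^ T := by
    rw [div_le_iff₀ S_pos]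
    calc 3 * (2400 * (K.card : ℝ) ^ 2 * R * (600 / 601) ^ T)
        = 12000 * K.card * R * (600 / 601) ^ T * (0.6 * K.card) := by ring
      _ ≤ 12000 * K.card * R * (600 / 601) ^ T * S.card := by gcongr
  have := norm_sub_le_of_gmObjective_le hSK hS (by linarith) hne
    (gmObjective_approxGM_le h0 h1 hx hR hR0 y)
  linarith

end GeometricMedianAccuracy

/-! ### Families of independent standard Gaussian variables -/

section Gaussian

variable {Ω : Type*} {mΩ : MeasurableSpace Ω} {P : Measure Ω} {α β : Type*}

/-- A family of independent standard Gaussian random variables. The families that occur are the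
entries of the measurement matrices of a batch, indexed by (tuples of) their indices. -/
structure IsStdGaussian (X : α → Ω → ℝ) (P : Measure Ω) : Prop where
  measurable : ∀ a, Measurable (X a)
  map_eq : ∀ a, P.map (X a) = gaussianReal 0 1
  indep : iIndepFun X P

theorem measure_le_of_lintegral_exp_le_one {f : Ω → ℝ} (hf : Measurable f)
    (h : ∫⁻ ω, ENNReal.ofReal (Real.exp (f ω)) ∂P ≤ 1) (c : ℝ) :
    P {ω | c ≤ f ω} ≤ ENNReal.ofReal (Real.exp (-c)) := by
  have markov := mul_meas_ge_le_lintegral (μ := P)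
    (f := fun ω => ENNReal.ofReal (Real.exp (f ω))) (by fun_prop) (ENNReal.ofReal (Real.exp c))
  simp only [ENNReal.ofReal_le_ofReal_iff (Real.exp_pos _).le, Real.exp_le_exp] at markov
  rw [Real.exp_neg, ENNReal.ofReal_inv_of_pos (Real.exp_pos _), ENNReal.le_inv_iff_mul_le, mul_comm]
  exact markov.trans h

theorem lintegral_exp_le_of_le_half_add {f A B : Ω → ℝ} (hA : Measurable A) (hB : Measurable B)
    {c : ENNReal} (hAc : ∫⁻ ω, ENNReal.ofReal (Real.exp (A ω)) ∂P ≤ c)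
    (hBc : ∫⁻ ω, ENNReal.ofReal (Real.exp (B ω)) ∂P ≤ c) (hf : ∀ ω, f ω ≤ (A ω + B ω) / 2) :
    ∫⁻ ω, ENNReal.ofReal (Real.exp (f ω)) ∂P ≤ c := by
  have pointwise (ω : Ω) : ENNReal.ofReal (Real.exp (f ω)) ≤
      2⁻¹ * (ENNReal.ofReal (Real.exp (A ω)) + ENNReal.ofReal (Real.exp (B ω))) := by
    have convex := convexOn_exp.2 (Set.mem_univ (A ω)) (Set.mem_univ (B ω))
      (by norm_num : (0 : ℝ) ≤ 2⁻¹) (by norm_num : (0 : ℝ) ≤ 2⁻¹) (by norm_num)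
    rw [← ENNReal.ofReal_add (Real.exp_pos _).le (Real.exp_pos _).le,
      ← ENNReal.ofReal_ofNat 2, ← ENNReal.ofReal_inv_of_pos two_pos,
      ← ENNReal.ofReal_mul (by norm_num)]
    refine ENNReal.ofReal_le_ofReal ((Real.exp_le_exp.2 (hf ω)).trans ?_)
    simp only [smul_eq_mul] at convex
    rwa [mul_add, add_div, div_eq_inv_mul, div_eq_inv_mul]
  calc ∫⁻ ω, ENNReal.ofReal (Real.exp (f ω)) ∂P
      ≤ 2⁻¹ * (∫⁻ ω, ENNReal.ofReal (Real.exp (A ω)) ∂P +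
          ∫⁻ ω, ENNReal.ofReal (Real.exp (B ω)) ∂P) := by
        rw [← lintegral_add_left (by fun_prop), ← lintegral_const_mul _ (by fun_prop)]
        exact lintegral_mono pointwise
    _ ≤ 2⁻¹ * (c + c) := by gcongr
    _ = c := by
        rw [← two_mul, ← mul_assoc, ENNReal.inv_mul_cancel two_ne_zero ENNReal.ofNat_ne_top,
          one_mul]

theorem lintegral_exp_gaussianReal (c : ℝ) :
    ∫⁻ x, ENNReal.ofReal (Real.exp (c * x - c ^ 2 / 2)) ∂(gaussianReal 0 1) = 1 := by
  have mgf_eq := congrFun (mgf_fun_id_gaussianReal (μ := 0) (v := 1)) c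
  rw [mgf] at mgf_eq
  simp_rw [sub_eq_add_neg, Real.exp_add]
  rw [← ofReal_integral_eq_lintegral_ofReal ((integrable_exp_mul_gaussianReal c).mul_const _)
    (Filter.Eventually.of_forall fun x => by positivity), integral_mul_const, mgf_eq,
    ← Real.exp_add]
  simp

theorem exp_neg_add_sq_le_one_sub {x : ℝ} (hx : |x| ≤ 1 / 2) :
    Real.exp (-(x + x ^ 2)) ≤ 1 - x := by
  obtain ⟨lower, upper⟩ := abs_le.1 hx
  rw [Real.exp_neg, inv_le_comm₀ (Real.exp_pos _) (by linarith)]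
  rcases le_or_gt 0 x with h0 | h0
  · refine le_trans ?_ (Real.quadratic_le_exp_of_nonneg (by positivity))
    rw [inv_le_iff_one_le_mul₀ (by linarith)]
    nlinarith [mul_nonneg h0 h0, mul_nonneg (mul_nonneg h0 h0) h0,
      mul_nonneg (mul_nonneg h0 h0) (mul_nonneg h0 (sub_nonneg.2 upper))]
  · refine le_trans ?_ (Real.add_one_le_exp _)
    rw [inv_le_iff_one_le_mul₀ (by linarith)]
    nlinarith [mul_nonneg (sq_nonneg x) (neg_nonneg.2 h0.le)]

theorem lintegral_exp_mul_sq_gaussianReal {s : ℝ} (hs : s < 1 / 2) :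
    ∫⁻ x, ENNReal.ofReal (Real.exp (s * x ^ 2)) ∂(gaussianReal 0 1) =
      ENNReal.ofReal (√(1 - 2 * s)⁻¹) := by
  have hs' : 0 < 1 / 2 - s := by linarith
  have density_mul (x : ℝ) : gaussianPDF 0 1 x * ENNReal.ofReal (Real.exp (s * x ^ 2)) =
      ENNReal.ofReal ((√(2 * Real.pi))⁻¹ * Real.exp (-(1 / 2 - s) * x ^ 2)) := by
    rw [gaussianPDF, ← ENNReal.ofReal_mul (gaussianPDFReal_nonneg _ _ _), gaussianPDFReal,
      mul_assoc, ← Real.exp_add, NNReal.coe_one, mul_one]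
    ring_nf
  rw [gaussianReal_of_var_ne_zero 0 one_ne_zero,
    lintegral_withDensity_eq_lintegral_mul _ (measurable_gaussianPDF 0 1) (by fun_prop)]
  simp_rw [Pi.mul_apply, density_mul]
  rw [← ofReal_integral_eq_lintegral_ofReal ((integrable_exp_neg_mul_sq hs').const_mul _)
    (Filter.Eventually.of_forall fun x => by positivity), integral_const_mul, integral_gaussian,
    ← Real.sqrt_inv, ← Real.sqrt_mul (by positivity)]
  congr 2
  have : 1 - 2 * s ≠ 0 := by linarith
  field_simp

theorem lintegral_exp_sq_gaussianReal_le_one {s : ℝ} (hs : |s| ≤ 1 / 4) :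
    ∫⁻ x, ENNReal.ofReal (Real.exp (s * x ^ 2 - (s + 2 * s ^ 2))) ∂(gaussianReal 0 1) ≤ 1 := by
  obtain ⟨_, _⟩ := abs_le.1 hs
  have normalization : √(1 - 2 * s)⁻¹ ≤ Real.exp (s + 2 * s ^ 2) := by
    refine Real.sqrt_le_iff.2 ⟨(Real.exp_pos _).le, ?_⟩
    rw [← Real.exp_nat_mul, inv_le_comm₀ (by linarith) (Real.exp_pos _), ← Real.exp_neg]
    calc Real.exp (-((2 : ℕ) * (s + 2 * s ^ 2))) = Real.exp (-(2 * s + (2 * s) ^ 2)) := by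
          push_cast; ring_nf
      _ ≤ 1 - 2 * s := exp_neg_add_sq_le_one_sub (by rw [abs_mul, abs_two]; linarith)
  simp_rw [Real.exp_sub, div_eq_mul_inv]
  simp_rw [ENNReal.ofReal_mul (Real.exp_pos _).le]
  rw [lintegral_mul_const _ (by fun_prop), lintegral_exp_mul_sq_gaussianReal (by linarith),
    ← ENNReal.ofReal_mul (Real.sqrt_nonneg _), ENNReal.ofReal_le_one, ← div_eq_mul_inv]
  exact div_le_one_of_le₀ normalization (Real.exp_pos _).le

namespace IsStdGaussian

section LinearForms

variable {X : α → Ω → ℝ}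

theorem precomp (hX : IsStdGaussian X P) {f : β → α} (hf : Function.Injective f) :
    IsStdGaussian (fun b => X (f b)) P where
  measurable _ := hX.measurable _
  map_eq _ := hX.map_eq _
  indep := hX.indep.precomp hf

theorem lintegral_comp (hX : IsStdGaussian X P) (a : α) {f : ℝ → ENNReal} (hf : Measurable f) :
    ∫⁻ ω, f (X a ω) ∂P = ∫⁻ x, f x ∂(gaussianReal 0 1) := by
  rw [← hX.map_eq a, lintegral_map hf (hX.measurable a)]

theorem lintegral_exp_sum [Fintype α] (hX : IsStdGaussian X P) (c : α → ℝ) :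
    ∫⁻ ω, ENNReal.ofReal (Real.exp (∑ a, c a * X a ω - (∑ a, c a ^ 2) / 2)) ∂P = 1 := by
  have factor (ω : Ω) : ENNReal.ofReal (Real.exp (∑ a, c a * X a ω - (∑ a, c a ^ 2) / 2)) =
      ∏ a, ENNReal.ofReal (Real.exp (c a * X a ω - c a ^ 2 / 2)) := by
    rw [← ENNReal.ofReal_prod_of_nonneg fun _ _ => (Real.exp_pos _).le, ← Real.exp_sum,
      Finset.sum_sub_distrib, Finset.sum_div]
  have measurable_X := hX.measurable
  simp_rw [factor]
  rw [lintegral_prod_eq_prod_lintegral_of_indepFun Finset.univ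
    (fun a ω => ENNReal.ofReal (Real.exp (c a * X a ω - c a ^ 2 / 2)))
    (hX.indep.comp (fun a x => ENNReal.ofReal (Real.exp (c a * x - c a ^ 2 / 2)))
      (fun a => by fun_prop)) (fun a => by fun_prop)]
  refine Finset.prod_eq_one fun a _ => ?_
  rw [← lintegral_exp_gaussianReal (c a), ← hX.lintegral_comp a (by fun_prop)]

theorem memLp (hX : IsStdGaussian X P) (a : α) : MemLp (X a) 2 P := by
  have := memLp_id_gaussianReal (μ := 0) (v := 1) 2
  rw [← hX.map_eq a] at this
  exact this.comp_of_map (hX.measurable a).aemeasurable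

theorem covariance [DecidableEq α] (hX : IsStdGaussian X P) (a b : α) :
    cov[X a, X b; P] = if a = b then 1 else 0 := by
  have := hX.indep.isProbabilityMeasure
  split_ifs with hab
  · subst hab
    have variance_eq := variance_id_gaussianReal (μ := 0) (v := 1)
    rw [← hX.map_eq a, variance_map aemeasurable_id (hX.measurable a).aemeasurable] at variance_eq
    rw [covariance_self (hX.measurable a).aemeasurable]
    simpa using variance_eq
  · exact (hX.indep.indepFun hab).covariance_eq_zero (hX.memLp a) (hX.memLp b)

theorem covariance_linear [Fintype α] (hX : IsStdGaussian X P) (c d : α → ℝ) :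
    cov[fun ω => ∑ a, c a * X a ω, fun ω => ∑ a, d a * X a ω; P] = ∑ a, c a * d a := by
  classical
  have := hX.indep.isProbabilityMeasure
  rw [covariance_fun_sum_fun_sum (fun a => (hX.memLp a).const_mul _)
    (fun a => (hX.memLp a).const_mul _)]
  refine Finset.sum_congr rfl fun a _ => ?_
  simp_rw [covariance_const_mul_left, covariance_const_mul_right, hX.covariance]
  simp

theorem hasGaussianLaw [Finite α] (hX : IsStdGaussian X P) :
    HasGaussianLaw (fun ω a => X a ω) P := by
  have := Fintype.ofFinite α
  refine iIndepFun.hasGaussianLaw (fun a => ?_) hX.indep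
  have : IsGaussian (P.map (X a)) := by rw [hX.map_eq a]; infer_instance
  exact IsGaussian.hasGaussianLaw

theorem map_linear [Fintype α] (hX : IsStdGaussian X P) (c : α → ℝ) :
    P.map (fun ω => ∑ a, c a * X a ω) = gaussianReal 0 (∑ a, c a ^ 2).toNNReal := by
  have := hX.indep.isProbabilityMeasure
  have gaussian : HasGaussianLaw (fun ω => ∑ a, c a * X a ω) P := by
    have := hX.hasGaussianLaw.map_fun
      (∑ a, c a • ContinuousLinearMap.proj (R := ℝ) (φ := fun _ : α => ℝ) a)
    simpa using this
  rw [gaussian.map_eq_gaussianReal]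
  congr 1
  · rw [integral_finsetSum _ fun a _ => ((hX.memLp a).integrable one_le_two).const_mul _]
    refine Finset.sum_eq_zero fun a _ => ?_
    have mean_eq := integral_id_gaussianReal (μ := 0) (v := 1)
    rw [← hX.map_eq a, integral_map (hX.measurable a).aemeasurable (by fun_prop)] at mean_eq
    rw [integral_const_mul, mean_eq, mul_zero]
  · rw [← covariance_self gaussian.aemeasurable, hX.covariance_linear]
    simp_rw [pow_two]

theorem indepFun_linear_of_orthogonal [Fintype α] {ι κ : Type*} [Finite ι] [Finite κ]
    (hX : IsStdGaussian X P) (c : ι → α → ℝ) (d : κ → α → ℝ)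
    (h : ∀ i k, ∑ a, c i a * d k a = 0) :
    IndepFun (fun ω i => ∑ a, c i a * X a ω) (fun ω k => ∑ a, d k a * X a ω) P := by
  have := Fintype.ofFinite ι
  have := Fintype.ofFinite κ
  refine HasGaussianLaw.indepFun_of_covariance_eval (X := fun i ω => ∑ a, c i a * X a ω)
    (Y := fun k ω => ∑ a, d k a * X a ω) ?_ fun i k => by rw [hX.covariance_linear, h]
  have := hX.hasGaussianLaw.map_fun
    ((ContinuousLinearMap.pi fun i =>
        ∑ a, c i a • ContinuousLinearMap.proj (R := ℝ) (φ := fun _ : α => ℝ) a).prod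
      (ContinuousLinearMap.pi fun k =>
        ∑ a, d k a • ContinuousLinearMap.proj (R := ℝ) (φ := fun _ : α => ℝ) a))
  refine this.congr (Filter.Eventually.of_forall fun ω => ?_)
  ext <;> simp

theorem lintegral_exp_sq_linear_le_one [Fintype α] (hX : IsStdGaussian X P) (c : α → ℝ) {s : ℝ}
    (hs : |s| * vnorm c ^ 2 ≤ 1 / 4) :
    ∫⁻ ω, ENNReal.ofReal (Real.exp (s * (∑ a, c a * X a ω) ^ 2 -
      (s * vnorm c ^ 2 + 2 * (s * vnorm c ^ 2) ^ 2))) ∂P ≤ 1 := by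
  have measurable_X := hX.measurable
  have law : P.map (fun ω => ∑ a, c a * X a ω) =
      (gaussianReal 0 1).map (fun x => vnorm c * x) := by
    rw [hX.map_linear c, gaussianReal_map_const_mul, ← vnorm_sq_eq_sum]
    congr 1
    · simp
    · ext; simp [sq_nonneg]
  rw [← lintegral_map (f := fun x : ℝ => ENNReal.ofReal (Real.exp (s * x ^ 2 -
      (s * vnorm c ^ 2 + 2 * (s * vnorm c ^ 2) ^ 2)))) (by fun_prop) (by fun_prop), law,
    lintegral_map (by fun_prop) (by fun_prop)]
  simp_rw [mul_pow (vnorm c), ← mul_assoc]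
  exact lintegral_exp_sq_gaussianReal_le_one (by rwa [abs_mul, abs_sq])

-- Polarization: `4 ⟨w, X⟩ ⟨v, X⟩ = ⟨w + v, X⟩² - ⟨w - v, X⟩²`.
theorem lintegral_exp_mul_le_one_of_vnorm_eq [Fintype α] (hX : IsStdGaussian X P) {w v : α → ℝ}
    (hwv : vnorm w = vnorm v) {l : ℝ} (hl : |l| * vnorm w ^ 2 ≤ 1 / 8) :
    ∫⁻ ω, ENNReal.ofReal (Real.exp (l * ((∑ a, w a * X a ω) * (∑ a, v a * X a ω) - w ⬝ᵥ v) -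
      4 * l ^ 2 * (vnorm w ^ 2) ^ 2)) ∂P ≤ 1 := by
  have sq_add : vnorm (w + v) ^ 2 = 2 * vnorm w ^ 2 + 2 * w ⬝ᵥ v := by
    have : vnorm (w + v) ^ 2 = vnorm w ^ 2 + vnorm v ^ 2 + 2 * w ⬝ᵥ v := by
      simp only [vnorm_sq, add_dotProduct, dotProduct_add, dotProduct_comm v w]; ring
    rw [this, hwv]; ring
  have sq_sub : vnorm (w - v) ^ 2 = 2 * vnorm w ^ 2 - 2 * w ⬝ᵥ v := by
    have : vnorm (w - v) ^ 2 = vnorm w ^ 2 + vnorm v ^ 2 - 2 * w ⬝ᵥ v := by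
      simp only [vnorm_sq, sub_dotProduct, dotProduct_sub, dotProduct_comm v w]; ring
    rw [this, hwv]; ring
  set N := vnorm w ^ 2
  have sq_add_nonneg : 0 ≤ 2 * N + 2 * w ⬝ᵥ v := sq_add ▸ sq_nonneg _
  have sq_sub_nonneg : 0 ≤ 2 * N - 2 * w ⬝ᵥ v := sq_sub ▸ sq_nonneg _
  have abs_nonneg_l := abs_nonneg l
  have measurable_X := hX.measurable
  have plus := hX.lintegral_exp_sq_linear_le_one (w + v) (s := l / 2)
    (by rw [sq_add, abs_div, abs_two]; nlinarith)
  have minus := hX.lintegral_exp_sq_linear_le_one (w - v) (s := -(l / 2))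
    (by rw [sq_sub, abs_neg, abs_div, abs_two]; nlinarith)
  refine lintegral_exp_le_of_le_half_add (by fun_prop) (by fun_prop) plus minus fun ω => ?_
  simp only [Pi.add_apply, Pi.sub_apply, add_mul, sub_mul, Finset.sum_add_distrib,
    Finset.sum_sub_distrib, sq_add, sq_sub]
  nlinarith [mul_nonneg (sq_nonneg l) (mul_nonneg sq_add_nonneg sq_sub_nonneg)]

-- Rescaling `(w, v)` to `(t w, t⁻¹ v)` reduces to the case of equal norms.
theorem lintegral_exp_mul_le_one [Fintype α] (hX : IsStdGaussian X P) (w v : α → ℝ) {l : ℝ}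
    (hl : |l| * (vnorm w * vnorm v) ≤ 1 / 8) :
    ∫⁻ ω, ENNReal.ofReal (Real.exp (l * ((∑ a, w a * X a ω) * (∑ a, v a * X a ω) - w ⬝ᵥ v) -
      4 * l ^ 2 * (vnorm w * vnorm v) ^ 2)) ∂P ≤ 1 := by
  have := hX.indep.isProbabilityMeasure
  rcases eq_or_ne w 0 with rfl | hw
  · simp [vnorm_zero]
  rcases eq_or_ne v 0 with rfl | hv
  · simp [vnorm_zero]
  have w_pos : 0 < vnorm w := (vnorm_nonneg _).lt_of_ne' (mt vnorm_eq_zero.1 hw)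
  have v_pos : 0 < vnorm v := (vnorm_nonneg _).lt_of_ne' (mt vnorm_eq_zero.1 hv)
  set t := √(vnorm v / vnorm w)
  have t_pos : 0 < t := by positivity
  have t_sq : t ^ 2 = vnorm v / vnorm w := Real.sq_sqrt (by positivity)
  have sq_norm : vnorm (t • w) ^ 2 = vnorm w * vnorm v := by
    rw [vnorm_smul, mul_pow, sq_abs, t_sq]; field_simp
  have norm_eq : vnorm (t • w) = vnorm (t⁻¹ • v) := by
    rw [vnorm_smul, vnorm_smul, abs_inv, abs_of_pos t_pos]
    field_simp
    rw [t_sq]; field_simp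
  have scaled := hX.lintegral_exp_mul_le_one_of_vnorm_eq norm_eq (by rwa [sq_norm])
  rw [sq_norm] at scaled
  convert scaled using 8 with ω
  · simp_rw [Pi.smul_apply, smul_eq_mul, mul_assoc, ← Finset.mul_sum]
    field_simp
  · rw [smul_dotProduct, dotProduct_smul, smul_smul, mul_inv_cancel₀ t_pos.ne', one_smul]

end LinearForms

section Rows

variable {J : Type*} {X : J → β → Ω → ℝ}

theorem iIndepFun_rows [Finite J] [Finite β] (hX : IsStdGaussian (fun p : J × β => X p.1 p.2) P) :
    iIndepFun (fun j ω b => X j b ω) P := by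
  classical
  have := Fintype.ofFinite J
  have := Fintype.ofFinite β
  refine HasGaussianLaw.iIndepFun_of_covariance_eval (κ := fun _ => β) (X := X) ?_ ?_
  · exact hX.hasGaussianLaw.map_fun
      (ContinuousLinearMap.pi fun j => ContinuousLinearMap.pi fun b =>
        ContinuousLinearMap.proj (R := ℝ) (φ := fun _ : J × β => ℝ) (j, b))
  · intro i j hij k l
    have := hX.covariance (i, k) (j, l)
    rwa [if_neg (by simp [hij])] at this

theorem lintegral_exp_sum_mul_le_one [Fintype J] [Fintype β]
    (hX : IsStdGaussian (fun p : J × β => X p.1 p.2) P) (w v : J → β → ℝ)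
    {l : ℝ} (hl : ∀ j, |l| * (vnorm (w j) * vnorm (v j)) ≤ 1 / 8) :
    ∫⁻ ω, ENNReal.ofReal (Real.exp (l * ∑ j,
      ((∑ b, w j b * X j b ω) * (∑ b, v j b * X j b ω) - w j ⬝ᵥ v j) -
      4 * l ^ 2 * ∑ j, (vnorm (w j) * vnorm (v j)) ^ 2)) ∂P ≤ 1 := by
  have measurable_X (j : J) (b : β) : Measurable (X j b) := hX.measurable (j, b)
  let f (j : J) (x : β → ℝ) : ENNReal := ENNReal.ofReal (Real.exp (l *
    ((∑ b, w j b * x b) * (∑ b, v j b * x b) - w j ⬝ᵥ v j) -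
      4 * l ^ 2 * (vnorm (w j) * vnorm (v j)) ^ 2))
  have factor (ω : Ω) : ENNReal.ofReal (Real.exp (l * ∑ j,
      ((∑ b, w j b * X j b ω) * (∑ b, v j b * X j b ω) - w j ⬝ᵥ v j) -
      4 * l ^ 2 * ∑ j, (vnorm (w j) * vnorm (v j)) ^ 2)) = ∏ j, f j (fun b => X j b ω) := by
    rw [← ENNReal.ofReal_prod_of_nonneg fun _ _ => (Real.exp_pos _).le, ← Real.exp_sum,
      Finset.mul_sum, Finset.mul_sum, ← Finset.sum_sub_distrib]
  simp_rw [factor]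
  rw [lintegral_prod_eq_prod_lintegral_of_indepFun Finset.univ (fun j ω => f j (fun b => X j b ω))
    (hX.iIndepFun_rows.comp f (fun j => by fun_prop)) (fun j => by fun_prop)]
  refine Finset.prod_le_one' fun j _ => ?_
  have row : IsStdGaussian (X j) P := hX.precomp (f := fun b => (j, b)) (Prod.mk_right_injective j)
  exact row.lintegral_exp_mul_le_one (w j) (v j) (hl j)

theorem measure_sum_mul_le [Fintype J] [Fintype β]
    (hX : IsStdGaussian (fun p : J × β => X p.1 p.2) P) (w v : J → β → ℝ)
    {l : ℝ} (hl0 : 0 < l) (hl : ∀ j, l * (vnorm (w j) * vnorm (v j)) ≤ 1 / 8) {S : ℝ}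
    (hS : ∑ j, (vnorm (w j) * vnorm (v j)) ^ 2 ≤ S) (t : ℝ) :
    P {ω | t < ∑ j, ((∑ b, w j b * X j b ω) * (∑ b, v j b * X j b ω) - w j ⬝ᵥ v j)} ≤
      ENNReal.ofReal (Real.exp (-(l * t - 4 * l ^ 2 * S))) := by
  have measurable_X (j : J) (b : β) : Measurable (X j b) := hX.measurable (j, b)
  refine le_trans (measure_mono fun ω hω => ?_) (measure_le_of_lintegral_exp_le_one (by fun_prop)
    (hX.lintegral_exp_sum_mul_le_one w v (l := l) (by rwa [abs_of_pos hl0]))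
    (l * t - 4 * l ^ 2 * S))
  have linear := mul_le_mul_of_nonneg_left (le_of_lt (Set.mem_ofPred.1 hω)) hl0.le
  have quadratic : 4 * l ^ 2 * ∑ j, (vnorm (w j) * vnorm (v j)) ^ 2 ≤ 4 * l ^ 2 * S := by gcongr
  simp only [Set.mem_ofPred_eq]
  linarith

end Rows

end IsStdGaussian

section IndepFun

variable {𝓧 𝓨 : Type*} [MeasurableSpace 𝓧] [MeasurableSpace 𝓨] [IsProbabilityMeasure P]
  {X : Ω → 𝓧} {Y : Ω → 𝓨}

theorem lintegral_le_of_indepFun (hX : Measurable X) (hY : Measurable Y) (hXY : IndepFun X Y P)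
    {f : 𝓧 × 𝓨 → ENNReal} (hf : Measurable f) {c : ENNReal} (h : ∀ x, ∫⁻ ω, f (x, Y ω) ∂P ≤ c) :
    ∫⁻ ω, f (X ω, Y ω) ∂P ≤ c := by
  have : IsProbabilityMeasure (P.map X) := Measure.isProbabilityMeasure_map hX.aemeasurable
  have : IsProbabilityMeasure (P.map Y) := Measure.isProbabilityMeasure_map hY.aemeasurable
  calc ∫⁻ ω, f (X ω, Y ω) ∂P = ∫⁻ x, ∫⁻ y, f (x, y) ∂(P.map Y) ∂(P.map X) := by
        rw [← lintegral_map (μ := P) hf (hX.prodMk hY),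
          (indepFun_iff_map_prod_eq_prod_map_map hX.aemeasurable hY.aemeasurable).1 hXY,
          lintegral_prod _ hf.aemeasurable]
    _ ≤ ∫⁻ _, c ∂(P.map X) := lintegral_mono fun x =>
        (lintegral_map (hf.comp measurable_prodMk_left) hY).trans_le (h x)
    _ = c := by simp

theorem measure_le_of_indepFun (hX : Measurable X) (hY : Measurable Y) (hXY : IndepFun X Y P)
    {S : Set (𝓧 × 𝓨)} (hS : MeasurableSet S) {c : ENNReal} (h : ∀ x, P {ω | (x, Y ω) ∈ S} ≤ c) :
    P {ω | (X ω, Y ω) ∈ S} ≤ c := by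
  have measure_eq {Z : Ω → 𝓧 × 𝓨} (hZ : Measurable Z) :
      P {ω | Z ω ∈ S} = ∫⁻ ω, S.indicator 1 (Z ω) ∂P :=
    (lintegral_indicator_one (hS.preimage hZ)).symm
  rw [measure_eq (by fun_prop)]
  refine lintegral_le_of_indepFun hX hY hXY (measurable_one.indicator hS) fun x => ?_
  rw [← measure_eq (by fun_prop)]
  exact h x

end IndepFun

end Gaussian

/-! ### Nets of the unit ball -/

section Net

theorem packingNumber_closedBall_le (E : Type*) [NormedAddCommGroup E] [NormedSpace ℝ E]
    [FiniteDimensional ℝ E] :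
    Metric.packingNumber 1 (Metric.closedBall (0 : E) 2) ≤ (5 ^ Module.finrank ℝ E : ℕ) := by
  refine iSup₂_le fun C hC => iSup_le fun separated => ?_
  have card_le (s : Finset E) (hs : (s : Set E) ⊆ C) : s.card ≤ 5 ^ Module.finrank ℝ E := by
    refine Besicovitch.card_le_of_separated s (fun c hc => by simpa using hC (hs hc))
      fun c hc d hd hcd => ?_
    have one_lt : ((1 : NNReal) : ENNReal) < edist c d := separated (hs hc) (hs hd) hcd
    rw [edist_dist, ENNReal.coe_one, ← ENNReal.ofReal_one,
      ENNReal.ofReal_lt_ofReal_iff_of_nonneg zero_le_one, dist_eq_norm] at one_lt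
    exact one_lt.le
  by_contra! hlt
  obtain ⟨s, hs, hs_card⟩ := Set.exists_subset_encard_eq (Order.add_one_le_of_lt hlt)
  have finite : s.Finite := Set.finite_of_encard_eq_coe (k := 5 ^ Module.finrank ℝ E + 1)
    (by rw [hs_card]; norm_cast)
  have := card_le finite.toFinset (by simpa using hs)
  rw [finite.encard_eq_coe_toFinset_card] at hs_card
  norm_cast at hs_card
  omega

theorem exists_finset_norm_le_two_mul_inner (E : Type*) [NormedAddCommGroup E]
    [InnerProductSpace ℝ E] [FiniteDimensional ℝ E] :
    ∃ N : Finset E, N.card ≤ 5 ^ Module.finrank ℝ E ∧ (∀ z ∈ N, ‖z‖ ≤ 1) ∧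
      ∀ y : E, ∃ z ∈ N, ‖y‖ ≤ 2 * inner ℝ y z := by
  classical
  have packing := packingNumber_closedBall_le E
  have packing_ne_top := (packing.trans_lt (ENat.natCast_lt_top _)).ne
  set C := Metric.maximalSeparatedSet 1 (Metric.closedBall (0 : E) 2)
  have C_card : C.encard ≤ (5 ^ Module.finrank ℝ E : ℕ) :=
    (Metric.encard_maximalSeparatedSet packing_ne_top).trans_le packing
  have C_finite : C.Finite := Set.finite_of_encard_le_coe C_card
  refine ⟨C_finite.toFinset.image ((2 : ℝ)⁻¹ • ·), Finset.card_image_le.trans ?_, ?_, fun y => ?_⟩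
  · rwa [C_finite.encard_eq_coe_toFinset_card, Nat.cast_le] at C_card
  · simp only [Finset.forall_mem_image, Set.Finite.mem_toFinset, norm_smul]
    intro c hc
    have : ‖c‖ ≤ 2 := by simpa using Metric.maximalSeparatedSet_subset hc
    norm_num
    linarith
  · have mem_ball : (2 / ‖y‖) • y ∈ Metric.closedBall (0 : E) 2 := by
      rw [mem_closedBall_zero_iff, norm_smul, Real.norm_of_nonneg (by positivity),
        div_mul_eq_mul_div, mul_div_assoc]
      exact mul_le_of_le_one_right zero_le_two (div_self_le_one _)
    obtain ⟨c, hc, hyc⟩ := Metric.isCover_maximalSeparatedSet packing_ne_top mem_ball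
    replace hyc : ‖(2 / ‖y‖) • y - c‖ ≤ 1 := by
      simpa [edist_dist, dist_eq_norm, -ofReal_norm] using hyc
    refine ⟨(2 : ℝ)⁻¹ • c, Finset.mem_image_of_mem _ (C_finite.mem_toFinset.2 hc), ?_⟩
    rw [real_inner_smul_right, mul_inv_cancel_left₀ two_ne_zero]
    rcases eq_or_ne y 0 with rfl | hy
    · simp
    have cauchy_schwarz := real_inner_le_norm y ((2 / ‖y‖) • y - c)
    rw [inner_sub_right, real_inner_smul_right, real_inner_self_eq_norm_sq,
      show 2 / ‖y‖ * ‖y‖ ^ 2 = 2 * ‖y‖ by field_simp] at cauchy_schwarz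
    nlinarith [norm_nonneg y]

theorem exists_finset_vnorm_le_two_mul_dotProduct (ι : Type*) [Fintype ι] :
    ∃ N : Finset (ι → ℝ), N.card ≤ 5 ^ Fintype.card ι ∧ (∀ z ∈ N, vnorm z ≤ 1) ∧
      ∀ y : ι → ℝ, ∃ z ∈ N, vnorm y ≤ 2 * (y ⬝ᵥ z) := by
  classical
  obtain ⟨N, hN_card, hN_norm, hN⟩ :=
    exists_finset_norm_le_two_mul_inner (EuclideanSpace ℝ ι)
  refine ⟨N.image WithLp.ofLp, Finset.card_image_le.trans (by simpa using hN_card), ?_,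
    fun y => ?_⟩
  · exact Finset.forall_mem_image.2 hN_norm
  · obtain ⟨z, hz, hyz⟩ := hN (WithLp.toLp 2 y)
    refine ⟨z.ofLp, Finset.mem_image_of_mem _ hz, hyz.trans_eq ?_⟩
    rw [EuclideanSpace.inner_eq_star_dotProduct, star_trivial, dotProduct_comm]

theorem exists_finset_matrix_norm_le_two_mul_sum (ι κ : Type*) [Fintype ι] [Fintype κ] :
    ∃ N : Finset (Matrix ι κ ℝ), N.card ≤ 5 ^ (Fintype.card ι * Fintype.card κ) ∧
      (∀ D ∈ N, ‖D‖ ≤ 1) ∧ ∀ Y : Matrix ι κ ℝ, ∃ D ∈ N, ‖Y‖ ≤ 2 * ∑ i, ∑ j, Y i j * D i j := by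
  classical
  obtain ⟨N, hN_card, hN_norm, hN⟩ := exists_finset_vnorm_le_two_mul_dotProduct (ι × κ)
  have norm_of (y : ι × κ → ℝ) :
      ‖(Matrix.of fun i j => y (i, j) : Matrix ι κ ℝ)‖ = vnorm y := by
    rw [← sq_eq_sq₀ (norm_nonneg _) (vnorm_nonneg _), frobenius_norm_sq, vnorm_sq_eq_sum,
      Fintype.sum_prod_type]
    rfl
  refine ⟨N.image fun y => Matrix.of fun i j => y (i, j), ?_, ?_, fun Y => ?_⟩
  · exact Finset.card_image_le.trans (by rwa [Fintype.card_prod] at hN_card)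
  · exact Finset.forall_mem_image.2 fun y hy => (norm_of y).trans_le (hN_norm y hy)
  · obtain ⟨z, hz, hYz⟩ := hN fun p => Y p.1 p.2
    refine ⟨_, Finset.mem_image_of_mem _ hz, ?_⟩
    rwa [← norm_of, dotProduct, Fintype.sum_prod_type] at hYz

end Net

/-! ### Measurability of matrix-valued maps -/

section Measurability

variable {𝓧 ι κ ν : Type*} [MeasurableSpace 𝓧]

/-- A matrix-valued random variable, given by its entries. (Mathlib puts no measurable structure on
matrices.) -/
def EntrywiseMeasurable (M : 𝓧 → Matrix ι κ ℝ) : Prop := ∀ i j, Measurable fun x => M x i j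

namespace EntrywiseMeasurable

theorem const (M : Matrix ι κ ℝ) :
    EntrywiseMeasurable fun _ : 𝓧 => M := fun _ _ => measurable_const

theorem transpose {M : 𝓧 → Matrix ι κ ℝ} (hM : EntrywiseMeasurable M) :
    EntrywiseMeasurable fun x => (M x)ᵀ := fun i j => hM j i

theorem mul [Fintype κ] {M : 𝓧 → Matrix ι κ ℝ} {N : 𝓧 → Matrix κ ν ℝ}
    (hM : EntrywiseMeasurable M) (hN : EntrywiseMeasurable N) :
    EntrywiseMeasurable fun x => M x * N x := fun i j => by
  simp only [Matrix.mul_apply]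
  exact Finset.measurable_sum _ fun k _ => (hM i k).mul (hN k j)

theorem sub {M N : 𝓧 → Matrix ι κ ℝ}
    (hM : EntrywiseMeasurable M) (hN : EntrywiseMeasurable N) :
    EntrywiseMeasurable fun x => M x - N x := fun i j => (hM i j).sub (hN i j)

theorem const_smul {M : 𝓧 → Matrix ι κ ℝ}
    (hM : EntrywiseMeasurable M) (c : ℝ) :
    EntrywiseMeasurable fun x => c • M x := fun i j => (hM i j).const_mul c

theorem sum {J : Type*} {s : Finset J} {M : J → 𝓧 → Matrix ι κ ℝ}
    (hM : ∀ j ∈ s, EntrywiseMeasurable (M j)) :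
    EntrywiseMeasurable fun x => ∑ j ∈ s, M j x := fun i k => by
  simp only [Matrix.sum_apply]
  exact Finset.measurable_sum _ fun j hj => hM j hj i k

theorem mulVec [Fintype κ] {M : 𝓧 → Matrix ι κ ℝ} {v : 𝓧 → κ → ℝ}
    (hM : EntrywiseMeasurable M) (hv : Measurable v) : Measurable fun x => M x *ᵥ v x := by
  refine measurable_pi_lambda _ fun i => ?_
  simp only [Matrix.mulVec, dotProduct]
  exact Finset.measurable_sum _ fun k _ => (hM i k).mul ((measurable_pi_apply k).comp hv)

theorem vecMulVec {v : 𝓧 → ι → ℝ} {w : 𝓧 → κ → ℝ} (hv : Measurable v)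
    (hw : Measurable w) : EntrywiseMeasurable fun x => Matrix.vecMulVec (v x) (w x) := fun i j =>
  ((measurable_pi_apply i).comp hv).mul ((measurable_pi_apply j).comp hw)

theorem det [Fintype ι] [DecidableEq ι] {M : 𝓧 → Matrix ι ι ℝ}
    (hM : EntrywiseMeasurable M) : Measurable fun x => (M x).det := by
  simp only [Matrix.det_apply']
  exact Finset.measurable_sum _ fun s _ => measurable_const.mul
    (Finset.measurable_prod _ fun i _ => hM _ _)

theorem inv [Fintype ι] [DecidableEq ι] {M : 𝓧 → Matrix ι ι ℝ}
    (hM : EntrywiseMeasurable M) : EntrywiseMeasurable fun x => (M x)⁻¹ := fun i j => by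
  simp only [Matrix.inv_def, Ring.inverse_eq_inv', Matrix.smul_apply, smul_eq_mul,
    Matrix.adjugate_apply]
  refine hM.det.inv.mul (EntrywiseMeasurable.det (M := fun x => (M x).updateRow j (Pi.single i 1))
    fun k l => ?_)
  by_cases h : k = j
  · subst h; simp only [Matrix.updateRow_self]; exact measurable_const
  · simp only [Matrix.updateRow_ne h]; exact hM k l

theorem pinv {m r : ℕ} {M : 𝓧 → Matrix (Fin m) (Fin r) ℝ}
    (hM : EntrywiseMeasurable M) : EntrywiseMeasurable fun x => pinv (M x) :=
  (hM.transpose.mul hM).inv.mul hM.transpose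

theorem norm [Fintype ι] [Fintype κ] {M : 𝓧 → Matrix ι κ ℝ}
    (hM : EntrywiseMeasurable M) : Measurable fun x => ‖M x‖ := by
  have norm_eq : (fun x => ‖M x‖) = fun x => √(∑ i, ∑ j, M x i j ^ 2) := by
    funext x
    rw [← frobenius_norm_sq, Real.sqrt_sq (norm_nonneg _)]
  rw [norm_eq]
  have entries (i j) : Measurable fun x => M x i j := hM i j
  fun_prop

end EntrywiseMeasurable

theorem measurable_vnorm [Fintype ι] {v : 𝓧 → ι → ℝ} (hv : Measurable v) :
    Measurable fun x => vnorm (v x) := by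
  have vnorm_eq : (fun x => vnorm (v x)) = fun x => √(∑ i, v x i * v x i) := by
    funext x
    rw [← Real.sqrt_sq (vnorm_nonneg (v x)), vnorm_sq, dotProduct]
  rw [vnorm_eq]
  fun_prop

end Measurability

/-! ### Least squares with a well-conditioned matrix -/

section LeastSquares

variable {m n r : ℕ}

/-- All `r` singular values of `W` are at least `√(m / 2)`. The columns of a standard Gaussian
matrix have expected squared norm `m`, so this leaves room for fluctuations by a constant factor. -/
def WellConditioned (W : Matrix (Fin m) (Fin r) ℝ) : Prop :=
  ∀ z, (m : ℝ) / 2 * vnorm z ^ 2 ≤ vnorm (W *ᵥ z) ^ 2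

theorem isClosed_wellConditioned :
    IsClosed {W : Fin m → Fin r → ℝ | WellConditioned (Matrix.of W)} := by
  simp only [WellConditioned, Set.ofPred_forall, vnorm_sq]
  refine isClosed_iInter fun z => isClosed_le continuous_const ?_
  simp only [Matrix.mulVec, dotProduct, Matrix.of_apply]
  fun_prop

theorem pinv_mulVec_dotProduct (W : Matrix (Fin m) (Fin r) ℝ) (v : Fin m → ℝ) (h : Fin r → ℝ) :
    (pinv W *ᵥ v) ⬝ᵥ h = v ⬝ᵥ (W *ᵥ ((Wᵀ * W)⁻¹ *ᵥ h)) := by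
  have transpose_pinv : (pinv W)ᵀ = W * (Wᵀ * W)⁻¹ := by
    rw [pinv, Matrix.transpose_mul, Matrix.transpose_transpose, Matrix.transpose_nonsing_inv,
      Matrix.transpose_mul, Matrix.transpose_transpose]
  rw [Matrix.mulVec_mulVec, ← transpose_pinv, Matrix.dotProduct_mulVec, Matrix.vecMul_transpose]

namespace WellConditioned

variable {W : Matrix (Fin m) (Fin r) ℝ}

theorem le_vnorm_gram_mulVec (hW : WellConditioned W) (z : Fin r → ℝ) :
    m / 2 * vnorm z ≤ vnorm ((Wᵀ * W) *ᵥ z) := by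
  rcases (vnorm_nonneg z).eq_or_lt with z_zero | z_pos
  · rw [← z_zero, mul_zero]
    exact vnorm_nonneg _
  refine le_of_mul_le_mul_left ?_ z_pos
  calc vnorm z * (m / 2 * vnorm z) = m / 2 * vnorm z ^ 2 := by ring
    _ ≤ z ⬝ᵥ ((Wᵀ * W) *ᵥ z) := (hW z).trans_eq (vnorm_sq_mulVec W z)
    _ ≤ vnorm z * vnorm ((Wᵀ * W) *ᵥ z) := dotProduct_le_vnorm_mul_vnorm _ _

variable (hm : 0 < m) (hW : WellConditioned W)
include hm hW

theorem vnorm_le_of_gram_mulVec_eq {z h : Fin r → ℝ} (hz : (Wᵀ * W) *ᵥ z = h) :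
    vnorm z ≤ 2 / m * vnorm h := by
  have : (0 : ℝ) < m := Nat.cast_pos.2 hm
  calc vnorm z = 2 / m * (m / 2 * vnorm z) := by field_simp
    _ ≤ 2 / m * vnorm h := by
      rw [← hz]
      gcongr
      exact hW.le_vnorm_gram_mulVec z

theorem isUnit_det : IsUnit (Wᵀ * W).det := by
  rw [← Matrix.isUnit_iff_isUnit_det, ← Matrix.mulVec_injective_iff_isUnit]
  refine (injective_iff_map_eq_zero (Matrix.mulVecLin (Wᵀ * W))).2 fun z hz => ?_
  have vnorm_le := hW.vnorm_le_of_gram_mulVec_eq hm hz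
  rw [vnorm_zero, mul_zero] at vnorm_le
  exact vnorm_eq_zero.1 (vnorm_le.antisymm (vnorm_nonneg z))

theorem vnorm_pinv_mulVec_le (v : Fin m → ℝ) :
    vnorm (pinv W *ᵥ v) ≤ 2 / m * vnorm (Wᵀ *ᵥ v) := by
  refine hW.vnorm_le_of_gram_mulVec_eq hm ?_
  rw [pinv, Matrix.mulVec_mulVec, ← Matrix.mul_assoc,
    Matrix.mul_nonsing_inv _ (hW.isUnit_det hm), Matrix.one_mul]

theorem vnorm_sq_mulVec_inv_le (h : Fin r → ℝ) :
    vnorm (W *ᵥ ((Wᵀ * W)⁻¹ *ᵥ h)) ^ 2 ≤ 2 / m * vnorm h ^ 2 := by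
  set z := (Wᵀ * W)⁻¹ *ᵥ h
  have hz : (Wᵀ * W) *ᵥ z = h := by
    rw [Matrix.mulVec_mulVec, Matrix.mul_nonsing_inv _ (hW.isUnit_det hm), Matrix.one_mulVec]
  calc vnorm (W *ᵥ z) ^ 2 = z ⬝ᵥ h := by rw [vnorm_sq_mulVec, hz]
    _ ≤ vnorm z * vnorm h := dotProduct_le_vnorm_mul_vnorm _ _
    _ ≤ 2 / m * vnorm h * vnorm h :=
      mul_le_mul_of_nonneg_right (hW.vnorm_le_of_gram_mulVec_eq hm hz) (vnorm_nonneg h)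
    _ = 2 / m * vnorm h ^ 2 := by ring

omit hW in
theorem lsCoeff_eq {A : Matrix (Fin m) (Fin n) ℝ} {U : Matrix (Fin n) (Fin r) ℝ}
    (hW : WellConditioned (A * U)) (x : Fin n → ℝ) :
    lsCoeff A U x = Uᵀ *ᵥ x + pinv (A * U) *ᵥ (A *ᵥ residual U x) := by
  have left_inv : pinv (A * U) * (A * U) = 1 := by
    rw [pinv, Matrix.mul_assoc, Matrix.nonsing_inv_mul _ (hW.isUnit_det hm)]
  rw [lsCoeff, residual, Matrix.mulVec_sub, Matrix.mulVec_sub, Matrix.mulVec_mulVec _ A U,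
    Matrix.mulVec_mulVec _ (pinv (A * U)) (A * U), left_inv, Matrix.one_mulVec]
  abel

end WellConditioned

end LeastSquares

/-! ### Concentration for one measurement matrix -/

section SingleMatrix

variable {Ω : Type*} {mΩ : MeasurableSpace Ω} {P : Measure Ω} {m n r : ℕ}

theorem mulVec_apply_eq_sum (A : Matrix (Fin m) (Fin n) ℝ) (v : Fin n → ℝ) (i : Fin m) :
    (A *ᵥ v) i = ∑ b, v b * A i b := by
  simp [Matrix.mulVec, dotProduct, mul_comm]

theorem measure_biUnion_le_of_card_le {ι : Type*} {N : Finset ι} {S : ι → Set Ω} {k p : ℝ}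
    (hN : (N.card : ℝ) ≤ k) (h : ∀ z ∈ N, P (S z) ≤ ENNReal.ofReal p) :
    P (⋃ z ∈ N, S z) ≤ ENNReal.ofReal (k * p) := by
  refine (measure_biUnion_finset_le N S).trans ((Finset.sum_le_sum h).trans ?_)
  rw [Finset.sum_const, nsmul_eq_mul, ENNReal.ofReal_mul ((Nat.cast_nonneg _).trans hN),
    ← ENNReal.ofReal_natCast]
  gcongr

theorem vnorm_mulVec_le_of_net {Q : Matrix (Fin r) (Fin r) ℝ} {N : Finset (Fin r → ℝ)} {c : ℝ}
    (hN : ∀ y : Fin r → ℝ, ∃ z ∈ N, vnorm y ≤ 2 * (y ⬝ᵥ z)) (hQ_symm : Qᵀ = Q)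
    (hQ : ∀ z ∈ N, ∀ z' ∈ N, (Q *ᵥ z) ⬝ᵥ z' ≤ c) (y : Fin r → ℝ) :
    vnorm (Q *ᵥ y) ≤ 4 * c * vnorm y := by
  have on_net : ∀ z ∈ N, vnorm (Q *ᵥ z) ≤ 2 * c := fun z hz => by
    obtain ⟨z', hz', le_dot⟩ := hN (Q *ᵥ z)
    linarith [hQ z hz z' hz']
  obtain ⟨z, hz, le_dot⟩ := hN (Q *ᵥ y)
  calc vnorm (Q *ᵥ y) ≤ 2 * (y ⬝ᵥ (Q *ᵥ z)) := by
        rwa [← transpose_mulVec_dotProduct, hQ_symm]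
    _ ≤ 2 * (vnorm y * (2 * c)) := by
        have := mul_le_mul_of_nonneg_left (on_net z hz) (vnorm_nonneg y)
        linarith [dotProduct_le_vnorm_mul_vnorm y (Q *ᵥ z)]
    _ = 4 * c * vnorm y := by ring

theorem WellConditioned.of_vnorm_gram_sub_smul_one_mulVec_le {W : Matrix (Fin m) (Fin r) ℝ}
    (hW : ∀ z, vnorm ((Wᵀ * W - (m : ℝ) • 1) *ᵥ z) ≤ m / 2 * vnorm z) : WellConditioned W := by
  intro z
  have vnorm_neg : vnorm (-z) = vnorm z := by simp [vnorm]
  have quadratic_form :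
      z ⬝ᵥ ((Wᵀ * W - (m : ℝ) • 1) *ᵥ z) = vnorm (W *ᵥ z) ^ 2 - m * vnorm z ^ 2 := by
    rw [vnorm_sq_mulVec, Matrix.sub_mulVec, dotProduct_sub, Matrix.smul_mulVec,
      dotProduct_smul, Matrix.one_mulVec, vnorm_sq, smul_eq_mul]
  have cauchy_schwarz := dotProduct_le_vnorm_mul_vnorm (-z) ((Wᵀ * W - (m : ℝ) • 1) *ᵥ z)
  rw [neg_dotProduct, vnorm_neg, quadratic_form] at cauchy_schwarz
  have := mul_le_mul_of_nonneg_left (hW z) (vnorm_nonneg z)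
  linarith

theorem sum_mul_sub_dotProduct_eq_gram (A : Matrix (Fin m) (Fin n) ℝ)
    {U : Matrix (Fin n) (Fin r) ℝ} (hU : Uᵀ * U = 1) (z z' : Fin r → ℝ) :
    ∑ i, ((∑ b, (U *ᵥ z) b * A i b) * (∑ b, (U *ᵥ z') b * A i b) - (U *ᵥ z) ⬝ᵥ (U *ᵥ z')) =
      (((A * U)ᵀ * (A * U) - (m : ℝ) • 1) *ᵥ z) ⬝ᵥ z' := by
  simp only [← mulVec_apply_eq_sum, mulVec_dotProduct_mulVec hU]
  rw [Finset.sum_sub_distrib, Finset.sum_const, Finset.card_univ, Fintype.card_fin,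
    nsmul_eq_mul, Matrix.sub_mulVec, sub_dotProduct, Matrix.smul_mulVec, smul_dotProduct,
    Matrix.one_mulVec, smul_eq_mul, ← Matrix.mulVec_mulVec, transpose_mulVec_dotProduct,
    Matrix.mulVec_mulVec, Matrix.mulVec_mulVec]
  rfl

variable {A : Ω → Matrix (Fin m) (Fin n) ℝ}
  (hA : IsStdGaussian (fun (p : Fin m × Fin n) ω => A ω p.1 p.2) P)
  {U : Matrix (Fin n) (Fin r) ℝ} (hU : Uᵀ * U = 1)
include hA hU

theorem measure_lt_gram_sub_smul_one_dotProduct_le {z z' : Fin r → ℝ} (hz : vnorm z ≤ 1)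
    (hz' : vnorm z' ≤ 1) :
    P {ω | (m : ℝ) / 8 < (((A ω * U)ᵀ * (A ω * U) - (m : ℝ) • 1) *ᵥ z) ⬝ᵥ z'} ≤
      ENNReal.ofReal (Real.exp (-(m / 1024))) := by
  have vnorm_mul_le : vnorm (U *ᵥ z) * vnorm (U *ᵥ z') ≤ 1 := by
    rw [vnorm_orthonormal_mulVec hU, vnorm_orthonormal_mulVec hU]
    exact mul_le_one₀ hz (vnorm_nonneg _) hz'
  have vnorm_mul_nonneg : 0 ≤ vnorm (U *ᵥ z) * vnorm (U *ᵥ z') :=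
    mul_nonneg (vnorm_nonneg _) (vnorm_nonneg _)
  simp only [← sum_mul_sub_dotProduct_eq_gram _ hU]
  refine (IsStdGaussian.measure_sum_mul_le (X := fun i b ω => A ω i b) hA
    (fun _ => U *ᵥ z) (fun _ => U *ᵥ z') (l := 1 / 64) (by norm_num)
    (fun _ => by linarith) (S := m) ?_ (m / 8)).trans_eq ?_
  · rw [Finset.sum_const, Finset.card_univ, Fintype.card_fin, nsmul_eq_mul]
    exact mul_le_of_le_one_right (Nat.cast_nonneg _) (pow_le_one₀ vnorm_mul_nonneg vnorm_mul_le)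
  · congr 2
    ring

theorem measure_not_wellConditioned_le :
    P {ω | ¬ WellConditioned (A ω * U)} ≤ ENNReal.ofReal (25 ^ r * Real.exp (-(m / 1024))) := by
  obtain ⟨N, N_card, N_vnorm, hN⟩ := exists_finset_vnorm_le_two_mul_dotProduct (Fin r)
  have bad_subset : {ω | ¬ WellConditioned (A ω * U)} ⊆ ⋃ z ∈ N ×ˢ N,
      {ω | (m : ℝ) / 8 < (((A ω * U)ᵀ * (A ω * U) - (m : ℝ) • 1) *ᵥ z.1) ⬝ᵥ z.2} := by
    intro ω hω
    by_contra no_witness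
    simp only [Set.mem_iUnion, not_exists, Set.mem_ofPred_eq, not_lt] at no_witness
    refine hω (WellConditioned.of_vnorm_gram_sub_smul_one_mulVec_le fun z => ?_)
    have := vnorm_mulVec_le_of_net hN (by simp)
      (fun z hz z' hz' => no_witness (z, z') (Finset.mk_mem_product hz hz')) z
    linarith
  refine (measure_mono bad_subset).trans (measure_biUnion_le_of_card_le ?_ fun z hz => ?_)
  · rw [Fintype.card_fin] at N_card
    rw [Finset.card_product, show (25 : ℝ) ^ r = 5 ^ r * 5 ^ r by rw [← mul_pow]; norm_num]
    exact_mod_cast Nat.mul_le_mul N_card N_card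
  · obtain ⟨hz₁, hz₂⟩ := Finset.mem_product.1 hz
    exact measure_lt_gram_sub_smul_one_dotProduct_le hA hU (N_vnorm _ hz₁) (N_vnorm _ hz₂)

variable {y : Fin n → ℝ} (hy : Uᵀ *ᵥ y = 0)
include hy

theorem measure_lt_transpose_mulVec_dotProduct_le (hy_pos : 0 < vnorm y) {z : Fin r → ℝ}
    (hz : vnorm z ≤ 1) :
    P {ω | m / 40 * vnorm y < ((A ω * U)ᵀ *ᵥ (A ω *ᵥ y)) ⬝ᵥ z} ≤
      ENNReal.ofReal (Real.exp (-(m / 25600))) := by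
  have sum_eq (ω : Ω) : ∑ i, ((∑ b, y b * A ω i b) * (∑ b, (U *ᵥ z) b * A ω i b) -
      y ⬝ᵥ (U *ᵥ z)) = ((A ω * U)ᵀ *ᵥ (A ω *ᵥ y)) ⬝ᵥ z := by
    simp only [← mulVec_apply_eq_sum, ← transpose_mulVec_dotProduct, hy, zero_dotProduct, sub_zero]
    rw [transpose_mulVec_dotProduct, ← Matrix.mulVec_mulVec, dotProduct]
  have vnorm_mul_le : vnorm y * vnorm (U *ᵥ z) ≤ vnorm y := by
    rw [vnorm_orthonormal_mulVec hU]
    exact mul_le_of_le_one_right hy_pos.le hz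
  have vnorm_mul_nonneg := mul_nonneg hy_pos.le (vnorm_nonneg (U *ᵥ z))
  simp only [← sum_eq]
  refine (IsStdGaussian.measure_sum_mul_le (X := fun i b ω => A ω i b) hA
    (fun _ => y) (fun _ => U *ᵥ z) (l := 1 / (320 * vnorm y)) (by positivity)
    (fun _ => ?_) (S := m * vnorm y ^ 2) ?_ (m / 40 * vnorm y)).trans_eq ?_
  · rw [div_mul_eq_mul_div, one_mul, div_le_div_iff₀ (by positivity) (by norm_num)]
    linarith
  · rw [Finset.sum_const, Finset.card_univ, Fintype.card_fin, nsmul_eq_mul]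
    gcongr
  · congr 2
    field_simp
    ring

theorem measure_lt_vnorm_transpose_mulVec_le :
    P {ω | m / 20 * vnorm y < vnorm ((A ω * U)ᵀ *ᵥ (A ω *ᵥ y))} ≤
      ENNReal.ofReal (5 ^ r * Real.exp (-(m / 25600))) := by
  rcases eq_or_ne y 0 with rfl | y_ne_zero
  · simp [vnorm_zero]
  have y_pos : 0 < vnorm y := (vnorm_nonneg y).lt_of_ne' (mt vnorm_eq_zero.1 y_ne_zero)
  obtain ⟨N, N_card, N_vnorm, hN⟩ := exists_finset_vnorm_le_two_mul_dotProduct (Fin r)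
  have bad_subset : {ω | m / 20 * vnorm y < vnorm ((A ω * U)ᵀ *ᵥ (A ω *ᵥ y))} ⊆
      ⋃ z ∈ N, {ω | m / 40 * vnorm y < ((A ω * U)ᵀ *ᵥ (A ω *ᵥ y)) ⬝ᵥ z} := by
    intro ω hω
    obtain ⟨z, hz, le_dot⟩ := hN ((A ω * U)ᵀ *ᵥ (A ω *ᵥ y))
    refine Set.mem_biUnion hz ?_
    simp only [Set.mem_ofPred_eq] at hω ⊢
    linarith
  refine (measure_mono bad_subset).trans (measure_biUnion_le_of_card_le ?_ fun z hz =>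
    measure_lt_transpose_mulVec_dotProduct_le hA hU hy y_pos (N_vnorm z hz))
  rw [Fintype.card_fin] at N_card
  exact_mod_cast N_card

omit hy in
theorem measure_not_lsCoeff_accurate_le (hm : 0 < m) (x : Fin n → ℝ) :
    P {ω | ¬ (WellConditioned (A ω * U) ∧
      vnorm (lsCoeff (A ω) U x - Uᵀ *ᵥ x) ≤ 0.1 * vnorm (residual U x))} ≤
      ENNReal.ofReal (2 * 25 ^ r * Real.exp (-(m / 25600))) := by
  set y := residual U x
  have : (0 : ℝ) < m := Nat.cast_pos.2 hm
  have bad_subset : {ω | ¬ (WellConditioned (A ω * U) ∧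
      vnorm (lsCoeff (A ω) U x - Uᵀ *ᵥ x) ≤ 0.1 * vnorm y)} ⊆
      {ω | ¬ WellConditioned (A ω * U)} ∪
        {ω | m / 20 * vnorm y < vnorm ((A ω * U)ᵀ *ᵥ (A ω *ᵥ y))} := by
    intro ω hω
    by_contra not_mem
    simp only [Set.mem_union, Set.mem_ofPred_eq, not_or, not_not, not_lt] at not_mem
    obtain ⟨hW, vnorm_le⟩ := not_mem
    refine hω ⟨hW, ?_⟩
    rw [hW.lsCoeff_eq hm x, add_sub_cancel_left]
    calc vnorm (pinv (A ω * U) *ᵥ (A ω *ᵥ y))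
        ≤ 2 / m * vnorm ((A ω * U)ᵀ *ᵥ (A ω *ᵥ y)) := hW.vnorm_pinv_mulVec_le hm _
      _ ≤ 2 / m * (m / 20 * vnorm y) := by gcongr
      _ = 0.1 * vnorm y := by
        field_simp
        ring
  refine (measure_mono bad_subset).trans ((measure_union_le _ _).trans ((add_le_add
    (measure_not_wellConditioned_le hA hU) (measure_lt_vnorm_transpose_mulVec_le hA hU
      (transpose_mulVec_residual hU x))).trans ?_))
  rw [← ENNReal.ofReal_add (by positivity) (by positivity), mul_assoc, two_mul]
  gcongr <;> norm_num

end SingleMatrix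

/-! ### Concentration of sums over many measurement matrices -/

section Batch

variable {J : Type*} [Fintype J] {m n r : ℕ}

theorem sum_vecMulVec_mul_eq_dotProduct (v : Fin n → ℝ) (w : Fin r → ℝ)
    (D : Matrix (Fin n) (Fin r) ℝ) :
    ∑ i, ∑ k, Matrix.vecMulVec v w i k * D i k = v ⬝ᵥ (D *ᵥ w) := by
  simp only [dotProduct, Matrix.mulVec, Matrix.vecMulVec_apply, Finset.mul_sum]
  exact Finset.sum_congr rfl fun i _ => Finset.sum_congr rfl fun k _ => by ring

theorem sum_sum_vecMulVec_mul_eq_sum_dotProduct (v : J → Fin n → ℝ) (w : J → Fin r → ℝ)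
    (D : Matrix (Fin n) (Fin r) ℝ) :
    ∑ i, ∑ k, (∑ j, Matrix.vecMulVec (v j) (w j)) i k * D i k = ∑ j, v j ⬝ᵥ (D *ᵥ w j) := by
  simp only [← sum_vecMulVec_mul_eq_dotProduct, Matrix.sum_apply, Finset.sum_mul]
  rw [Finset.sum_comm_cycle, Finset.sum_comm]

theorem sum_gradient_sub_mul_eq_sum_rows (A : J → Matrix (Fin m) (Fin n) ℝ) (w : J → Fin n → ℝ)
    (b : J → Fin r → ℝ) (D : Matrix (Fin n) (Fin r) ℝ) :
    ∑ i, ∑ k, (∑ j, Matrix.vecMulVec ((A j)ᵀ *ᵥ (A j *ᵥ w j)) (b j) -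
        (m : ℝ) • ∑ j, Matrix.vecMulVec (w j) (b j)) i k * D i k =
      ∑ p : J × Fin m, ((∑ c, w p.1 c * A p.1 p.2 c) * (∑ c, (D *ᵥ b p.1) c * A p.1 p.2 c) -
        w p.1 ⬝ᵥ (D *ᵥ b p.1)) := by
  simp only [Matrix.sub_apply, Matrix.smul_apply, sub_mul, smul_eq_mul, mul_assoc,
    Finset.sum_sub_distrib, ← Finset.mul_sum, sum_sum_vecMulVec_mul_eq_sum_dotProduct]
  rw [Fintype.sum_prod_type, Fintype.sum_prod_type, Finset.mul_sum]
  congr 1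
  · refine Finset.sum_congr rfl fun j _ => ?_
    simp only [← mulVec_apply_eq_sum]
    exact transpose_mulVec_dotProduct ..
  · simp

variable {Ω : Type*} {mΩ : MeasurableSpace Ω} {P : Measure Ω} {A : J → Ω → Matrix (Fin m) (Fin n) ℝ}
  (hA : IsStdGaussian (fun (p : J × Fin m × Fin n) ω => A p.1 ω p.2.1 p.2.2) P)
include hA

theorem measure_lt_norm_gradient_sub_le (w : J → Fin n → ℝ) (b : J → Fin r → ℝ) {l S : ℝ}
    (hl0 : 0 < l) (hl : ∀ j, l * (vnorm (w j) * vnorm (b j)) ≤ 1 / 8)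
    (hS : ∀ D : Matrix (Fin n) (Fin r) ℝ, ‖D‖ ≤ 1 →
      m * ∑ j, (vnorm (w j) * vnorm (D *ᵥ b j)) ^ 2 ≤ S) (t : ℝ) :
    P {ω | 2 * t < ‖∑ j, Matrix.vecMulVec ((A j ω)ᵀ *ᵥ (A j ω *ᵥ w j)) (b j) -
      (m : ℝ) • ∑ j, Matrix.vecMulVec (w j) (b j)‖} ≤
      ENNReal.ofReal (5 ^ (n * r) * Real.exp (-(l * t - 4 * l ^ 2 * S))) := by
  obtain ⟨N, N_card, N_norm, hN⟩ := exists_finset_matrix_norm_le_two_mul_sum (Fin n) (Fin r)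
  have rows : IsStdGaussian (fun (p : (J × Fin m) × Fin n) ω => A p.1.1 ω p.1.2 p.2) P :=
    hA.precomp (Equiv.prodAssoc J (Fin m) (Fin n)).injective
  have bad_subset : {ω | 2 * t < ‖∑ j, Matrix.vecMulVec ((A j ω)ᵀ *ᵥ (A j ω *ᵥ w j)) (b j) -
      (m : ℝ) • ∑ j, Matrix.vecMulVec (w j) (b j)‖} ⊆ ⋃ D ∈ N,
      {ω | t < ∑ p : J × Fin m, ((∑ c, w p.1 c * A p.1 ω p.2 c) *
        (∑ c, (D *ᵥ b p.1) c * A p.1 ω p.2 c) - w p.1 ⬝ᵥ (D *ᵥ b p.1))} := by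
    intro ω hω
    obtain ⟨D, hD, norm_le⟩ := hN (∑ j, Matrix.vecMulVec ((A j ω)ᵀ *ᵥ (A j ω *ᵥ w j)) (b j) -
      (m : ℝ) • ∑ j, Matrix.vecMulVec (w j) (b j))
    rw [sum_gradient_sub_mul_eq_sum_rows (fun j => A j ω)] at norm_le
    refine Set.mem_biUnion hD ?_
    simp only [Set.mem_ofPred_eq] at hω ⊢
    linarith
  refine (measure_mono bad_subset).trans (measure_biUnion_le_of_card_le ?_ fun D hD => ?_)
  · rw [Fintype.card_fin, Fintype.card_fin] at N_card
    exact_mod_cast N_card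
  · refine IsStdGaussian.measure_sum_mul_le (X := fun (p : J × Fin m) c ω => A p.1 ω p.2 c) rows
      (fun p => w p.1) (fun p => D *ᵥ b p.1) hl0 (fun p => ?_) ?_ t
    · refine le_trans ?_ (hl p.1)
      gcongr
      · exact vnorm_nonneg _
      · exact (vnorm_mulVec_le D _).trans (mul_le_of_le_one_left (vnorm_nonneg _) (N_norm D hD))
    · refine le_trans (le_of_eq ?_) (hS D (N_norm D hD))
      simp [Fintype.sum_prod_type, Finset.mul_sum]

theorem measure_lt_sum_dotProduct_mulVec_le (c : J → Fin m → ℝ) (y : J → Fin n → ℝ) {l V : ℝ}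
    (hl : 0 ≤ l) (hV : ∑ j, vnorm (c j) ^ 2 * vnorm (y j) ^ 2 ≤ V) (t : ℝ) :
    P {ω | t < ∑ j, c j ⬝ᵥ (A j ω *ᵥ y j)} ≤
      ENNReal.ofReal (Real.exp (-(l * t - l ^ 2 * V / 2))) := by
  set a : J × Fin m × Fin n → ℝ := fun p => l * c p.1 p.2.1 * y p.1 p.2.2
  have linear (ω : Ω) :
      l * ∑ j, c j ⬝ᵥ (A j ω *ᵥ y j) = ∑ p, a p * A p.1 ω p.2.1 p.2.2 := by
    simp only [a, dotProduct, mulVec_apply_eq_sum, Fintype.sum_prod_type, Finset.mul_sum,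
      mul_assoc]
  have variance : ∑ p, a p ^ 2 = l ^ 2 * ∑ j, vnorm (c j) ^ 2 * vnorm (y j) ^ 2 := by
    simp only [a, Fintype.sum_prod_type, vnorm_sq_eq_sum, Finset.sum_mul_sum]
    simp only [Finset.mul_sum, mul_pow, mul_assoc]
  have entry_measurable := hA.measurable
  refine (measure_mono fun ω hω => ?_).trans (measure_le_of_lintegral_exp_le_one (by fun_prop)
    (hA.lintegral_exp_sum a).le (l * t - l ^ 2 * V / 2))
  rw [Set.mem_ofPred_eq, ← linear, variance]
  have := mul_le_mul_of_nonneg_left (le_of_lt hω) hl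
  have := mul_le_mul_of_nonneg_left hV (sq_nonneg l)
  linarith

theorem measure_lt_sum_pinv_mulVec_dotProduct_le (hm : 0 < m)
    {W : J → Matrix (Fin m) (Fin r) ℝ} (hW : ∀ j, WellConditioned (W j)) (y : J → Fin n → ℝ)
    (h : J → Fin r → ℝ) {l S : ℝ} (hl : 0 ≤ l)
    (hS : ∑ j, vnorm (y j) ^ 2 * vnorm (h j) ^ 2 ≤ S) (t : ℝ) :
    P {ω | t < ∑ j, (pinv (W j) *ᵥ (A j ω *ᵥ y j)) ⬝ᵥ h j} ≤
      ENNReal.ofReal (Real.exp (-(l * t - l ^ 2 * S / m))) := by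
  have : (0 : ℝ) < m := Nat.cast_pos.2 hm
  have variance_le : ∑ j, vnorm (W j *ᵥ (((W j)ᵀ * W j)⁻¹ *ᵥ h j)) ^ 2 * vnorm (y j) ^ 2 ≤
      2 / m * S := by
    refine le_trans (Finset.sum_le_sum fun j _ => ?_)
      ((Finset.mul_sum _ _ _).symm.trans_le (mul_le_mul_of_nonneg_left hS (by positivity)))
    calc vnorm (W j *ᵥ (((W j)ᵀ * W j)⁻¹ *ᵥ h j)) ^ 2 * vnorm (y j) ^ 2
        ≤ 2 / m * vnorm (h j) ^ 2 * vnorm (y j) ^ 2 :=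
          mul_le_mul_of_nonneg_right ((hW j).vnorm_sq_mulVec_inv_le hm _) (sq_nonneg _)
      _ = 2 / m * (vnorm (y j) ^ 2 * vnorm (h j) ^ 2) := by ring
  simp only [pinv_mulVec_dotProduct, dotProduct_comm (A _ _ *ᵥ y _)]
  refine (measure_lt_sum_dotProduct_mulVec_le hA _ y hl variance_le t).trans_eq ?_
  congr 3
  field_simp

omit [Fintype J] in
theorem indepFun_mul_mulVec_of_orthogonal [Finite J] {U : Matrix (Fin n) (Fin r) ℝ}
    {y : J → Fin n → ℝ} (hy : ∀ j, Uᵀ *ᵥ y j = 0) :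
    IndepFun (fun ω j i k => (A j ω * U) i k) (fun ω j => A j ω *ᵥ y j) P := by
  classical
  have := Fintype.ofFinite J
  have independent := hA.indepFun_linear_of_orthogonal
    (fun (p : J × Fin m × Fin r) a => if a.1 = p.1 then
      (if a.2.1 = p.2.1 then U a.2.2 p.2.2 else 0) else 0)
    (fun (p : J × Fin m) a => if a.1 = p.1 then
      (if a.2.1 = p.2 then y p.1 a.2.2 else 0) else 0) fun p p' => by
    have orthogonal : ∑ b, U b p.2.2 * y p'.1 b = 0 := congrFun (hy p'.1) p.2.2
    simp only [Fintype.sum_prod_type, ite_mul, mul_ite, zero_mul, mul_zero, Finset.sum_ite_irrel,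
      Finset.sum_const_zero, Finset.sum_ite_eq', Finset.mem_univ, if_true]
    split_ifs <;> simp [orthogonal]
  convert independent.comp (φ := fun W j i k => W (j, i, k)) (ψ := fun v j i => v (j, i))
    (by fun_prop) (by fun_prop) using 1
  · funext ω j i k
    simp [Fintype.sum_prod_type, Finset.sum_ite_irrel, Matrix.mul_apply, mul_comm]
  · funext ω j i
    simp [Fintype.sum_prod_type, ite_mul, Finset.sum_ite_irrel, mulVec_apply_eq_sum]

omit hA in
theorem measurableSet_wellConditioned_and_lt_sum_pinv_mulVec (h : J → Fin r → ℝ) (t : ℝ) :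
    MeasurableSet {x : (J → Fin m → Fin r → ℝ) × (J → Fin m → ℝ) |
      (∀ j, WellConditioned (Matrix.of (x.1 j))) ∧
        t < ∑ j, (pinv (Matrix.of (x.1 j)) *ᵥ x.2 j) ⬝ᵥ h j} := by
  refine MeasurableSet.inter (s₁ := {x | ∀ j, _}) (s₂ := {x | t < _}) ?_
    (measurableSet_lt measurable_const ?_)
  · simp only [Set.ofPred_forall]
    exact MeasurableSet.iInter fun j => isClosed_wellConditioned.measurableSet.preimage
      (f := fun x : (J → Fin m → Fin r → ℝ) × (J → Fin m → ℝ) => x.1 j) (by fun_prop)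
  · have entries (j : J) : EntrywiseMeasurable
        fun x : (J → Fin m → Fin r → ℝ) × (J → Fin m → ℝ) => Matrix.of (x.1 j) := fun i k => by
      simp only [Matrix.of_apply]
      fun_prop
    have coefficient (j : J) (k : Fin r) :=
      (measurable_pi_apply k).comp ((entries j).pinv.mulVec (v := fun x => x.2 j) (by fun_prop))
    simp only [dotProduct]
    exact Finset.measurable_sum _ fun j _ => Finset.measurable_sum _ fun k _ =>
      (coefficient j k).mul_const _

/-- Since `y j` is orthogonal to the columns of `U`, the matrices `A j * U` are independent of the
vectors `A j *ᵥ y j`; given the former, the sum is a centered Gaussian variable. -/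
theorem measure_wellConditioned_and_lt_sum_pinv_mulVec_dotProduct_le (hm : 0 < m)
    {U : Matrix (Fin n) (Fin r) ℝ} {y : J → Fin n → ℝ} (hy : ∀ j, Uᵀ *ᵥ y j = 0)
    (h : J → Fin r → ℝ) {l S : ℝ} (hl : 0 ≤ l)
    (hS : ∑ j, vnorm (y j) ^ 2 * vnorm (h j) ^ 2 ≤ S) (t : ℝ) :
    P {ω | (∀ j, WellConditioned (A j ω * U)) ∧
      t < ∑ j, (pinv (A j ω * U) *ᵥ (A j ω *ᵥ y j)) ⬝ᵥ h j} ≤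
      ENNReal.ofReal (Real.exp (-(l * t - l ^ 2 * S / m))) := by
  have := hA.indep.isProbabilityMeasure
  have A_measurable (j : J) : EntrywiseMeasurable (A j) := fun i c => hA.measurable (j, i, c)
  refine measure_le_of_indepFun (X := fun ω j i k => (A j ω * U) i k)
    (Y := fun ω j => A j ω *ᵥ y j) ?_ ?_ (indepFun_mul_mulVec_of_orthogonal hA hy)
    (measurableSet_wellConditioned_and_lt_sum_pinv_mulVec h t) fun W => ?_
  · exact measurable_pi_lambda _ fun j => measurable_pi_lambda _ fun i => measurable_pi_lambda _
      ((A_measurable j).mul (.const U) i)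
  · exact measurable_pi_lambda _ fun j => (A_measurable j).mulVec measurable_const
  by_cases hW : ∀ j, WellConditioned (Matrix.of (W j))
  · exact (measure_mono fun ω hω => hω.2).trans
      (measure_lt_sum_pinv_mulVec_dotProduct_le hA hm hW y h hl hS t)
  · simp [hW]

theorem measure_lt_norm_lsError_le (hm : 0 < m) {U : Matrix (Fin n) (Fin r) ℝ}
    {y : J → Fin n → ℝ} (hy : ∀ j, Uᵀ *ᵥ y j = 0) (g : J → Fin r → ℝ) {l S : ℝ} (hl : 0 ≤ l)
    (hS : ∀ D : Matrix (Fin r) (Fin r) ℝ, ‖D‖ ≤ 1 →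
      ∑ j, vnorm (y j) ^ 2 * vnorm (D *ᵥ g j) ^ 2 ≤ S) (t : ℝ) :
    P {ω | (∀ j, WellConditioned (A j ω * U)) ∧ 2 * t <
      ‖∑ j, Matrix.vecMulVec (pinv (A j ω * U) *ᵥ (A j ω *ᵥ y j)) (g j)‖} ≤
      ENNReal.ofReal (5 ^ (r * r) * Real.exp (-(l * t - l ^ 2 * S / m))) := by
  obtain ⟨N, N_card, N_norm, hN⟩ := exists_finset_matrix_norm_le_two_mul_sum (Fin r) (Fin r)
  have bad_subset : {ω | (∀ j, WellConditioned (A j ω * U)) ∧ 2 * t <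
      ‖∑ j, Matrix.vecMulVec (pinv (A j ω * U) *ᵥ (A j ω *ᵥ y j)) (g j)‖} ⊆ ⋃ D ∈ N,
      {ω | (∀ j, WellConditioned (A j ω * U)) ∧
        t < ∑ j, (pinv (A j ω * U) *ᵥ (A j ω *ᵥ y j)) ⬝ᵥ (D *ᵥ g j)} := by
    rintro ω ⟨hW, lt_norm⟩
    obtain ⟨D, hD, norm_le⟩ :=
      hN (∑ j, Matrix.vecMulVec (pinv (A j ω * U) *ᵥ (A j ω *ᵥ y j)) (g j))
    rw [sum_sum_vecMulVec_mul_eq_sum_dotProduct] at norm_le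
    exact Set.mem_biUnion hD ⟨hW, by linarith⟩
  refine (measure_mono bad_subset).trans (measure_biUnion_le_of_card_le ?_ fun D hD =>
    measure_wellConditioned_and_lt_sum_pinv_mulVec_dotProduct_le hA hm hy _ hl
      (hS D (N_norm D hD)) t)
  rw [Fintype.card_fin] at N_card
  exact_mod_cast N_card

end Batch

/-! ### One batch -/

section OneBatch

variable {m n p q r ρ : ℕ} {X : Matrix (Fin n) (Fin q) ℝ} {U : Matrix (Fin n) (Fin r) ℝ}

theorem sum_prod_snd {ι κ M : Type*} [Fintype ι] [Fintype κ] [AddCommMonoid M] (f : κ → M) :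
    ∑ j : ι × κ, f j.2 = Fintype.card ι • ∑ k, f k := by
  simp [Fintype.sum_prod_type]

/-- The number `ρ m q` of samples of one batch, relative to the number `κ⁴ μ² r` that makes its
gradient informative. -/
def sampleRatio (σ : Fin r → ℝ) (μ : ℝ) (m q ρ : ℕ) : ℝ :=
  (ρ * m * q : ℝ) / (kappa σ ^ 4 * μ ^ 2 * r)

/-- The bound on the norms of the columns of `X` that right incoherence provides. -/
def columnBound (σ : Fin r → ℝ) (μ : ℝ) (q : ℕ) : ℝ :=
  μ * √((r : ℝ) / q) * sigmaMax σ

/-- The gradient, with respect to the subspace estimate, of the squared loss of a batch of `ρ` nodes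
with measurement matrices `A` and coefficients `b`. -/
def batchGradient (A : Fin ρ × Fin q → Matrix (Fin m) (Fin n) ℝ) (X : Matrix (Fin n) (Fin q) ℝ)
    (U : Matrix (Fin n) (Fin r) ℝ) (b : Fin ρ × Fin q → Fin r → ℝ) : Matrix (Fin n) (Fin r) ℝ :=
  ∑ j, Matrix.vecMulVec ((A j)ᵀ *ᵥ (A j *ᵥ (U *ᵥ b j - X.col j.2))) (b j)

/-- The expectation of `batchGradient` over Gaussian measurement matrices, per measurement. -/
def meanBatchGradient (X : Matrix (Fin n) (Fin q) ℝ) (U : Matrix (Fin n) (Fin r) ℝ)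
    (b : Fin ρ × Fin q → Fin r → ℝ) : Matrix (Fin n) (Fin r) ℝ :=
  ∑ j, Matrix.vecMulVec (U *ᵥ b j - X.col j.2) (b j)

/-- The coefficients `b` approximate the exact coefficients `Uᵀ xₖ` of the columns `xₖ` of `X` up to
a tenth of the distance from `xₖ` to the column space of `U`. -/
def CoeffsAccurate (X : Matrix (Fin n) (Fin q) ℝ) (U : Matrix (Fin n) (Fin r) ℝ)
    (b : Fin ρ × Fin q → Fin r → ℝ) : Prop :=
  ∀ j, vnorm (b j - Uᵀ *ᵥ X.col j.2) ≤ 0.1 * vnorm (residual U (X.col j.2))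

theorem sampleRatio_nonneg (σ : Fin r → ℝ) (μ : ℝ) (m q ρ : ℕ) : 0 ≤ sampleRatio σ μ m q ρ := by
  have : 0 ≤ kappa σ ^ 4 := Even.pow_nonneg (by decide) _
  rw [sampleRatio]
  positivity

variable {Ustar : Matrix (Fin n) (Fin r) ℝ} {σ : Fin r → ℝ} {V : Matrix (Fin q) (Fin r) ℝ} {δ μ : ℝ}

section SpectralBounds

variable [NeZero r] (hX : IsReducedSVD X Ustar σ V)
include hX

theorem IsReducedSVD.sigmaMax_eq : sigmaMax σ = kappa σ * sigmaMin σ := by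
  have := hX.sigmaMin_pos
  rw [kappa]
  field_simp

theorem IsReducedSVD.columnBound_pos (hq : 0 < q) (hμ : 0 < μ) : 0 < columnBound σ μ q := by
  have := hX.sigmaMax_pos
  have : (0 : ℝ) < q := Nat.cast_pos.2 hq
  have : (0 : ℝ) < r := Nat.cast_pos.2 (NeZero.pos r)
  rw [columnBound]
  positivity

theorem IsReducedSVD.sampleRatio_eq (hq : 0 < q) (hμ : 0 < μ) :
    sampleRatio σ μ m q ρ =
      ρ * m * sigmaMin σ ^ 2 / (columnBound σ μ q ^ 2 * kappa σ ^ 2) := by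
  have := hX.sigmaMin_pos
  have := one_pos.trans_le hX.one_le_kappa
  have : (0 : ℝ) < q := Nat.cast_pos.2 hq
  have : (0 : ℝ) < r := Nat.cast_pos.2 (NeZero.pos r)
  rw [columnBound, mul_pow, mul_pow, Real.sq_sqrt (by positivity), hX.sigmaMax_eq, sampleRatio]
  field_simp

theorem IsReducedSVD.sq_mul_sigmaMax_sq_le (hδ0 : 0 ≤ δ) (hδ1 : δ ≤ 0.1 / kappa σ ^ 2) :
    δ ^ 2 * sigmaMax σ ^ 2 ≤ 0.1 * δ * sigmaMin σ ^ 2 := by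
  have := one_pos.trans_le hX.one_le_kappa
  rw [le_div_iff₀ (by positivity)] at hδ1
  calc δ ^ 2 * sigmaMax σ ^ 2 = (δ * kappa σ ^ 2) * (δ * sigmaMin σ ^ 2) := by
        rw [hX.sigmaMax_eq]; ring
    _ ≤ 0.1 * (δ * sigmaMin σ ^ 2) := by gcongr
    _ = 0.1 * δ * sigmaMin σ ^ 2 := by ring

end SpectralBounds

theorem RightIncoherent.vnorm_residual_col_le (hμ : RightIncoherent σ V μ)
    (hX : IsReducedSVD X Ustar σ V) (hU : Uᵀ * U = 1) (hδ : subspaceDist Ustar U ≤ δ) (k : Fin q) :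
    vnorm (residual U (X.col k)) ≤ δ * columnBound σ μ q :=
  (hX.vnorm_residual_col_le hU hδ k).trans
    (mul_le_mul_of_nonneg_left (hμ.vnorm_col_le hX k) ((subspaceDist_nonneg _ _).trans hδ))

theorem RightIncoherent.sum_vnorm_sq_residual_mul_vnorm_sq_le (hμ : RightIncoherent σ V μ)
    (hX : IsReducedSVD X Ustar σ V) (hU : Uᵀ * U = 1) (hδ : subspaceDist Ustar U ≤ δ)
    {D : Matrix (Fin p) (Fin r) ℝ} (hD : ‖D‖ ≤ 1) :
    ∑ k, vnorm (residual U (X.col k)) ^ 2 * vnorm (D *ᵥ (Uᵀ *ᵥ X.col k)) ^ 2 ≤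
      (δ * columnBound σ μ q) ^ 2 * sigmaMax σ ^ 2 := by
  refine le_trans ?_ (mul_le_mul_of_nonneg_left (hX.sum_vnorm_sq_mulVec_le hU hD) (sq_nonneg _))
  rw [Finset.mul_sum]
  exact Finset.sum_le_sum fun k _ => mul_le_mul_of_nonneg_right (pow_le_pow_left₀ (vnorm_nonneg _)
    (hμ.vnorm_residual_col_le hX hU hδ k) 2) (sq_nonneg _)

section Concentration

variable {Ω : Type*} {mΩ : MeasurableSpace Ω} {P : Measure Ω}
  {A : Fin ρ × Fin q → Ω → Matrix (Fin m) (Fin n) ℝ}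

theorem IsReducedSVD.measure_lsError_le [NeZero r] (hX : IsReducedSVD X Ustar σ V) (hm : 0 < m)
    (hq : 0 < q) (hμ0 : 0 < μ) (hμ : RightIncoherent σ V μ) (hU : Uᵀ * U = 1) (hδ0 : 0 < δ)
    (hδ : subspaceDist Ustar U ≤ δ)
    (hA : IsStdGaussian
      (fun (p : (Fin ρ × Fin q) × Fin m × Fin n) ω => A p.1 ω p.2.1 p.2.2) P) :
    P {ω | (∀ j, WellConditioned (A j ω * U)) ∧ 0.01 * δ * sigmaMin σ ^ 2 * ρ <
      ‖∑ j, Matrix.vecMulVec (pinv (A j ω * U) *ᵥ (A j ω *ᵥ residual U (X.col j.2)))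
        (Uᵀ *ᵥ X.col j.2)‖} ≤
      ENNReal.ofReal (5 ^ (r * r) * Real.exp (-(sampleRatio σ μ m q ρ / 160000))) := by
  have := one_pos.trans_le hX.one_le_kappa
  have := hX.sigmaMin_pos
  have : (0 : ℝ) < m := Nat.cast_pos.2 hm
  have := hX.columnBound_pos hq hμ0
  set a := columnBound σ μ q with ha
  have tail := measure_lt_norm_lsError_le hA hm
    (fun j => transpose_mulVec_residual hU (X.col j.2)) (fun j => Uᵀ *ᵥ X.col j.2)
    (l := 1 / 400 * m / (δ * a ^ 2 * kappa σ ^ 2)) (S := ρ * ((δ * a) ^ 2 * sigmaMax σ ^ 2))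
    (by positivity) ?_ (0.005 * δ * sigmaMin σ ^ 2 * ρ)
  · rw [show 2 * (0.005 * δ * sigmaMin σ ^ 2 * ρ) = 0.01 * δ * sigmaMin σ ^ 2 * ρ by ring] at tail
    refine tail.trans_eq ?_
    congr 4
    rw [hX.sampleRatio_eq hq hμ0, ← ha, hX.sigmaMax_eq]
    field_simp
    ring
  · intro D hD
    rw [sum_prod_snd fun k => vnorm (residual U (X.col k)) ^ 2 * vnorm (D *ᵥ (Uᵀ *ᵥ X.col k)) ^ 2,
      nsmul_eq_mul, Fintype.card_fin]
    exact mul_le_mul_of_nonneg_left (hμ.sum_vnorm_sq_residual_mul_vnorm_sq_le hX hU hδ hD)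
      (Nat.cast_nonneg _)

end Concentration

theorem meanBatchGradient_sub_smul_expectedGradient
    (X : Matrix (Fin n) (Fin q) ℝ) (U : Matrix (Fin n) (Fin r) ℝ)
    (b : Fin ρ × Fin q → Fin r → ℝ) :
    meanBatchGradient X U b - (ρ : ℝ) • expectedGradient U X =
      U * ∑ j, Matrix.vecMulVec (b j - Uᵀ *ᵥ X.col j.2) (Uᵀ *ᵥ X.col j.2) +
      U * ∑ j, Matrix.vecMulVec (b j - Uᵀ *ᵥ X.col j.2) (b j - Uᵀ *ᵥ X.col j.2) -
      ∑ j, Matrix.vecMulVec (residual U (X.col j.2)) (b j - Uᵀ *ᵥ X.col j.2) := by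
  have expected : (ρ : ℝ) • expectedGradient U X =
      -∑ j : Fin ρ × Fin q, Matrix.vecMulVec (residual U (X.col j.2)) (Uᵀ *ᵥ X.col j.2) := by
    rw [expectedGradient_eq_neg_sum,
      sum_prod_snd fun k => Matrix.vecMulVec (residual U (X.col k)) (Uᵀ *ᵥ X.col k), smul_neg,
      Nat.cast_smul_eq_nsmul, Fintype.card_fin]
  rw [expected, meanBatchGradient, sub_neg_eq_add, ← Finset.sum_add_distrib, ← Matrix.mul_add,
    ← Finset.sum_add_distrib, Matrix.mul_sum, ← Finset.sum_sub_distrib]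
  refine Finset.sum_congr rfl fun j _ => ?_
  have error_eq : U *ᵥ b j - X.col j.2 =
      U *ᵥ (b j - Uᵀ *ᵥ X.col j.2) - residual U (X.col j.2) := by
    rw [residual, Matrix.mulVec_sub]; abel
  rw [error_eq, ← Matrix.vecMulVec_add, add_sub_cancel, Matrix.mul_vecMulVec,
    Matrix.sub_vecMulVec, Matrix.vecMulVec_sub]
  abel

namespace CoeffsAccurate

variable {b : Fin ρ × Fin q → Fin r → ℝ} (hb : CoeffsAccurate X U b)
include hb

theorem vnorm_mulVec_sub_le (hU : Uᵀ * U = 1) (j : Fin ρ × Fin q) :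
    vnorm (U *ᵥ b j - X.col j.2) ≤ 1.1 * vnorm (residual U (X.col j.2)) := by
  have split : U *ᵥ b j - X.col j.2 = U *ᵥ (b j - Uᵀ *ᵥ X.col j.2) - residual U (X.col j.2) := by
    rw [residual, Matrix.mulVec_sub]; abel
  rw [split]
  refine (vnorm_sub_le _ _).trans ?_
  rw [vnorm_orthonormal_mulVec hU]
  linarith [hb j]

theorem vnorm_le (hU : Uᵀ * U = 1) (j : Fin ρ × Fin q) :
    vnorm (b j) ≤ 1.1 * vnorm (X.col j.2) := by
  have triangle := vnorm_add_le (Uᵀ *ᵥ X.col j.2) (b j - Uᵀ *ᵥ X.col j.2)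
  rw [add_sub_cancel] at triangle
  linarith [hb j, vnorm_residual_le hU (X.col j.2), vnorm_transpose_mulVec_le hU (X.col j.2)]

theorem vnorm_sq_mulVec_le (j : Fin ρ × Fin q) {D : Matrix (Fin p) (Fin r) ℝ} (hD : ‖D‖ ≤ 1) :
    vnorm (D *ᵥ b j) ^ 2 ≤
      2 * vnorm (D *ᵥ (Uᵀ *ᵥ X.col j.2)) ^ 2 + 0.02 * vnorm (residual U (X.col j.2)) ^ 2 := by
  have triangle := vnorm_add_le (D *ᵥ (Uᵀ *ᵥ X.col j.2)) (D *ᵥ (b j - Uᵀ *ᵥ X.col j.2))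
  rw [← Matrix.mulVec_add, add_sub_cancel] at triangle
  have error_le : vnorm (D *ᵥ (b j - Uᵀ *ᵥ X.col j.2)) ≤ 0.1 * vnorm (residual U (X.col j.2)) :=
    (vnorm_mulVec_le _ _).trans ((mul_le_of_le_one_left (vnorm_nonneg _) hD).trans (hb j))
  calc vnorm (D *ᵥ b j) ^ 2
      ≤ (vnorm (D *ᵥ (Uᵀ *ᵥ X.col j.2)) + 0.1 * vnorm (residual U (X.col j.2))) ^ 2 :=
        pow_le_pow_left₀ (vnorm_nonneg _) (by linarith) 2
    _ ≤ 2 * (vnorm (D *ᵥ (Uᵀ *ᵥ X.col j.2)) ^ 2 + (0.1 * vnorm (residual U (X.col j.2))) ^ 2) :=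
        add_sq_le
    _ = _ := by ring

theorem sum_vnorm_sq_mulVec_le (hX : IsReducedSVD X Ustar σ V) (hU : Uᵀ * U = 1) (hδ1 : δ ≤ 0.1)
    (hδ : subspaceDist Ustar U ≤ δ) (i : Fin ρ) {D : Matrix (Fin p) (Fin r) ℝ} (hD : ‖D‖ ≤ 1) :
    ∑ k, vnorm (D *ᵥ b (i, k)) ^ 2 ≤ 3 * sigmaMax σ ^ 2 := by
  have hδ0 : 0 ≤ δ := (subspaceDist_nonneg _ _).trans hδ
  refine (Finset.sum_le_sum fun k _ => hb.vnorm_sq_mulVec_le (i, k) hD).trans ?_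
  rw [Finset.sum_add_distrib, ← Finset.mul_sum, ← Finset.mul_sum]
  have exact_le := hX.sum_vnorm_sq_mulVec_le hU hD
  have residual_le := hX.sum_vnorm_sq_residual_le hU hδ
  have := mul_le_mul_of_nonneg_right (pow_le_one₀ (n := 2) hδ0 (by linarith))
    (sq_nonneg (sigmaMax σ))
  linarith [sq_nonneg (sigmaMax σ)]

theorem sum_vnorm_mul_vnorm_sq_le (hX : IsReducedSVD X Ustar σ V) (hμ : RightIncoherent σ V μ)
    (hU : Uᵀ * U = 1) (hδ1 : δ ≤ 0.1) (hδ : subspaceDist Ustar U ≤ δ)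
    {D : Matrix (Fin p) (Fin r) ℝ} (hD : ‖D‖ ≤ 1) :
    ∑ j, (vnorm (U *ᵥ b j - X.col j.2) * vnorm (D *ᵥ b j)) ^ 2 ≤
      ρ * ((1.1 * (δ * columnBound σ μ q)) ^ 2 * (3 * sigmaMax σ ^ 2)) := by
  have node_le (i : Fin ρ) : ∑ k, (vnorm (U *ᵥ b (i, k) - X.col k) * vnorm (D *ᵥ b (i, k))) ^ 2 ≤
      (1.1 * (δ * columnBound σ μ q)) ^ 2 * (3 * sigmaMax σ ^ 2) := by
    refine le_trans ?_ (mul_le_mul_of_nonneg_left (hb.sum_vnorm_sq_mulVec_le hX hU hδ1 hδ i hD)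
      (sq_nonneg _))
    rw [Finset.mul_sum]
    refine Finset.sum_le_sum fun k _ => ?_
    rw [mul_pow]
    refine mul_le_mul_of_nonneg_right (pow_le_pow_left₀ (vnorm_nonneg _) ?_ 2) (sq_nonneg _)
    exact (hb.vnorm_mulVec_sub_le hU (i, k)).trans
      (mul_le_mul_of_nonneg_left (hμ.vnorm_residual_col_le hX hU hδ k) (by norm_num))
  rw [Fintype.sum_prod_type]
  simpa using Finset.sum_le_card_nsmul Finset.univ _ _ fun i _ => node_le i

theorem vnorm_mulVec_sub_mul_vnorm_le (hX : IsReducedSVD X Ustar σ V)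
    (hμ : RightIncoherent σ V μ) (hU : Uᵀ * U = 1) (hδ : subspaceDist Ustar U ≤ δ)
    (j : Fin ρ × Fin q) :
    vnorm (U *ᵥ b j - X.col j.2) * vnorm (b j) ≤ 1.21 * (δ * columnBound σ μ q ^ 2) := by
  have error_le : vnorm (U *ᵥ b j - X.col j.2) ≤ 1.1 * (δ * columnBound σ μ q) :=
    (hb.vnorm_mulVec_sub_le hU j).trans
      (mul_le_mul_of_nonneg_left (hμ.vnorm_residual_col_le hX hU hδ j.2) (by norm_num))
  have coeff_le : vnorm (b j) ≤ 1.1 * columnBound σ μ q :=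
    (hb.vnorm_le hU j).trans (mul_le_mul_of_nonneg_left (hμ.vnorm_col_le hX j.2) (by norm_num))
  calc vnorm (U *ᵥ b j - X.col j.2) * vnorm (b j)
      ≤ (1.1 * (δ * columnBound σ μ q)) * (1.1 * columnBound σ μ q) :=
        mul_le_mul error_le coeff_le (vnorm_nonneg _) ((vnorm_nonneg _).trans error_le)
    _ = 1.21 * (δ * columnBound σ μ q ^ 2) := by ring

theorem measure_batchGradient_le {Ω : Type*} {mΩ : MeasurableSpace Ω} {P : Measure Ω}
    {A : Fin ρ × Fin q → Ω → Matrix (Fin m) (Fin n) ℝ} [NeZero r]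
    (hX : IsReducedSVD X Ustar σ V) (hm : 0 < m) (hq : 0 < q) (hμ0 : 0 < μ)
    (hμ : RightIncoherent σ V μ) (hU : Uᵀ * U = 1) (hδ0 : 0 < δ) (hδ1 : δ ≤ 0.1)
    (hδ : subspaceDist Ustar U ≤ δ)
    (hA : IsStdGaussian
      (fun (p : (Fin ρ × Fin q) × Fin m × Fin n) ω => A p.1 ω p.2.1 p.2.2) P) :
    P {ω | 0.01 * δ * sigmaMin σ ^ 2 * (ρ * m) <
      ‖batchGradient (fun j => A j ω) X U b - (m : ℝ) • meanBatchGradient X U b‖} ≤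
      ENNReal.ofReal (5 ^ (n * r) * Real.exp (-(sampleRatio σ μ m q ρ / 2560000))) := by
  have one_le_kappa := hX.one_le_kappa
  have := hX.sigmaMin_pos
  have : (0 : ℝ) < m := Nat.cast_pos.2 hm
  have := hX.columnBound_pos hq hμ0
  set a := columnBound σ μ q with ha
  have tail := measure_lt_norm_gradient_sub_le hA (fun j => U *ᵥ b j - X.col j.2) b
    (l := 1 / 6400 / (δ * a ^ 2 * kappa σ ^ 2)) (S := 4 * m * ρ * ((δ * a) ^ 2 * sigmaMax σ ^ 2))
    (by positivity) (fun j => ?_) (fun D hD => ?_) (0.005 * δ * sigmaMin σ ^ 2 * (ρ * m))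
  · rw [show 2 * (0.005 * δ * sigmaMin σ ^ 2 * (ρ * m)) =
      0.01 * δ * sigmaMin σ ^ 2 * (ρ * m) by ring] at tail
    refine tail.trans_eq ?_
    congr 4
    rw [hX.sampleRatio_eq hq hμ0, ← ha, hX.sigmaMax_eq]
    field_simp
    ring
  · calc 1 / 6400 / (δ * a ^ 2 * kappa σ ^ 2) * (vnorm (U *ᵥ b j - X.col j.2) * vnorm (b j))
        ≤ 1 / 6400 / (δ * a ^ 2 * kappa σ ^ 2) * (1.21 * (δ * a ^ 2)) :=
          mul_le_mul_of_nonneg_left (hb.vnorm_mulVec_sub_mul_vnorm_le hX hμ hU hδ j)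
            (by positivity)
      _ = 1.21 / 6400 / kappa σ ^ 2 := by field_simp
      _ ≤ 1.21 / 6400 / 1 := by gcongr; exact one_le_pow₀ one_le_kappa
      _ ≤ 1 / 8 := by norm_num
  · calc (m : ℝ) * ∑ j, (vnorm (U *ᵥ b j - X.col j.2) * vnorm (D *ᵥ b j)) ^ 2
        ≤ m * (ρ * ((1.1 * (δ * a)) ^ 2 * (3 * sigmaMax σ ^ 2))) := by
          gcongr; exact hb.sum_vnorm_mul_vnorm_sq_le hX hμ hU hδ1 hδ hD
      _ = 3.63 * m * ρ * ((δ * a) ^ 2 * sigmaMax σ ^ 2) := by ring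
      _ ≤ _ := by gcongr; norm_num

theorem norm_sum_vecMulVec_error_self_le :
    ‖∑ j, Matrix.vecMulVec (b j - Uᵀ *ᵥ X.col j.2) (b j - Uᵀ *ᵥ X.col j.2)‖ ≤
      0.01 * ∑ j : Fin ρ × Fin q, vnorm (residual U (X.col j.2)) ^ 2 := by
  rw [Finset.mul_sum]
  refine norm_sum_le_of_le _ fun j _ => ?_
  rw [frobenius_norm_vecMulVec]
  have := mul_self_le_mul_self (vnorm_nonneg _) (hb j)
  linarith

theorem norm_sum_vecMulVec_residual_error_le :
    ‖∑ j, Matrix.vecMulVec (residual U (X.col j.2)) (b j - Uᵀ *ᵥ X.col j.2)‖ ≤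
      0.1 * ∑ j : Fin ρ × Fin q, vnorm (residual U (X.col j.2)) ^ 2 := by
  rw [Finset.mul_sum]
  refine norm_sum_le_of_le _ fun j _ => ?_
  rw [frobenius_norm_vecMulVec]
  have := mul_le_mul_of_nonneg_left (hb j) (vnorm_nonneg (residual U (X.col j.2)))
  linarith

theorem norm_meanBatchGradient_sub_le [NeZero r] (hX : IsReducedSVD X Ustar σ V)
    (hU : Uᵀ * U = 1) (hδ1 : δ ≤ 0.1 / kappa σ ^ 2) (hδ : subspaceDist Ustar U ≤ δ)
    (hS : ‖∑ j, Matrix.vecMulVec (b j - Uᵀ *ᵥ X.col j.2) (Uᵀ *ᵥ X.col j.2)‖ ≤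
      0.01 * δ * sigmaMin σ ^ 2 * ρ) :
    ‖meanBatchGradient X U b - (ρ : ℝ) • expectedGradient U X‖ ≤
      0.021 * δ * sigmaMin σ ^ 2 * ρ := by
  have hδ0 : 0 ≤ δ := (subspaceDist_nonneg _ _).trans hδ
  have sum_residual_le : ∑ j : Fin ρ × Fin q, vnorm (residual U (X.col j.2)) ^ 2 ≤
      ρ * (0.1 * δ * sigmaMin σ ^ 2) := by
    rw [sum_prod_snd fun k => vnorm (residual U (X.col k)) ^ 2, nsmul_eq_mul, Fintype.card_fin]
    gcongr
    exact (hX.sum_vnorm_sq_residual_le hU hδ).trans (hX.sq_mul_sigmaMax_sq_le hδ0 hδ1)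
  rw [meanBatchGradient_sub_smul_expectedGradient]
  refine (norm_sub_le _ _).trans ((add_le_add_left (norm_add_le _ _) _).trans ?_)
  have linear_le := (frobenius_norm_orthonormal_mul_le hU _).trans hS
  have quadratic_le :=
    (frobenius_norm_orthonormal_mul_le hU _).trans hb.norm_sum_vecMulVec_error_self_le
  have cross_le := hb.norm_sum_vecMulVec_residual_error_le
  have : 0 ≤ δ * sigmaMin σ ^ 2 * ρ := by positivity
  linarith

end CoeffsAccurate

end OneBatch

/-! ### Accuracy of one iteration -/

section Iteration

variable {m n q r ρ Lt : ℕ} {X : Matrix (Fin n) (Fin q) ℝ} {U : Matrix (Fin n) (Fin r) ℝ}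

instance : Finite Phase :=
  Finite.of_surjective (fun isB : Bool => if isB then Phase.updateB else Phase.updateU) fun
    | .updateB => ⟨true, rfl⟩
    | .updateU => ⟨false, rfl⟩

/-- The coefficients that the nodes of a batch with measurement matrices `A` compute from `U`. -/
def batchCoeffs (A : Fin ρ × Fin q → Matrix (Fin m) (Fin n) ℝ) (X : Matrix (Fin n) (Fin q) ℝ)
    (U : Matrix (Fin n) (Fin r) ℝ) (j : Fin ρ × Fin q) : Fin r → ℝ :=
  lsCoeff (A j) U (X.col j.2)

theorem batchSum_nodeGradient (A₁ A₂ : Node Lt ρ → Fin q → Matrix (Fin m) (Fin n) ℝ)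
    (X : Matrix (Fin n) (Fin q) ℝ) (U : Matrix (Fin n) (Fin r) ℝ) (θ : Fin Lt) :
    batchSum (fun ℓ => nodeGradient (A₁ ℓ) (A₂ ℓ) X U) θ =
      batchGradient (fun j => A₂ (θ, j.1) j.2) X U
        (batchCoeffs (fun j => A₁ (θ, j.1) j.2) X U) := by
  simp only [batchSum, nodeGradient, batchGradient, batchCoeffs, Fintype.sum_prod_type,
    Matrix.mulVec_sub]

section Measurability

variable {𝓧 : Type*} [MeasurableSpace 𝓧]

namespace EntrywiseMeasurable

variable {U : 𝓧 → Matrix (Fin n) (Fin r) ℝ} (hU : EntrywiseMeasurable U)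
include hU

theorem lsCoeff {A : 𝓧 → Matrix (Fin m) (Fin n) ℝ} (hA : EntrywiseMeasurable A)
    (x : Fin n → ℝ) : Measurable fun ω => lsCoeff (A ω) (U ω) x :=
  (hA.mul hU).pinv.mulVec (hA.mulVec measurable_const)

theorem expectedGradient (X : Matrix (Fin n) (Fin q) ℝ) :
    EntrywiseMeasurable fun ω => expectedGradient (U ω) X :=
  ((hU.mul (hU.transpose.mul (const X))).sub (const X)).mul (hU.transpose.mul (const X)).transpose

variable {b : 𝓧 → Fin ρ × Fin q → Fin r → ℝ} (hb : ∀ j, Measurable fun ω => b ω j)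
include hb

theorem meanBatchGradient (X : Matrix (Fin n) (Fin q) ℝ) :
    EntrywiseMeasurable fun ω => meanBatchGradient X (U ω) (b ω) :=
  sum fun j _ => vecMulVec ((hU.mulVec (hb j)).sub measurable_const) (hb j)

theorem batchGradient {A : 𝓧 → Fin ρ × Fin q → Matrix (Fin m) (Fin n) ℝ}
    (hA : ∀ j, EntrywiseMeasurable fun ω => A ω j) (X : Matrix (Fin n) (Fin q) ℝ) :
    EntrywiseMeasurable fun ω => batchGradient (A ω) X (U ω) (b ω) :=
  sum fun j _ => vecMulVec
    ((hA j).transpose.mulVec ((hA j).mulVec ((hU.mulVec (hb j)).sub measurable_const))) (hb j)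

end EntrywiseMeasurable

theorem measurableSet_vnorm_sub_le {U : 𝓧 → Matrix (Fin n) (Fin r) ℝ}
    (hU : EntrywiseMeasurable U) {b : 𝓧 → Fin r → ℝ} (hb : Measurable b) (x : Fin n → ℝ) :
    MeasurableSet {ω | vnorm (b ω - (U ω)ᵀ *ᵥ x) ≤ 0.1 * vnorm (residual (U ω) x)} :=
  measurableSet_le
    (measurable_vnorm (hb.sub (hU.transpose.mulVec measurable_const)))
    (measurable_const.mul (measurable_vnorm
      (measurable_const.sub (hU.mulVec (hU.transpose.mulVec measurable_const)))))

theorem measurableSet_orthonormal_subspaceDist_le {U : 𝓧 → Matrix (Fin n) (Fin r) ℝ}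
    (hU : EntrywiseMeasurable U) (Ustar : Matrix (Fin n) (Fin r) ℝ) (δ : ℝ) :
    MeasurableSet {ω | (U ω)ᵀ * U ω = 1 ∧ subspaceDist Ustar (U ω) ≤ δ} := by
  refine MeasurableSet.inter (s₁ := {ω | (U ω)ᵀ * U ω = 1})
    (s₂ := {ω | subspaceDist Ustar (U ω) ≤ δ}) ?_
    (measurableSet_le ((EntrywiseMeasurable.const _).mul hU).norm measurable_const)
  simp only [← Matrix.ext_iff, Set.ofPred_forall]
  exact MeasurableSet.iInter fun i => MeasurableSet.iInter fun j =>
    measurableSet_eq_fun ((hU.transpose.mul hU) i j) measurable_const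

end Measurability

variable {Ω : Type*} {mΩ : MeasurableSpace Ω} {P : Measure Ω}
  {Ustar : Matrix (Fin n) (Fin r) ℝ} {σ : Fin r → ℝ} {V : Matrix (Fin q) (Fin r) ℝ} {δ μ : ℝ}

section Batch

variable [NeZero r] {A : Phase → Fin ρ × Fin q → Ω → Matrix (Fin m) (Fin n) ℝ}

theorem IsReducedSVD.measure_batchGradient_batchCoeffs_le (hX : IsReducedSVD X Ustar σ V)
    (hm : 0 < m) (hq : 0 < q) (hμ0 : 0 < μ) (hμ : RightIncoherent σ V μ) (hU : Uᵀ * U = 1)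
    (hδ0 : 0 < δ) (hδ1 : δ ≤ 0.1) (hδ : subspaceDist Ustar U ≤ δ)
    (hA : IsStdGaussian (fun (p : Phase × (Fin ρ × Fin q) × Fin m × Fin n) ω =>
      A p.1 p.2.1 ω p.2.2.1 p.2.2.2) P) :
    P {ω | CoeffsAccurate X U (batchCoeffs (fun j => A .updateB j ω) X U) ∧
      0.01 * δ * sigmaMin σ ^ 2 * (ρ * m) <
        ‖batchGradient (fun j => A .updateU j ω) X U
            (batchCoeffs (fun j => A .updateB j ω) X U) -
          (m : ℝ) • meanBatchGradient X U (batchCoeffs (fun j => A .updateB j ω) X U)‖} ≤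
      ENNReal.ofReal (5 ^ (n * r) * Real.exp (-(sampleRatio σ μ m q ρ / 2560000))) := by
  have := hA.indep.isProbabilityMeasure
  set entries : Phase → Ω → (Fin ρ × Fin q) × Fin m × Fin n → ℝ :=
    fun f ω p => A f p.1 ω p.2.1 p.2.2
  have measurable_entries (f : Phase) : Measurable (entries f) :=
    measurable_pi_lambda _ fun p => hA.measurable (f, p)
  have phases_indep : IndepFun (entries .updateB) (entries .updateU) P :=
    (IsStdGaussian.iIndepFun_rows
      (X := fun f (p : (Fin ρ × Fin q) × Fin m × Fin n) ω => A f p.1 ω p.2.1 p.2.2) hA).indepFun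
      (show Phase.updateB ≠ Phase.updateU by nofun)
  set mats : ((Fin ρ × Fin q) × Fin m × Fin n → ℝ) → Fin ρ × Fin q → Matrix (Fin m) (Fin n) ℝ :=
    fun x j => Matrix.of fun i c => x (j, i, c)
  set coeffs := fun x => batchCoeffs (mats x) X U
  have measurable_mats (j) : EntrywiseMeasurable fun x => mats x j :=
    fun i c => measurable_pi_apply (j, i, c)
  have measurable_coeffs (j) : Measurable fun x => coeffs x j :=
    (EntrywiseMeasurable.const U).lsCoeff (measurable_mats j) _
  refine measure_le_of_indepFun (S := Prod.fst ⁻¹' {x | CoeffsAccurate X U (coeffs x)} ∩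
      {x | 0.01 * δ * sigmaMin σ ^ 2 * (ρ * m) < ‖batchGradient (mats x.2) X U (coeffs x.1) -
        (m : ℝ) • meanBatchGradient X U (coeffs x.1)‖})
    (measurable_entries .updateB) (measurable_entries .updateU) phases_indep
    (MeasurableSet.inter (measurable_fst ?_) ?_) fun x => ?_
  · simp only [CoeffsAccurate, Set.ofPred_forall]
    exact MeasurableSet.iInter fun j =>
      measurableSet_vnorm_sub_le (EntrywiseMeasurable.const U) (measurable_coeffs j) _
  · exact measurableSet_lt measurable_const
      (((EntrywiseMeasurable.const U).batchGradient
        (fun j => (measurable_coeffs j).comp measurable_fst)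
        (fun j i c => (measurable_mats j i c).comp measurable_snd) X).sub
      (((EntrywiseMeasurable.const U).meanBatchGradient
        (fun j => (measurable_coeffs j).comp measurable_fst) X).const_smul _)).norm
  · by_cases accurate : CoeffsAccurate X U (coeffs x)
    · exact (measure_mono fun _ hω => hω.2).trans (accurate.measure_batchGradient_le hX hm hq hμ0 hμ
        hU hδ0 hδ1 hδ (hA.precomp (f := Prod.mk Phase.updateU) (Prod.mk_right_injective _)))
    · exact (measure_mono_null (fun _ hω => accurate hω.1) measure_empty).trans_le zero_le

theorem IsReducedSVD.norm_batchGradient_sub_le {A : Fin ρ × Fin q → Matrix (Fin m) (Fin n) ℝ}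
    {G : Matrix (Fin n) (Fin r) ℝ} (hX : IsReducedSVD X Ustar σ V) (hm : 0 < m) (hU : Uᵀ * U = 1)
    (hδ1 : δ ≤ 0.1 / kappa σ ^ 2) (hδ : subspaceDist Ustar U ≤ δ)
    (hW : ∀ j, WellConditioned (A j * U)) (hb : CoeffsAccurate X U (batchCoeffs A X U))
    (hE : ‖∑ j, Matrix.vecMulVec (pinv (A j * U) *ᵥ (A j *ᵥ residual U (X.col j.2)))
      (Uᵀ *ᵥ X.col j.2)‖ ≤ 0.01 * δ * sigmaMin σ ^ 2 * ρ)
    (hG : ‖G - (m : ℝ) • meanBatchGradient X U (batchCoeffs A X U)‖ ≤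
      0.01 * δ * sigmaMin σ ^ 2 * (ρ * m)) :
    ‖G - (ρ * m : ℝ) • expectedGradient U X‖ ≤ 0.031 * δ * sigmaMin σ ^ 2 * (ρ * m) := by
  have coeff_error (j : Fin ρ × Fin q) : pinv (A j * U) *ᵥ (A j *ᵥ residual U (X.col j.2)) =
      batchCoeffs A X U j - Uᵀ *ᵥ X.col j.2 := by
    rw [batchCoeffs, (hW j).lsCoeff_eq hm, add_sub_cancel_left]
  simp only [coeff_error] at hE
  have mean_sub_le := hb.norm_meanBatchGradient_sub_le hX hU hδ1 hδ hE
  calc ‖G - (ρ * m : ℝ) • expectedGradient U X‖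
      = ‖(G - (m : ℝ) • meanBatchGradient X U (batchCoeffs A X U)) + (m : ℝ) •
          (meanBatchGradient X U (batchCoeffs A X U) - (ρ : ℝ) • expectedGradient U X)‖ := by
        rw [smul_sub, smul_smul, sub_add_sub_cancel, mul_comm (m : ℝ)]
    _ ≤ 0.01 * δ * sigmaMin σ ^ 2 * (ρ * m) + m * (0.021 * δ * sigmaMin σ ^ 2 * ρ) := by
        refine norm_add_le_of_le hG ?_
        rw [norm_smul, RCLike.norm_natCast]
        gcongr
    _ = 0.031 * δ * sigmaMin σ ^ 2 * (ρ * m) := by ring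

theorem IsReducedSVD.measure_batch_le (hX : IsReducedSVD X Ustar σ V)
    (hm : 0 < m) (hq : 0 < q) (hμ0 : 0 < μ) (hμ : RightIncoherent σ V μ) (hU : Uᵀ * U = 1)
    (hδ0 : 0 < δ) (hδ1 : δ ≤ 0.1 / kappa σ ^ 2) (hδ : subspaceDist Ustar U ≤ δ)
    (hA : IsStdGaussian (fun (p : Phase × (Fin ρ × Fin q) × Fin m × Fin n) ω =>
      A p.1 p.2.1 ω p.2.2.1 p.2.2.2) P) :
    P {ω | (∀ j, WellConditioned (A .updateB j ω * U)) ∧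
      CoeffsAccurate X U (batchCoeffs (fun j => A .updateB j ω) X U) ∧
      0.031 * δ * sigmaMin σ ^ 2 * (ρ * m) <
        ‖batchGradient (fun j => A .updateU j ω) X U
            (batchCoeffs (fun j => A .updateB j ω) X U) -
          (ρ * m : ℝ) • expectedGradient U X‖} ≤
      ENNReal.ofReal (2 * 5 ^ (n * r) * Real.exp (-(sampleRatio σ μ m q ρ / 2560000))) := by
  have r_le_n : r ≤ n := by simpa using card_le_card_of_orthonormal hU
  have hδ1' : δ ≤ 0.1 := hδ1.trans (div_le_self (by norm_num) (one_le_pow₀ hX.one_le_kappa))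
  have ratio_nonneg := sampleRatio_nonneg σ μ m q ρ
  have lsError := hX.measure_lsError_le hm hq hμ0 hμ hU hδ0 hδ (A := A .updateB)
    (hA.precomp (f := Prod.mk Phase.updateB) (Prod.mk_right_injective _))
  have gradient := hX.measure_batchGradient_batchCoeffs_le hm hq hμ0 hμ hU hδ0 hδ1' hδ hA
  refine (measure_mono ?_).trans
    ((measure_union_le _ _).trans ((add_le_add lsError gradient).trans ?_))
  · rintro ω ⟨hW, hb, hlt⟩
    contrapose! hlt
    simp only [Set.mem_union, Set.mem_ofPred_eq, not_or, not_and, not_lt] at hlt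
    exact hX.norm_batchGradient_sub_le hm hU hδ1 hδ hW hb (hlt.1 hW) (hlt.2 hb)
  · rw [← ENNReal.ofReal_add (by positivity) (by positivity)]
    refine ENNReal.ofReal_le_ofReal ?_
    have : (5 : ℝ) ^ (r * r) * Real.exp (-(sampleRatio σ μ m q ρ / 160000)) ≤
        5 ^ (n * r) * Real.exp (-(sampleRatio σ μ m q ρ / 2560000)) := by
      gcongr <;> norm_num
    linarith

end Batch

/-- All the nodes compute accurate coefficients, and the honest gradient of every batch is close to
its expectation. -/
def IterationAccurate (X : Matrix (Fin n) (Fin q) ℝ) (σ : Fin r → ℝ) (δ : ℝ)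
    (A : Phase → Node Lt ρ → Fin q → Matrix (Fin m) (Fin n) ℝ) (U : Matrix (Fin n) (Fin r) ℝ) :
    Prop :=
  (∀ ℓ k, vnorm (lsCoeff (A .updateB ℓ k) U (X.col k) - Uᵀ *ᵥ X.col k) ≤
    0.1 * vnorm (residual U (X.col k))) ∧
  ∀ θ, ‖batchSum (fun ℓ => nodeGradient (A .updateB ℓ) (A .updateU ℓ) X U) θ -
    (ρ * m : ℝ) • expectedGradient U X‖ ≤ 0.031 * δ * sigmaMin σ ^ 2 * (ρ * m)

theorem measurableSet_iterationAccurate {𝓧 : Type*} [MeasurableSpace 𝓧]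
    {A : 𝓧 → Phase → Node Lt ρ → Fin q → Matrix (Fin m) (Fin n) ℝ}
    {U : 𝓧 → Matrix (Fin n) (Fin r) ℝ} (hA : ∀ f ℓ k, EntrywiseMeasurable fun ω => A ω f ℓ k)
    (hU : EntrywiseMeasurable U) (X : Matrix (Fin n) (Fin q) ℝ) (σ : Fin r → ℝ) (δ : ℝ) :
    MeasurableSet {ω | IterationAccurate X σ δ (A ω) (U ω)} := by
  have measurable_coeff (ℓ k) : Measurable fun ω => lsCoeff (A ω .updateB ℓ k) (U ω) (X.col k) :=
    hU.lsCoeff (hA .updateB ℓ k) _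
  simp only [IterationAccurate, batchSum_nodeGradient, Set.ofPred_and, Set.ofPred_forall]
  refine MeasurableSet.inter (MeasurableSet.iInter fun ℓ => MeasurableSet.iInter fun k =>
    measurableSet_vnorm_sub_le hU (measurable_coeff ℓ k) _) (MeasurableSet.iInter fun θ =>
      measurableSet_le (EntrywiseMeasurable.norm ?_) measurable_const)
  exact (hU.batchGradient (fun j => measurable_coeff _ _) (fun j => hA _ _ _) X).sub
    ((hU.expectedGradient X).const_smul _)

/-- The bound on the failure probability of one iteration that the union bound provides. The first
term accounts for the coefficients, the second one for the gradients of the batches. -/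
def failureBound (σ : Fin r → ℝ) (μ : ℝ) (m n q Lt ρ : ℕ) : ℝ :=
  (Lt * ρ * q) * (2 * 25 ^ r * Real.exp (-(m / 25600))) +
    Lt * (2 * 5 ^ (n * r) * Real.exp (-(sampleRatio σ μ m q ρ / 2560000)))

theorem IsReducedSVD.measure_not_iterationAccurate_le [NeZero r] (hX : IsReducedSVD X Ustar σ V)
    (hm : 0 < m) (hq : 0 < q) (hμ0 : 0 < μ) (hμ : RightIncoherent σ V μ) (hU : Uᵀ * U = 1)
    (hδ0 : 0 < δ) (hδ1 : δ ≤ 0.1 / kappa σ ^ 2) (hδ : subspaceDist Ustar U ≤ δ)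
    {A : Phase → Node Lt ρ → Fin q → Ω → Matrix (Fin m) (Fin n) ℝ}
    (hA : IsStdGaussian (fun (a : Phase × Node Lt ρ × Fin q × Fin m × Fin n) ω =>
      A a.1 a.2.1 a.2.2.1 ω a.2.2.2.1 a.2.2.2.2) P) :
    P {ω | ¬ IterationAccurate X σ δ (fun f ℓ k => A f ℓ k ω) U} ≤
      ENNReal.ofReal (failureBound σ μ m n q Lt ρ) := by
  have coeffs := measure_biUnion_le_of_card_le (N := (.univ : Finset (Node Lt ρ × Fin q)))
    (k := Lt * ρ * q) (by simp) fun p _ => measure_not_lsCoeff_accurate_le (A := A .updateB p.1 p.2)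
      (hA.precomp (f := fun c => (Phase.updateB, p.1, p.2, c)) fun c c' h => by simpa using h)
      hU hm (X.col p.2)
  have gradients := measure_biUnion_le_of_card_le (N := (.univ : Finset (Fin Lt)))
    (k := Lt) (by simp)
    fun θ _ => hX.measure_batch_le hm hq hμ0 hμ hU hδ0 hδ1 hδ
      (A := fun f j ω => A f (θ, j.1) j.2 ω) (hA.precomp
        (f := fun p : Phase × (Fin ρ × Fin q) × Fin m × Fin n =>
          (p.1, (θ, p.2.1.1), p.2.1.2, p.2.2.1, p.2.2.2)) fun p p' h => by
            simp only [Prod.ext_iff] at h ⊢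
            tauto)
  refine (measure_mono fun ω not_accurate => ?_).trans ((measure_union_le _ _).trans
    ((add_le_add coeffs gradients).trans_eq ?_))
  · contrapose not_accurate
    simp only [Set.mem_union, Set.mem_iUnion, Finset.mem_univ, exists_true_left, not_or,
      not_exists, Set.mem_ofPred_eq, not_not] at not_accurate ⊢
    obtain ⟨node, batch⟩ := not_accurate
    refine ⟨fun ℓ k => (node (ℓ, k)).2, fun θ => ?_⟩
    rw [batchSum_nodeGradient]
    exact not_lt.1 fun hlt =>
      batch θ ⟨fun j => (node ((θ, j.1), j.2)).1, fun j => (node ((θ, j.1), j.2)).2, hlt⟩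
  · rw [failureBound, ← ENNReal.ofReal_add (by positivity) (by positivity)]

theorem IsSampleSplitGaussian.measure_not_iterationAccurate_le [NeZero r] [IsProbabilityMeasure P]
    {F : Filtration ℕ mΩ} {A : ℕ → Phase → Node Lt ρ → Fin q → Ω → Matrix (Fin m) (Fin n) ℝ}
    (hA : IsSampleSplitGaussian P F A) (hX : IsReducedSVD X Ustar σ V) (hm : 0 < m) (hq : 0 < q)
    (hμ0 : 0 < μ) (hμ : RightIncoherent σ V μ) (hδ0 : 0 < δ) (hδ1 : δ ≤ 0.1 / kappa σ ^ 2) (s : ℕ)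
    {U : Ω → Matrix (Fin n) (Fin r) ℝ} (hU : ∀ i j, Measurable[F s] fun ω => U ω i j) :
    P {ω | ((U ω)ᵀ * U ω = 1 ∧ subspaceDist Ustar (U ω) ≤ δ) ∧
      ¬ IterationAccurate X σ δ (fun f ℓ k => A s f ℓ k ω) (U ω)} ≤
      ENNReal.ofReal (failureBound σ μ m n q Lt ρ) := by
  have gaussian : IsStdGaussian (fun (a : Phase × Node Lt ρ × Fin q × Fin m × Fin n) ω =>
      A s a.1 a.2.1 a.2.2.1 ω a.2.2.2.1 a.2.2.2.2) P :=
    { measurable := fun a => (hA.adapted s _ _ _ _ _).mono (F.le _) le_rfl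
      map_eq := fun a => hA.gaussian s _ _ _ _ _
      indep := hA.indep_entries s }
  set data : Ω → Phase × Node Lt ρ × Fin q × Fin m × Fin n → ℝ := fun ω a =>
    A s a.1 a.2.1 a.2.2.1 ω a.2.2.2.1 a.2.2.2.2
  have measurable_data : Measurable data := measurable_pi_lambda _ gaussian.measurable
  have measurable_U : Measurable[F s] fun ω (i : Fin n) (k : Fin r) => U ω i k :=
    (@measurable_pi_iff _ _ _ (F s) _ _).2 fun i => (@measurable_pi_iff _ _ _ (F s) _ _).2 (hU i)
  have fresh : IndepFun (fun ω (i : Fin n) (k : Fin r) => U ω i k) data P :=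
    indep_of_indep_of_le_left (hA.fresh s).symm measurable_U.comap_le
  refine measure_le_of_indepFun (X := fun ω i k => U ω i k)
    (S := Prod.fst ⁻¹' {x : Fin n → Fin r → ℝ | (Matrix.of x)ᵀ * Matrix.of x = 1 ∧
        subspaceDist Ustar (Matrix.of x) ≤ δ} ∩
      {x | IterationAccurate X σ δ (fun f ℓ k => Matrix.of fun i c => x.2 (f, ℓ, k, i, c))
        (Matrix.of x.1)}ᶜ)
    (measurable_U.mono (F.le s) le_rfl) measurable_data fresh
    ((measurable_fst (measurableSet_orthonormal_subspaceDist_le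
      (fun i c => by simp only [Matrix.of_apply]; fun_prop) _ _)).inter
    (measurableSet_iterationAccurate
      (fun f ℓ k i c => by simp only [Matrix.of_apply]; fun_prop)
      (fun i c => by simp only [Matrix.of_apply]; fun_prop) _ _ _).compl) fun x => ?_
  by_cases close : (Matrix.of x)ᵀ * Matrix.of x = 1 ∧ subspaceDist Ustar (Matrix.of x) ≤ δ
  · exact (measure_mono fun ω hω => hω.2).trans (hX.measure_not_iterationAccurate_le hm hq hμ0 hμ
      close.1 hδ0 hδ1 close.2 (A := A s) gaussian)
  · exact (measure_mono_null (fun _ hω => close hω.1) measure_empty).trans_le zero_le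

section FailureBound

theorem two_mul_exp_neg_log_le (hn : 2 ≤ n) :
    2 * Real.exp (-(13 * Real.log n)) ≤ ((n : ℝ) ^ 10)⁻¹ / 4 := by
  have n_pos : (0 : ℝ) < n := by positivity
  have n_cube : (2 : ℝ) ^ 3 ≤ (n : ℝ) ^ 3 := by gcongr; exact_mod_cast hn
  calc 2 * Real.exp (-(13 * Real.log n)) = ((n : ℝ) ^ 10)⁻¹ * (2 / (n : ℝ) ^ 3) := by
        rw [Real.exp_neg, show (13 : ℝ) * Real.log n = ((13 : ℕ) : ℝ) * Real.log n by norm_num,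
          Real.exp_nat_mul, Real.exp_log n_pos]
        field_simp
    _ ≤ ((n : ℝ) ^ 10)⁻¹ * (2 / 2 ^ 3) := by gcongr
    _ = ((n : ℝ) ^ 10)⁻¹ / 4 := by ring

theorem five_le_exp_two : (5 : ℝ) ≤ Real.exp 2 := by
  have : (2.7 : ℝ) ≤ Real.exp 1 := by linarith [Real.exp_one_gt_d9]
  calc (5 : ℝ) ≤ 2.7 ^ 2 := by norm_num
    _ ≤ Real.exp 1 ^ 2 := by gcongr
    _ = Real.exp 2 := by rw [← Real.exp_nat_mul]; norm_num

theorem twentyFive_le_exp_four : (25 : ℝ) ≤ Real.exp 4 := by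
  calc (25 : ℝ) = 5 ^ 2 := by norm_num
    _ ≤ Real.exp 2 ^ 2 := by gcongr; exact five_le_exp_two
    _ = Real.exp 4 := by rw [← Real.exp_nat_mul]; norm_num

theorem mul_exp_neg_div_le (hn : 2 ≤ n) (hq : 0 < q)
    (hm : (460800 : ℝ) * max (max (Real.log q) (Real.log n)) r ≤ m) :
    (q : ℝ) * (2 * 25 ^ r * Real.exp (-(m / 25600))) ≤ ((n : ℝ) ^ 10)⁻¹ / 4 := by
  rw [mul_max_of_nonneg _ _ (by norm_num), mul_max_of_nonneg _ _ (by norm_num), max_le_iff,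
    max_le_iff] at hm
  calc (q : ℝ) * (2 * 25 ^ r * Real.exp (-(m / 25600)))
      ≤ Real.exp (Real.log q) * (2 * Real.exp 4 ^ r * Real.exp (-(m / 25600))) := by
        rw [Real.exp_log (Nat.cast_pos.2 hq)]
        gcongr
        exact twentyFive_le_exp_four
    _ = 2 * Real.exp (Real.log q + r * 4 + -(m / 25600)) := by
        rw [← Real.exp_nat_mul, Real.exp_add, Real.exp_add]
        ring
    _ ≤ 2 * Real.exp (-(13 * Real.log n)) := by
        gcongr
        linarith
    _ ≤ ((n : ℝ) ^ 10)⁻¹ / 4 := two_mul_exp_neg_log_le hn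

theorem le_sampleRatio [NeZero r] (hLt : 0 < Lt) (hκ : 0 < kappa σ) (hμ0 : 0 < μ)
    (hC : (38400000 : ℝ) * Lt * kappa σ ^ 4 * μ ^ 2 * (n + r) * r ^ 2 ≤
      ((Lt * ρ : ℕ) : ℝ) * m * q) :
    38400000 * ((n : ℝ) * r) ≤ sampleRatio σ μ m q ρ := by
  have : (0 : ℝ) < r := Nat.cast_pos.2 (NeZero.pos r)
  rw [sampleRatio, le_div_iff₀ (by positivity)]
  refine le_of_mul_le_mul_left ?_ (Nat.cast_pos.2 hLt : (0 : ℝ) < Lt)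
  calc (Lt : ℝ) * (38400000 * ((n : ℝ) * r) * (kappa σ ^ 4 * μ ^ 2 * r))
      = 38400000 * Lt * kappa σ ^ 4 * μ ^ 2 * n * r ^ 2 := by ring
    _ ≤ 38400000 * Lt * kappa σ ^ 4 * μ ^ 2 * (n + r) * r ^ 2 := by gcongr; linarith
    _ ≤ ((Lt * ρ : ℕ) : ℝ) * m * q := hC
    _ = Lt * (ρ * m * q) := by push_cast; ring

theorem mul_exp_neg_sampleRatio_le [NeZero r] (hn : 2 ≤ n)
    (hR : 38400000 * ((n : ℝ) * r) ≤ sampleRatio σ μ m q ρ) :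
    2 * 5 ^ (n * r) * Real.exp (-(sampleRatio σ μ m q ρ / 2560000)) ≤ ((n : ℝ) ^ 10)⁻¹ / 4 := by
  have n_pos : (0 : ℝ) < n := by positivity
  have log_le : Real.log n ≤ n * r := by
    have one_le_r : (1 : ℝ) ≤ r := by exact_mod_cast NeZero.one_le
    calc Real.log n ≤ n := (Real.log_le_sub_one_of_pos n_pos).trans (by linarith)
      _ ≤ n * r := le_mul_of_one_le_right n_pos.le one_le_r
  calc 2 * 5 ^ (n * r) * Real.exp (-(sampleRatio σ μ m q ρ / 2560000))
      ≤ 2 * Real.exp 2 ^ (n * r) * Real.exp (-(sampleRatio σ μ m q ρ / 2560000)) := by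
        gcongr
        exact five_le_exp_two
    _ = 2 * Real.exp (n * r * 2 + -(sampleRatio σ μ m q ρ / 2560000)) := by
        rw [← Real.exp_nat_mul, Real.exp_add]
        push_cast
        ring
    _ ≤ 2 * Real.exp (-(13 * Real.log n)) := by
        gcongr
        linarith
    _ ≤ ((n : ℝ) ^ 10)⁻¹ / 4 := two_mul_exp_neg_log_le hn

theorem failureBound_le [NeZero r] (hn : 2 ≤ n) (hq : 0 < q) (hLt : 0 < Lt) (hρ : 0 < ρ)
    (hκ : 0 < kappa σ) (hμ0 : 0 < μ)
    (hC : (38400000 : ℝ) * Lt * kappa σ ^ 4 * μ ^ 2 * (n + r) * r ^ 2 ≤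
      ((Lt * ρ : ℕ) : ℝ) * m * q)
    (hm : (460800 : ℝ) * max (max (Real.log q) (Real.log n)) r ≤ m) :
    failureBound σ μ m n q Lt ρ ≤ ((Lt * ρ : ℕ) : ℝ) * ((n : ℝ) ^ 10)⁻¹ / 2 := by
  have one_le_ρ : (1 : ℝ) ≤ ρ := by exact_mod_cast hρ
  calc failureBound σ μ m n q Lt ρ
      = Lt * ρ * (q * (2 * 25 ^ r * Real.exp (-(m / 25600)))) +
          Lt * (2 * 5 ^ (n * r) * Real.exp (-(sampleRatio σ μ m q ρ / 2560000))) := by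
        rw [failureBound]
        ring
    _ ≤ Lt * ρ * (((n : ℝ) ^ 10)⁻¹ / 4) + Lt * ρ * (((n : ℝ) ^ 10)⁻¹ / 4) := by
        gcongr
        · exact mul_exp_neg_div_le hn hq hm
        · exact le_mul_of_one_le_right (Nat.cast_nonneg _) one_le_ρ
        · exact mul_exp_neg_sampleRatio_le hn (le_sampleRatio hLt hκ hμ0 hC)
    _ = ((Lt * ρ : ℕ) : ℝ) * ((n : ℝ) ^ 10)⁻¹ / 2 := by push_cast; ring

end FailureBound

end Iteration

/-! ### The error bounds -/

section ErrorBound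

variable {n q r : ℕ} {X : Matrix (Fin n) (Fin q) ℝ} {Ustar : Matrix (Fin n) (Fin r) ℝ}
  {σ : Fin r → ℝ} {V : Matrix (Fin q) (Fin r) ℝ} {η : ℝ}

theorem one_sub_pow_le_exp_neg_mul {a : ℝ} (ha : a ≤ 1) (t : ℕ) :
    (1 - a) ^ t ≤ Real.exp (-(a * t)) :=
  calc (1 - a) ^ t ≤ Real.exp (-a) ^ t :=
        pow_le_pow_left₀ (sub_nonneg.2 ha) (Real.one_sub_le_exp_neg a) t
    _ = Real.exp (-(a * t)) := by
        rw [← Real.exp_nat_mul]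
        ring_nf

theorem errorBound_zero (σ : Fin r → ℝ) (η : ℝ) : errorBound σ η 0 = 0.1 / kappa σ ^ 2 := by
  simp [errorBound]

variable [NeZero r]

namespace IsReducedSVD

theorem div_kappa_sq_le (hX : IsReducedSVD X Ustar σ V) : 0.1 / kappa σ ^ 2 ≤ 0.1 :=
  div_le_self (by norm_num) (one_le_pow₀ hX.one_le_kappa)

theorem errorBound_eq (hX : IsReducedSVD X Ustar σ V) (η : ℝ) (t : ℕ) :
    errorBound σ η t = (1 - 0.12 * (η * sigmaMin σ ^ 2)) ^ t * (0.1 / kappa σ ^ 2) := by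
  have min_ne := hX.sigmaMin_pos.ne'
  have max_ne := hX.sigmaMax_pos.ne'
  have rate : η * sigmaMax σ ^ 2 * (0.12 / kappa σ ^ 2) = 0.12 * (η * sigmaMin σ ^ 2) := by
    rw [kappa]
    field_simp
  rw [errorBound, rate]

theorem errorBound_succ (hX : IsReducedSVD X Ustar σ V) (η : ℝ) (t : ℕ) :
    errorBound σ η (t + 1) = (1 - 0.12 * (η * sigmaMin σ ^ 2)) * errorBound σ η t := by
  rw [hX.errorBound_eq, hX.errorBound_eq, pow_succ]
  ring

theorem errorBound_pos (hX : IsReducedSVD X Ustar σ V) (hη : 0 ≤ η)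
    (hη1 : η * sigmaMax σ ^ 2 ≤ 0.5) (t : ℕ) : 0 < errorBound σ η t := by
  have rate_le := hX.mul_sigmaMin_sq_le hη hη1
  have one_le_kappa := hX.one_le_kappa
  have factor_pos : 0 < 1 - 0.12 * (η * sigmaMin σ ^ 2) := by linarith
  rw [hX.errorBound_eq]
  positivity

theorem antitone_errorBound (hX : IsReducedSVD X Ustar σ V) (hη : 0 ≤ η)
    (hη1 : η * sigmaMax σ ^ 2 ≤ 0.5) : Antitone (errorBound σ η) := by
  refine antitone_nat_of_succ_le fun t => ?_
  rw [hX.errorBound_succ]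
  refine mul_le_of_le_one_left (hX.errorBound_pos hη hη1 t).le ?_
  have : 0 ≤ η * sigmaMin σ ^ 2 := by positivity
  linarith

theorem errorBound_le (hX : IsReducedSVD X Ustar σ V) (hη : 0 ≤ η)
    (hη1 : η * sigmaMax σ ^ 2 ≤ 0.5) (t : ℕ) : errorBound σ η t ≤ 0.1 / kappa σ ^ 2 :=
  (hX.antitone_errorBound hη hη1 (Nat.zero_le t)).trans_eq (errorBound_zero σ η)

theorem errorBound_le_exp (hX : IsReducedSVD X Ustar σ V) (hη : 0 ≤ η)
    (hη1 : η * sigmaMax σ ^ 2 ≤ 0.5) (t : ℕ) :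
    errorBound σ η t ≤ 0.1 * Real.exp (-(0.12 * (η * sigmaMin σ ^ 2) * t)) := by
  have rate_le := hX.mul_sigmaMin_sq_le hη hη1
  rw [hX.errorBound_eq, mul_comm (0.1 : ℝ)]
  refine mul_le_mul ?_ hX.div_kappa_sq_le (by positivity) (Real.exp_pos _).le
  exact one_sub_pow_le_exp_neg_mul (by linarith) t

theorem mul_lt_log_of_lt_errorBound (hX : IsReducedSVD X Ustar σ V) (hη : 0 ≤ η)
    (hη1 : η * sigmaMax σ ^ 2 ≤ 0.5) {ε : ℝ} (hε : 0 < ε) {t : ℕ} (ht : ε < errorBound σ η t) :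
    0.12 * (η * sigmaMin σ ^ 2) * t + 0.9 < Real.log (1 / ε) := by
  have log_lt := Real.log_lt_log hε (ht.trans_le (hX.errorBound_le_exp hη hη1 t))
  rw [Real.log_mul (by norm_num) (Real.exp_pos _).ne', Real.log_exp] at log_lt
  have log_tenth : Real.log 0.1 ≤ -0.9 :=
    (Real.log_le_sub_one_of_pos (by norm_num)).trans (by norm_num)
  rw [one_div, Real.log_inv]
  linarith

theorem exists_errorBound_le (hX : IsReducedSVD X Ustar σ V) (hη : 0 < η)
    (hη1 : η * sigmaMax σ ^ 2 ≤ 0.5) {ε : ℝ} (hε : 0 < ε) : ∃ T, errorBound σ η T ≤ ε := by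
  have rate_pos : 0 < 0.12 * (η * sigmaMin σ ^ 2) :=
    mul_pos (by norm_num) (mul_pos hη (pow_pos hX.sigmaMin_pos 2))
  obtain ⟨T, hT⟩ := exists_nat_gt (Real.log (1 / ε) / (0.12 * (η * sigmaMin σ ^ 2)))
  rw [div_lt_iff₀' rate_pos] at hT
  refine ⟨T, not_lt.1 fun hlt => ?_⟩
  linarith [hX.mul_lt_log_of_lt_errorBound hη.le hη1 hε hlt]

theorem exists_first_errorBound_le (hX : IsReducedSVD X Ustar σ V) (hη : 0 < η)
    (hη1 : η * sigmaMax σ ^ 2 ≤ 0.5) {ε : ℝ} (hε : 0 < ε) (hε1 : ε < 1) :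
    ∃ T : ℕ, errorBound σ η T ≤ ε ∧ (∀ t < T, ε ≤ errorBound σ η t) ∧
      (T : ℝ) ≤ 10 * (kappa σ ^ 2 / (η * sigmaMax σ ^ 2)) * Real.log (1 / ε) := by
  have min_pos := hX.sigmaMin_pos
  have max_pos := hX.sigmaMax_pos
  have log_pos : 0 < Real.log (1 / ε) := Real.log_pos (one_lt_one_div hε hε1)
  have rate_le := hX.mul_sigmaMin_sq_le hη.le hη1
  have inv_rate : kappa σ ^ 2 / (η * sigmaMax σ ^ 2) = 1 / (η * sigmaMin σ ^ 2) := by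
    rw [kappa]
    field_simp
  classical
  have reaches := hX.exists_errorBound_le hη hη1 hε
  refine ⟨Nat.find reaches, Nat.find_spec reaches,
    fun t ht => (not_le.1 (Nat.find_min reaches ht)).le, ?_⟩
  rw [inv_rate]
  rcases h : Nat.find reaches with - | t
  · rw [Nat.cast_zero]
    positivity
  · have before := hX.mul_lt_log_of_lt_errorBound hη.le hη1 hε
      (not_le.1 (Nat.find_min reaches (m := t) (by lia)))
    have : 0 ≤ 0.12 * (η * sigmaMin σ ^ 2) * t := by positivity
    rw [Nat.cast_succ, mul_one_div, div_mul_eq_mul_div, le_div_iff₀ (by positivity)]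
    linarith

end IsReducedSVD

end ErrorBound

/-! ### Aggregation of the batches -/

section Aggregation

variable {m n q r ρ Lt : ℕ} {X : Matrix (Fin n) (Fin q) ℝ} {Ustar : Matrix (Fin n) (Fin r) ℝ}
  {σ : Fin r → ℝ} {V : Matrix (Fin q) (Fin r) ℝ} {U : Matrix (Fin n) (Fin r) ℝ} {δ : ℝ}
  {A : Phase → Node Lt ρ → Fin q → Matrix (Fin m) (Fin n) ℝ} {good : Finset (Node Lt ρ)}
  {Z : Node Lt ρ → Matrix (Fin n) (Fin r) ℝ}

/-- The batches that contain no Byzantine node. -/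
def goodBatches (good : Finset (Node Lt ρ)) : Finset (Fin Lt) :=
  Finset.univ.filter fun θ => ∀ j, (θ, j) ∈ good

theorem card_compl_goodBatches_le (good : Finset (Node Lt ρ)) :
    (goodBatches good)ᶜ.card ≤ goodᶜ.card := by
  refine (Finset.card_le_card fun θ hθ => ?_).trans (Finset.card_image_le (f := Prod.fst))
  simp only [goodBatches, Finset.mem_compl, Finset.mem_filter, Finset.mem_univ, true_and,
    not_forall] at hθ
  obtain ⟨j, hj⟩ := hθ
  exact Finset.mem_image.2 ⟨(θ, j), Finset.mem_compl.2 hj, rfl⟩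

theorem lt_card_goodBatches (hgood : (goodᶜ.card : ℝ) < 0.4 * Lt) :
    0.6 * (Lt : ℝ) < (goodBatches good).card := by
  have compl_le : ((goodBatches good)ᶜ.card : ℝ) ≤ goodᶜ.card := by
    exact_mod_cast card_compl_goodBatches_le good
  have card_add_compl : ((goodBatches good).card : ℝ) + (goodBatches good)ᶜ.card = Lt := by
    exact_mod_cast (Finset.card_add_card_compl _).trans (Fintype.card_fin Lt)
  linarith

namespace IterationAccurate

theorem norm_batchSum_sub_le (hacc : IterationAccurate X σ δ A U)
    (hZ : ∀ ℓ ∈ good, Z ℓ = nodeGradient (A .updateB ℓ) (A .updateU ℓ) X U) {θ : Fin Lt}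
    (hθ : θ ∈ goodBatches good) :
    ‖batchSum Z θ - (ρ * m : ℝ) • expectedGradient U X‖ ≤
      0.031 * δ * sigmaMin σ ^ 2 * (ρ * m) := by
  have honest : batchSum Z θ =
      batchSum (fun ℓ => nodeGradient (A .updateB ℓ) (A .updateU ℓ) X U) θ :=
    Finset.sum_congr rfl fun j _ => hZ _ ((Finset.mem_filter.1 hθ).2 j)
  rw [honest]
  exact hacc.2 θ

theorem goodBatches_subset_keptBatches [NeZero r] (hacc : IterationAccurate X σ δ A U)
    (hX : IsReducedSVD X Ustar σ V) (hU : Uᵀ * U = 1) (hδ : subspaceDist Ustar U ≤ δ)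
    (hδ1 : δ ≤ 0.1 / kappa σ ^ 2)
    (hZ : ∀ ℓ ∈ good, Z ℓ = nodeGradient (A .updateB ℓ) (A .updateU ℓ) X U)
    {thr : ℝ} (hthr : ρ * m * sigmaMin σ ^ 2 ≤ thr) :
    goodBatches good ⊆ keptBatches thr Z := fun θ hθ => by
  have min_pos := hX.sigmaMin_pos
  have kappa_pos := zero_lt_one.trans_le hX.one_le_kappa
  have expected_le : ‖expectedGradient U X‖ ≤ 0.1 * sigmaMin σ ^ 2 :=
    calc ‖expectedGradient U X‖ ≤ 0.1 / kappa σ ^ 2 * sigmaMax σ ^ 2 :=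
          hX.norm_expectedGradient_le hU (hδ.trans hδ1)
      _ = 0.1 * sigmaMin σ ^ 2 := by
          rw [hX.sigmaMax_eq]
          field_simp
  rw [keptBatches, Finset.mem_filter]
  refine ⟨Finset.mem_univ _, ?_⟩
  calc ‖batchSum Z θ‖
      ≤ ‖(ρ * m : ℝ) • expectedGradient U X‖ +
          ‖batchSum Z θ - (ρ * m : ℝ) • expectedGradient U X‖ := norm_le_norm_add_norm_sub' _ _
    _ ≤ ρ * m * (0.1 * sigmaMin σ ^ 2) + 0.031 * 0.1 * sigmaMin σ ^ 2 * (ρ * m) := by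
        rw [norm_smul, Real.norm_of_nonneg (by positivity)]
        refine add_le_add (by gcongr) ((hacc.norm_batchSum_sub_le hZ hθ).trans ?_)
        gcongr
        exact hδ1.trans hX.div_kappa_sq_le
    _ = 0.1031 * (ρ * m * sigmaMin σ ^ 2) := by ring
    _ ≤ ρ * m * sigmaMin σ ^ 2 := mul_le_of_le_one_left (by positivity) (by norm_num)
    _ ≤ thr := hthr

theorem norm_approxGM_sub_le [NeZero r] (hacc : IterationAccurate X σ δ A U)
    (hX : IsReducedSVD X Ustar σ V) (hU : Uᵀ * U = 1) (hδ : subspaceDist Ustar U ≤ δ)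
    (hδ1 : δ ≤ 0.1 / kappa σ ^ 2) (hgood : (goodᶜ.card : ℝ) < 0.4 * Lt)
    (hZ : ∀ ℓ ∈ good, Z ℓ = nodeGradient (A .updateB ℓ) (A .updateU ℓ) X U)
    {Cthr thr εGM : ℝ} (hC : 1 ≤ Cthr) (hthr : thr = Cthr * (ρ * m) * sigmaMin σ ^ 2)
    (hε0 : 0 < εGM) (hε1 : εGM < 1) {T : ℕ} {x : ℕ → Matrix (Fin n) (Fin r) ℝ}
    (hx : LineSearchesSucceed (keptBatches thr Z) (batchSum Z) εGM T x)
    (hT : 12000 * Lt * Cthr * (600 / 601) ^ T ≤ 0.05 * δ) :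
    ‖approxGM (keptBatches thr Z) (batchSum Z) T x - (ρ * m : ℝ) • expectedGradient U X‖ ≤
      0.3 * δ * sigmaMin σ ^ 2 * (ρ * m) := by
  have good_pos : (0 : ℝ) < (goodBatches good).card :=
    (by positivity : (0 : ℝ) ≤ 0.6 * Lt).trans_lt (lt_card_goodBatches hgood)
  have kept_le : ((keptBatches thr Z).card : ℝ) ≤ Lt := by
    exact_mod_cast (Finset.card_le_univ _).trans_eq (Fintype.card_fin Lt)
  have le_thr : ρ * m * sigmaMin σ ^ 2 ≤ thr := by
    rw [hthr, mul_assoc Cthr]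
    exact le_mul_of_one_le_left (by positivity) hC
  have thr_nonneg : 0 ≤ thr := (by positivity : 0 ≤ ρ * m * sigmaMin σ ^ 2).trans le_thr
  have gap_le : 12000 * (keptBatches thr Z).card * thr * (600 / 601) ^ T ≤
      0.05 * δ * (ρ * m * sigmaMin σ ^ 2) :=
    calc 12000 * (keptBatches thr Z).card * thr * (600 / 601) ^ T
        ≤ 12000 * Lt * thr * (600 / 601) ^ T := by gcongr
      _ = 12000 * Lt * Cthr * (600 / 601) ^ T * (ρ * m * sigmaMin σ ^ 2) := by rw [hthr]; ring
      _ ≤ 0.05 * δ * (ρ * m * sigmaMin σ ^ 2) := mul_le_mul_of_nonneg_right hT (by positivity)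
  have close := ByzAltGDmin.norm_approxGM_sub_le hε0 hε1 hx (fun θ hθ => (Finset.mem_filter.1 hθ).2)
    thr_nonneg (hacc.goodBatches_subset_keptBatches hX hU hδ hδ1 hZ le_thr)
    (fun θ hθ => hacc.norm_batchSum_sub_le hZ hθ) (Finset.card_pos.1 (by exact_mod_cast good_pos))
    (by linarith [lt_card_goodBatches hgood])
  have : 0 ≤ δ * sigmaMin σ ^ 2 * (ρ * m) := by
    have := (subspaceDist_nonneg _ _).trans hδ
    positivity
  linarith

theorem vnorm_sub_columnEstimate_le (hacc : IterationAccurate X σ δ A U)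
    (hX : IsReducedSVD X Ustar σ V) (hU : Uᵀ * U = 1) (hδ : subspaceDist Ustar U ≤ δ)
    (ℓ : Node Lt ρ) (k : Fin q) :
    vnorm (X.col k - columnEstimate (A .updateB ℓ k) U (X.col k)) ≤ 1.4 * δ * vnorm (X.col k) := by
  have split : X.col k - columnEstimate (A .updateB ℓ k) U (X.col k) =
      residual U (X.col k) - U *ᵥ (lsCoeff (A .updateB ℓ k) U (X.col k) - Uᵀ *ᵥ X.col k) := by
    rw [columnEstimate, residual, Matrix.mulVec_sub]
    abel
  calc vnorm (X.col k - columnEstimate (A .updateB ℓ k) U (X.col k))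
      ≤ vnorm (residual U (X.col k)) +
          vnorm (lsCoeff (A .updateB ℓ k) U (X.col k) - Uᵀ *ᵥ X.col k) := by
        rw [split, ← vnorm_orthonormal_mulVec hU (_ - _)]
        exact vnorm_sub_le _ _
    _ ≤ 1.1 * vnorm (residual U (X.col k)) := by linarith [hacc.1 ℓ k]
    _ ≤ 1.1 * (δ * vnorm (X.col k)) := by gcongr; exact hX.vnorm_residual_col_le hU hδ k
    _ ≤ 1.4 * δ * vnorm (X.col k) := by
        have := mul_nonneg ((subspaceDist_nonneg _ _).trans hδ) (vnorm_nonneg (X.col k))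
        linarith

end IterationAccurate

/-- The constant `C_gm` of the theorem, as a function of `C_ω`. Each median iteration shrinks the
gap by the factor `600 / 601`, whence the `601`; the gap starts at `12000 N C_ω` and has to drop
to `0.05 ε`, whence the `240000 C_ω`. -/
def gmConstant (Cthr : ℝ) : ℝ := 601 * (1 + Real.log (240000 * Cthr))

theorem one_le_gmConstant {Cthr : ℝ} (hC : 1 ≤ Cthr) : 1 ≤ gmConstant Cthr := by
  have : 0 ≤ Real.log (240000 * Cthr) := Real.log_nonneg (by linarith)
  rw [gmConstant]
  linarith

theorem mul_pow_le_of_gmConstant_mul_log_le {Cthr ε N : ℝ} (hC : 1 ≤ Cthr) (hε : 0 < ε)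
    (hε1 : ε ≤ 0.1) (hN : 1 ≤ N) {T : ℕ} (hT : gmConstant Cthr * Real.log (N / ε) ≤ T) :
    12000 * N * Cthr * (600 / 601) ^ T ≤ 0.05 * ε := by
  have logC_nonneg : 0 ≤ Real.log (240000 * Cthr) := Real.log_nonneg (by linarith)
  have one_le_log : 1 ≤ Real.log (N / ε) := by
    rw [Real.le_log_iff_exp_le (by positivity), le_div_iff₀ hε]
    calc Real.exp 1 * ε ≤ 10 * 0.1 := by gcongr; linarith [Real.exp_one_lt_d9]
      _ ≤ N := by linarith
  have exponent_le : -(T / 601 : ℝ) ≤ -Real.log (N / ε) - Real.log (240000 * Cthr) := by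
    rw [gmConstant] at hT
    have := mul_le_mul_of_nonneg_left one_le_log logC_nonneg
    linarith
  calc 12000 * N * Cthr * (600 / 601) ^ T
      ≤ 12000 * N * Cthr * Real.exp (-Real.log (N / ε) - Real.log (240000 * Cthr)) := by
        gcongr
        calc (600 / 601 : ℝ) ^ T = (1 - 1 / 601) ^ T := by norm_num
          _ ≤ Real.exp (-(1 / 601 * T)) := one_sub_pow_le_exp_neg_mul (by norm_num) T
          _ ≤ Real.exp (-Real.log (N / ε) - Real.log (240000 * Cthr)) := by
              rwa [Real.exp_le_exp, one_div_mul_eq_div]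
    _ = 12000 * N * Cthr * (ε / N / (240000 * Cthr)) := by
        rw [Real.exp_sub, Real.exp_neg, Real.exp_log (by positivity),
          Real.exp_log (by positivity), inv_div]
    _ = 0.05 * ε := by
        field_simp
        norm_num

theorem gap_le_of_gmConstant_mul_log_le [NeZero r] {Cthr ε : ℝ} (hC : 1 ≤ Cthr) (hε : 0 < ε)
    (hε1 : ε ≤ 0.1) (hLρ : 0 < Lt * ρ) {T : ℕ}
    (hT : gmConstant Cthr * Real.log (((Lt * ρ : ℕ) : ℝ) * r / ε) ≤ T) :
    12000 * Lt * Cthr * (600 / 601) ^ T ≤ 0.05 * ε := by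
  have le_nodes : (Lt : ℝ) ≤ ((Lt * ρ : ℕ) : ℝ) * r := by
    exact_mod_cast (Nat.le_mul_of_pos_right Lt (Nat.pos_of_mul_pos_left hLρ)).trans
      (Nat.le_mul_of_pos_right _ (NeZero.pos r))
  have one_le_nodes : (1 : ℝ) ≤ ((Lt * ρ : ℕ) : ℝ) * r := by
    exact_mod_cast Nat.mul_pos hLρ (NeZero.pos r)
  calc 12000 * Lt * Cthr * (600 / 601) ^ T
      ≤ 12000 * (((Lt * ρ : ℕ) : ℝ) * r) * Cthr * (600 / 601) ^ T := by gcongr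
    _ ≤ 0.05 * ε := mul_pow_le_of_gmConstant_mul_log_le hC hε hε1 one_le_nodes hT

end Aggregation

/-! ### The iterations -/

section Run

variable {Ω : Type*} {mΩ : MeasurableSpace Ω} {P : Measure Ω}
variable {m n q r ρ Lt : ℕ} {X : Matrix (Fin n) (Fin q) ℝ} {Ustar : Matrix (Fin n) (Fin r) ℝ}
  {σ : Fin r → ℝ} {V : Matrix (Fin q) (Fin r) ℝ} {η thr Cthr εGM : ℝ} {Tgm t : ℕ}
  {F : Filtration ℕ mΩ} {A : ℕ → Phase → Node Lt ρ → Fin q → Ω → Matrix (Fin m) (Fin n) ℝ}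
  {good : ℕ → Finset (Node Lt ρ)} {Z : ℕ → Node Lt ρ → Ω → Matrix (Fin n) (Fin r) ℝ}
  {x : ℕ → Ω → ℕ → Matrix (Fin n) (Fin r) ℝ} {U : ℕ → Ω → Matrix (Fin n) (Fin r) ℝ} {ω : Ω}

/-- The event that fails with small probability at each time: `U` spans `Ustar` up to `δ`, and
every good node recovers each column of `X` from it up to a relative error `1.4 δ`. -/
def EstimatesAccurate (X : Matrix (Fin n) (Fin q) ℝ) (Ustar : Matrix (Fin n) (Fin r) ℝ) (δ : ℝ)
    (good : Finset (Node Lt ρ)) (A : Node Lt ρ → Fin q → Matrix (Fin m) (Fin n) ℝ)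
    (U : Matrix (Fin n) (Fin r) ℝ) : Prop :=
  subspaceDist Ustar U ≤ δ ∧
    ∀ ℓ ∈ good, ∀ k, vnorm (X.col k - columnEstimate (A ℓ k) U (X.col k)) ≤
      1.4 * δ * vnorm (X.col k)

namespace IsRun

theorem orthonormal (h : IsRun F A X good η thr Tgm Z x U) (s : ℕ) (ω : Ω) :
    (U s ω)ᵀ * U s ω = 1 := by
  cases s with
  | zero => exact h.init ω
  | succ s => exact (h.update s ω).1

variable [NeZero r]

theorem subspaceDist_succ_le (h : IsRun F A X good η thr Tgm Z x U)
    (hX : IsReducedSVD X Ustar σ V) (hm : 0 < m) (hρ : 0 < ρ) (hη : 0 ≤ η)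
    (hη1 : η * sigmaMax σ ^ 2 ≤ 0.5) {s : ℕ}
    (hδ : subspaceDist Ustar (U s ω) ≤ errorBound σ η s)
    (hacc : IterationAccurate X σ (errorBound σ η s) (fun f ℓ k => A s f ℓ k ω) (U s ω))
    (hgood : ((good s)ᶜ.card : ℝ) < 0.4 * Lt) (hC : 1 ≤ Cthr)
    (hthr : thr = Cthr * (ρ * m) * sigmaMin σ ^ 2) (hε0 : 0 < εGM) (hε1 : εGM < 1)
    (hx : GMSucceeds thr εGM Tgm Z x s ω)
    (hT : 12000 * Lt * Cthr * (600 / 601) ^ Tgm ≤ 0.05 * errorBound σ η s) :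
    subspaceDist Ustar (U (s + 1) ω) ≤ errorBound σ η (s + 1) := by
  have bound_le := hX.errorBound_le hη hη1 s
  have ρm_pos : (0 : ℝ) < ρ * m := by positivity
  have median_close := hacc.norm_approxGM_sub_le hX (h.orthonormal s ω) hδ bound_le hgood
    (fun ℓ hℓ => h.honest s ℓ hℓ ω) hC hthr hε0 hε1 hx hT
  rw [hX.errorBound_succ]
  refine hX.subspaceDist_update_le (h.orthonormal s ω) hδ (bound_le.trans hX.div_kappa_sq_le) hη
    hη1 (Y := (ρ * m : ℝ)⁻¹ • approxGM (keptBatches thr fun ℓ => Z s ℓ ω)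
      (batchSum fun ℓ => Z s ℓ ω) Tgm (x s ω)) ?_ ?_
  · rw [← inv_smul_smul₀ ρm_pos.ne' (expectedGradient (U s ω) X), ← smul_sub, norm_smul,
      Real.norm_of_nonneg (by positivity), inv_mul_le_iff₀ ρm_pos, mul_comm (ρ * m : ℝ)]
    exact median_close
  · rw [smul_smul, ← div_eq_mul_inv]
    exact h.update s ω

theorem subspaceDist_le (h : IsRun F A X good η thr Tgm Z x U)
    (hX : IsReducedSVD X Ustar σ V) (hm : 0 < m) (hρ : 0 < ρ) (hη : 0 ≤ η)
    (hη1 : η * sigmaMax σ ^ 2 ≤ 0.5) (hinit : subspaceDist Ustar (U 0 ω) ≤ 0.1 / kappa σ ^ 2)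
    (hgood : ∀ s, ((good s)ᶜ.card : ℝ) < 0.4 * Lt) (hC : 1 ≤ Cthr)
    (hthr : thr = Cthr * (ρ * m) * sigmaMin σ ^ 2) (hε0 : 0 < εGM) (hε1 : εGM < 1)
    (hT : 12000 * Lt * Cthr * (600 / 601) ^ Tgm ≤ 0.05 * errorBound σ η t)
    (hx : ∀ s ≤ t, GMSucceeds thr εGM Tgm Z x s ω)
    (hacc : ∀ s ≤ t, subspaceDist Ustar (U s ω) ≤ errorBound σ η s →
      IterationAccurate X σ (errorBound σ η s) (fun f ℓ k => A s f ℓ k ω) (U s ω))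
    {s : ℕ} (hs : s ≤ t + 1) : subspaceDist Ustar (U s ω) ≤ errorBound σ η s := by
  induction s with
  | zero => rwa [errorBound_zero]
  | succ s ih =>
    have hst : s ≤ t := by lia
    refine h.subspaceDist_succ_le hX hm hρ hη hη1 (ih (by lia)) (hacc s hst (ih (by lia)))
      (hgood s) hC hthr hε0 hε1 (hx s hst) (hT.trans ?_)
    gcongr
    exact hX.antitone_errorBound hη hη1 hst

theorem measure_not_estimatesAccurate_le_failureBound [IsProbabilityMeasure P]
    (h : IsRun F A X good η thr Tgm Z x U) (hA : IsSampleSplitGaussian P F A)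
    (hX : IsReducedSVD X Ustar σ V) (hm : 0 < m) (hq : 0 < q) (hρ : 0 < ρ) {μ : ℝ} (hμ0 : 0 < μ)
    (hμ : RightIncoherent σ V μ) (hη : 0 ≤ η) (hη1 : η * sigmaMax σ ^ 2 ≤ 0.5)
    (hgood : ∀ s, ((good s)ᶜ.card : ℝ) < 0.4 * Lt) (hC : 1 ≤ Cthr)
    (hthr : thr = Cthr * (ρ * m) * sigmaMin σ ^ 2) (hε0 : 0 < εGM) (hε1 : εGM < 1)
    (hT : 12000 * Lt * Cthr * (600 / 601) ^ Tgm ≤ 0.05 * errorBound σ η t)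
    (hinit : ∀ᵐ ω ∂P, subspaceDist Ustar (U 0 ω) ≤ 0.1 / kappa σ ^ 2)
    {cgm : ℝ} (hcgm : 0 ≤ cgm)
    (hgm : P {ω | ¬ ∀ s ≤ t, GMSucceeds thr εGM Tgm Z x s ω} ≤ ENNReal.ofReal cgm) :
    P {ω | ¬ EstimatesAccurate X Ustar (errorBound σ η (t + 1)) (good (t + 1))
        (fun ℓ k => A (t + 1) .updateB ℓ k ω) (U (t + 1) ω)} ≤
      ENNReal.ofReal (cgm + ((t + 2 : ℕ) * failureBound σ μ m n q Lt ρ)) := by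
  set Inaccurate : ℕ → Set Ω := fun s => {ω | ((U s ω)ᵀ * U s ω = 1 ∧
    subspaceDist Ustar (U s ω) ≤ errorBound σ η s) ∧
      ¬ IterationAccurate X σ (errorBound σ η s) (fun f ℓ k => A s f ℓ k ω) (U s ω)}
  have iterations := measure_biUnion_le_of_card_le (S := Inaccurate)
    (N := Finset.range (t + 2)) (k := (t + 2 : ℕ)) (by simp) fun s _ =>
      hA.measure_not_iterationAccurate_le hX hm hq hμ0 hμ (hX.errorBound_pos hη hη1 s)
        (hX.errorBound_le hη hη1 s) s (h.adapted s)
  have cover : {ω | ¬ EstimatesAccurate X Ustar (errorBound σ η (t + 1)) (good (t + 1))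
        (fun ℓ k => A (t + 1) .updateB ℓ k ω) (U (t + 1) ω)} ⊆
      {ω | ¬ subspaceDist Ustar (U 0 ω) ≤ 0.1 / kappa σ ^ 2} ∪
        ({ω | ¬ ∀ s ≤ t, GMSucceeds thr εGM Tgm Z x s ω} ∪
          ⋃ s ∈ Finset.range (t + 2), Inaccurate s) := fun ω not_accurate => by
    contrapose not_accurate
    simp only [Set.mem_union, Set.mem_ofPred_eq, not_or, not_not, Set.mem_iUnion, exists_prop,
      Finset.mem_range, not_exists, not_and, Inaccurate] at not_accurate ⊢
    obtain ⟨init, medians, accurate⟩ := not_accurate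
    have close := h.subspaceDist_le hX hm hρ hη hη1 init hgood hC hthr hε0 hε1 hT medians
      (fun s hs hd => accurate s (by lia) ⟨h.orthonormal s ω, hd⟩) le_rfl
    exact ⟨close, fun ℓ _ k => (accurate (t + 1) (by lia) ⟨h.orthonormal _ ω, close⟩)
      |>.vnorm_sub_columnEstimate_le hX (h.orthonormal _ ω) close ℓ k⟩
  refine (measure_mono cover).trans ((measure_union_le _ _).trans ?_)
  rw [ae_iff.1 hinit, zero_add, ENNReal.ofReal_add hcgm (by rw [failureBound]; positivity)]
  exact (measure_union_le _ _).trans (add_le_add hgm iterations)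

theorem measure_not_estimatesAccurate_le [IsProbabilityMeasure P]
    (h : IsRun F A X good η thr Tgm Z x U) (hA : IsSampleSplitGaussian P F A)
    (hX : IsReducedSVD X Ustar σ V) {μ : ℝ} (hμ0 : 0 < μ) (hμ : RightIncoherent σ V μ)
    (hLρ : 0 < Lt * ρ) (hη : 0 ≤ η) (hη1 : η * sigmaMax σ ^ 2 ≤ 0.5)
    (hmq : (38400000 : ℝ) * Lt * kappa σ ^ 4 * μ ^ 2 * (n + r) * r ^ 2 ≤
      ((Lt * ρ : ℕ) : ℝ) * m * q)
    (hm : (460800 : ℝ) * max (max (Real.log q) (Real.log n)) r ≤ m)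
    (hgood : ∀ s, ((good s)ᶜ.card : ℝ) < 0.4 * Lt) (hC : 1 ≤ Cthr)
    (hthr : thr = Cthr * (ρ * m) * sigmaMin σ ^ 2) (hε0 : 0 < εGM) (hε1 : εGM < 1)
    (hT : 12000 * Lt * Cthr * (600 / 601) ^ Tgm ≤ 0.05 * errorBound σ η t)
    (hinit : ∀ᵐ ω ∂P, subspaceDist Ustar (U 0 ω) ≤ 0.1 / kappa σ ^ 2)
    {cgm : ℝ} (hcgm : 0 ≤ cgm)
    (hgm : P {ω | ¬ ∀ s ≤ t, GMSucceeds thr εGM Tgm Z x s ω} ≤ ENNReal.ofReal cgm) :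
    P {ω | ¬ EstimatesAccurate X Ustar (errorBound σ η (t + 1)) (good (t + 1))
        (fun ℓ k => A (t + 1) .updateB ℓ k ω) (U (t + 1) ω)} ≤
      ENNReal.ofReal (cgm + (t + 1) * (((Lt * ρ : ℕ) : ℝ) * ((n : ℝ) ^ 10)⁻¹)) := by
  have hr := NeZero.pos r
  have hn : 0 < n := hr.trans_le (by simpa using card_le_card_of_orthonormal hX.left_orthonormal)
  have hq : 0 < q := hr.trans_le (by simpa using card_le_card_of_orthonormal hX.right_orthonormal)
  have m_pos : 0 < m := by
    have : (1 : ℝ) ≤ r := by exact_mod_cast hr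
    have : (0 : ℝ) < m := by
      linarith [le_max_right (max (Real.log q) (Real.log n)) (r : ℝ)]
    exact_mod_cast this
  rcases Nat.lt_or_ge n 2 with hn2 | hn2
  · -- For `n = 1` the claimed failure probability is at least `1`.
    obtain rfl : n = 1 := by lia
    refine prob_le_one.trans (ENNReal.one_le_ofReal.2 ?_)
    have : (1 : ℝ) ≤ (t + 1 : ℕ) * (Lt * ρ : ℕ) := by
      exact_mod_cast Nat.mul_pos t.succ_pos hLρ
    push_cast at this ⊢
    linarith
  · have hρ := Nat.pos_of_mul_pos_left hLρ
    refine (h.measure_not_estimatesAccurate_le_failureBound hA hX m_pos hq hρ hμ0 hμ hη hη1 hgood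
      hC hthr hε0 hε1 hT hinit hcgm hgm).trans (ENNReal.ofReal_le_ofReal ?_)
    have failure_le := mul_le_mul_of_nonneg_left (failureBound_le hn2 hq
      (Nat.pos_of_mul_pos_right hLρ) hρ (zero_lt_one.trans_le hX.one_le_kappa) hμ0 hmq hm)
      (Nat.cast_nonneg (α := ℝ) (t + 2))
    have : 0 ≤ (t : ℝ) * (((Lt * ρ : ℕ) : ℝ) * ((n : ℝ) ^ 10)⁻¹) := by positivity
    push_cast at failure_le this ⊢
    linarith

end IsRun

theorem scalarsExchanged_eq (n r T : ℕ) : scalarsExchanged n r T = T * (2 * (n * r)) := by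
  simp only [scalarsExchanged, Finset.sum_const, Finset.card_range, Fintype.card_prod,
    Fintype.card_fin, smul_eq_mul]
  ring

theorem mul_pos_of_lt_mul_div {τ : ℝ} (hτ0 : 0 ≤ τ)
    (hτ : τ < 0.4 * (Lt / ((Lt * ρ : ℕ) : ℝ))) : 0 < Lt * ρ := by
  refine Nat.pos_of_ne_zero fun eq_zero => hτ.not_ge ?_
  rwa [eq_zero, Nat.cast_zero, div_zero, mul_zero]

theorem mul_lt_of_lt_mul_div {τ : ℝ} (hLρ : 0 < Lt * ρ)
    (hτ : τ < 0.4 * (Lt / ((Lt * ρ : ℕ) : ℝ))) : τ * ((Lt * ρ : ℕ) : ℝ) < 0.4 * Lt := by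
  rwa [← mul_div_assoc, lt_div_iff₀ (by exact_mod_cast hLρ)] at hτ

end Run

end

end ByzAltGDmin

theorem mainTheorem3 :
    ∃ C₁ ≥ (1 : ℝ), ∃ C₂ ≥ (1 : ℝ), ∃ C₃ ≥ (1 : ℝ), ∀ Cthr ≥ (1 : ℝ), ∃ Cgm ≥ (1 : ℝ),
    ∀ (n q r mt Lt ρ : ℕ), 0 < r →
    -- the unknown matrix, its reduced SVD and its incoherence
    ∀ (X Ustar σ V) (_ : ByzAltGDmin.IsReducedSVD (n := n) (q := q) (r := r) X Ustar σ V)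
      (μ : ℝ) (_ : 1 ≤ μ) (_ : ByzAltGDmin.RightIncoherent σ V μ)
    -- sample complexity, with `m = L mt` and `L = Lt ρ`
      (_ : C₁ * Lt * ByzAltGDmin.kappa σ ^ 4 * μ ^ 2 * (n + r) * r ^ 2 ≤
        ((Lt * ρ : ℕ) : ℝ) * mt * q)
      (_ : C₂ * max (max (Real.log q) (Real.log n)) r ≤ mt)
    -- Byzantine nodes
      (τ : ℝ) (_ : 0 ≤ τ) (_ : τ < 0.4 * (Lt / ((Lt * ρ : ℕ) : ℝ)))
      (good : ℕ → Finset (ByzAltGDmin.Node Lt ρ))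
      (_ : ∀ s, (((good s)ᶜ.card : ℕ) : ℝ) ≤ τ * ((Lt * ρ : ℕ) : ℝ))
    -- algorithm parameters
      (η : ℝ) (_ : 0 < η) (_ : η ≤ 0.5 / ByzAltGDmin.sigmaMax σ ^ 2)
      (ε : ℝ) (_ : 0 < ε) (_ : ε < 1)
      (Tgm : ℕ) (_ : Cgm * Real.log (((Lt * ρ : ℕ) : ℝ) * r / ε) ≤ Tgm)
      (εGM : ℝ) (_ : 0 < εGM) (_ : εGM < 1)
      (thr : ℝ) (_ : thr = Cthr * (ρ * mt) * ByzAltGDmin.sigmaMin σ ^ 2),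
    -- error decay: at iteration `t`, as long as `δ_t` has not fallen below `ε`
    (∀ (Ω : Type*) [mΩ : MeasurableSpace Ω] (P : Measure Ω) [IsProbabilityMeasure P]
      (F : Filtration ℕ mΩ)
      (A : ℕ → ByzAltGDmin.Phase → ByzAltGDmin.Node Lt ρ → Fin q → Ω →
        Matrix (Fin mt) (Fin n) ℝ)
      (_ : ByzAltGDmin.IsSampleSplitGaussian P F A)
      (Z : ℕ → ByzAltGDmin.Node Lt ρ → Ω → Matrix (Fin n) (Fin r) ℝ)
      (x : ℕ → Ω → ℕ → Matrix (Fin n) (Fin r) ℝ)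
      (U : ℕ → Ω → Matrix (Fin n) (Fin r) ℝ)
      (_ : ByzAltGDmin.IsRun F A X good η thr Tgm Z x U)
      (_ : ∀ᵐ ω ∂P, ByzAltGDmin.subspaceDist Ustar (U 0 ω) ≤ 0.1 / ByzAltGDmin.kappa σ ^ 2)
      (t : ℕ) (_ : ε ≤ ByzAltGDmin.errorBound σ η t)
      (cgm : ℝ) (_ : 0 ≤ cgm)
      (_ : P {ω | ¬ ∀ s ≤ t, ByzAltGDmin.GMSucceeds thr εGM Tgm Z x s ω} ≤ ENNReal.ofReal cgm),
      P {ω | ¬ (ByzAltGDmin.subspaceDist Ustar (U (t + 1) ω) ≤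
              ByzAltGDmin.errorBound σ η (t + 1) ∧
            ∀ ℓ ∈ good (t + 1), ∀ k,
              ‖WithLp.toLp 2 (X.col k - ByzAltGDmin.columnEstimate
                  (A (t + 1) .updateB ℓ k ω) (U (t + 1) ω) (X.col k))‖ ≤
                1.4 * ByzAltGDmin.errorBound σ η (t + 1) * ‖WithLp.toLp 2 (X.col k)‖)} ≤
        ENNReal.ofReal (cgm + (t + 1) *
          (((Lt * ρ : ℕ) : ℝ) * ((n : ℝ) ^ 10)⁻¹ +
            Real.exp (-(((Lt * ρ : ℕ) : ℝ) *
              ByzAltGDmin.psi (0.4 - τ) ((n : ℝ) ^ 10)⁻¹))))) ∧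
    -- communication cost of the iterations needed to reach accuracy `ε`
    (∃ T : ℕ, ByzAltGDmin.errorBound σ η T ≤ ε ∧
      (∀ t < T, ε ≤ ByzAltGDmin.errorBound σ η t) ∧
      (ByzAltGDmin.scalarsExchanged n r T : ℝ) ≤
        C₃ * (ByzAltGDmin.kappa σ ^ 2 / (η * ByzAltGDmin.sigmaMax σ ^ 2)) *
          (n * r * Real.log (1 / ε))) := by
  refine ⟨38400000, by norm_num, 460800, by norm_num, 20, by norm_num, fun Cthr hC =>
    ⟨ByzAltGDmin.gmConstant Cthr, ByzAltGDmin.one_le_gmConstant hC, ?_⟩⟩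
  intro n q r mt Lt ρ hr X Ustar σ V hX μ hμ1 hμ hmq hm τ hτ0 hτ good hgood η hη hη1 ε hε hε1 Tgm
    hT εGM hGM0 hGM1 thr hthr
  have : NeZero r := ⟨hr.ne'⟩
  have hLρ := ByzAltGDmin.mul_pos_of_lt_mul_div hτ0 hτ
  have minority s := (hgood s).trans_lt (ByzAltGDmin.mul_lt_of_lt_mul_div hLρ hτ)
  have step_le : η * ByzAltGDmin.sigmaMax σ ^ 2 ≤ 0.5 :=
    (le_div_iff₀ (pow_pos hX.sigmaMax_pos 2)).1 hη1
  refine ⟨fun Ω mΩ P _ F A hA Z x U hrun hinit t ht cgm hcgm hgm => ?_, ?_⟩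
  · have gap := (ByzAltGDmin.gap_le_of_gmConstant_mul_log_le hC hε
      (ht.trans ((hX.errorBound_le hη.le step_le t).trans hX.div_kappa_sq_le)) hLρ hT).trans
      (mul_le_mul_of_nonneg_left ht (by norm_num))
    refine (hrun.measure_not_estimatesAccurate_le hA hX (zero_lt_one.trans_le hμ1) hμ hLρ hη.le
      step_le hmq hm minority hC hthr hGM0 hGM1 gap hinit hcgm hgm).trans
      (ENNReal.ofReal_le_ofReal ?_)
    gcongr
    exact le_add_of_nonneg_right (Real.exp_pos _).le
  · obtain ⟨T, reached, before, T_le⟩ := hX.exists_first_errorBound_le hη step_le hε hε1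
    refine ⟨T, reached, before, ?_⟩
    rw [ByzAltGDmin.scalarsExchanged_eq]
    push_cast
    exact (mul_le_mul_of_nonneg_right T_le (by positivity)).trans_eq (by ring)
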